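/- \textbf{Lemma.} \emph{Configuration structures.} A configuration structure $(E,C,\ell)$ consists of a set $E$ of events, a labelling $\ell$ of $E$ by names, co-names or $\tau$, and a set $C$ of subsets of $E$ (configurations) satisfying finiteness, coincidence freeness, finite completeness and stability. An isomorphism is a label-preserving bijection of the events whose direct image maps configurations to configurations in both directions. For $x\in C$, the structure generated by $x$ is $x{\downarrow}=(x,\{y\in C\mid y\subseteq x\},\ell{\restriction}x)$. An identified configuration structure is a configuration structure with a function $\mathsf m:E\to\mathbb N$ that is injective on each configuration. Each CCS process $P$ (built from $0$, prefix $\lambda.P$, guarded binary sum $\lambda.P+\nu.Q$, parallel composition and restriction) has its usual encoding $[\![P]\!]$ as a configuration structure (prefixing, coproduct, parallel composition as relabelled and restricted product, restriction). \emph{RCCS.} A thread is $m\rhd P$ with $P$ a CCS process and $m$ a memory stack of fork symbols and memory events $\langle i,\lambda,Q\rangle$, $i\in\mathbb N$; RCCS processes are built from threads by parallel composition and restriction. The forward transitions are generated by: a thread $m\rhd\lambda.P+Q$ (either summand, with $\lambda.P$ read as $\lambda.P+0$) moves by $i:\lambda$ to $\langle i,\lambda,Q\rangle.m\rhd P$ if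 $i$ does not occur in $m$; synchronisation of complementary actions with the same identifier; parallel context, if the identifier does not occur in the other component; restriction context; closure under the structural congruence generated by $m\rhd(P\mid Q)\equiv(\curlyvee.m\rhd P)\mid(\curlyvee.m\rhd Q)$, $m\rhd P\backslash a\equiv(m\rhd P)\backslash a$ for $a$ not free in $m$, and $\alpha$-conversion of restricted names in $P$. Backward transitions are the converses. $R$ is reachable with origin $P$ if a finite sequence of forward and backward transitions leads from $\emptyset\rhd P$ to $R$. \emph{Memory encoding.} $[\![R]\!]_m$ is defined by: $[\![\emptyset]\!]_m$ has no events; forks are ignored; $\langle i,\lambda,Q\rangle.m$ adds to $[\![m]\!]_m$ one event labelled $\lambda$ and identified by $i$, on top of the maximal configurations; $[\![m\rhd P]\!]_m=[\![m]\!]_m$; $[\![R\backslash a]\!]_m=[\![R]\!]_m$; and $[\![R\mid S]\!]_m$ is obtained from the product of $[\![R]\!]_m$ and $[\![S]\!]_m$ by keeping the pairs of events with equal identifiers whose labels are complementary (new label $\tau$) or equal (same label), and the single events whose identifier does not occur on the other side; the common identifier is kept. \emph{Address.} Follow the prefix occurrences of $P$ along a computation from $\emptyset\rhd P$ to $R$.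 The address of $R$ in $[\![P]\!]$ determined by this computation is the set of those events of $[\![P]\!]$ whose prefix occurrences (one, or two for a synchronisation) are exactly those recorded under some one identifier in the memories of $R$, i.e. the events executed and not undone. \emph{Claim.} Let $R$ be a reachable RCCS process with origin $P$. Then $[\![R]\!]_m$ is an identified configuration structure, $R$ has an address in $[\![P]\!]$, and for every address $x$ of $R$ in $[\![P]\!]$: $x$ is a configuration of $[\![P]\!]$, $x{\downarrow}$ is a configuration structure, and the underlying configuration structure of $[\![R]\!]_m$ is isomorphic to $x{\downarrow}$. -/

import Mathlib

universe u v w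

namespace RevCCS

/-! ### Configuration structures -/

/-- The data `(E, C, ℓ)` of a labelled structure: events, configurations, labelling.  The events
form a subset of an ambient type `U`; the values of `lab` outside `E` are irrelevant.  The axioms
are `ConfStruct.IsConf`. -/
structure ConfStruct (U : Type v) (L : Type u) where
  E : Set U
  C : Set (Set U)
  lab : U → L

/-- The axioms of configuration structures. -/
structure ConfStruct.IsConf {U : Type v} {L : Type u} (S : ConfStruct U L) : Prop where
  subset_events : ∀ x ∈ S.C, x ⊆ S.E
  finiteness : ∀ x ∈ S.C, ∀ e ∈ x, ∃ z ∈ S.C, z.Finite ∧ e ∈ z ∧ z ⊆ x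
  coincidence_free : ∀ x ∈ S.C, ∀ e ∈ x, ∀ e' ∈ x, e ≠ e' →
    ∃ z ∈ S.C, z ⊆ x ∧ (e ∈ z ↔ e' ∉ z)
  finite_complete : ∀ X ⊆ S.C, (∃ y ∈ S.C, y.Finite ∧ ∀ x ∈ X, x ⊆ y) → ⋃₀ X ∈ S.C
  stable : ∀ x ∈ S.C, ∀ y ∈ S.C, x ∪ y ∈ S.C → x ∩ y ∈ S.C

/-- An isomorphism of configuration structures over the same label set, the identity on labels: a
label-preserving bijection of the events whose direct image maps configurations to configurations
in both directions. -/
structure ConfStruct.Iso {U : Type v} {V : Type w} {L : Type u}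
    (S : ConfStruct U L) (S' : ConfStruct V L) where
  onE : S.E ≃ S'.E
  lab_eq : ∀ e : S.E, S'.lab (onE e) = S.lab e
  conf_iff : ∀ x : Set S.E,
    (Subtype.val '' x ∈ S.C ↔ Subtype.val '' (onE '' x) ∈ S'.C)

/-- The configuration structure `x↓` generated by a configuration `x`. -/
def ConfStruct.generated {U : Type v} {L : Type u} (S : ConfStruct U L) (x : Set U) :
    ConfStruct U L where
  E := x
  C := {y | y ∈ S.C ∧ y ⊆ x}
  lab := S.lab

/-- The structure without events; its only configuration is `∅`. -/
def ConfStruct.zero {U : Type v} {L : Type u} (lab : U → L) : ConfStruct U L where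
  E := ∅
  C := {∅}
  lab := lab

/-- The product of the category of sets and partial functions: `(a, ⋆)`, `(⋆, b)` and `(a, b)`. -/
inductive StarProd (A : Type v) (B : Type w) : Type (max v w)
  | left (a : A) : StarProd A B
  | right (b : B) : StarProd A B
  | both (a : A) (b : B) : StarProd A B

/-- The first projection; `none` stands for `⋆`. -/
def StarProd.fst {A : Type v} {B : Type w} : StarProd A B → Option A
  | .left a => some a
  | .right _ => none
  | .both a _ => some a

/-- The second projection; `none` stands for `⋆`. -/
def StarProd.snd {A : Type v} {B : Type w} : StarProd A B → Option B
  | .left _ => none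
  | .right b => some b
  | .both _ b => some b

/-- Image of a set under the (partial) first projection. -/
def StarProd.image₁ {A : Type v} {B : Type w} (x : Set (StarProd A B)) : Set A :=
  {a | ∃ e ∈ x, e.fst = some a}

/-- Image of a set under the (partial) second projection. -/
def StarProd.image₂ {A : Type v} {B : Type w} (x : Set (StarProd A B)) : Set B :=
  {b | ∃ e ∈ x, e.snd = some b}

/-- The product; its labels are the labels of the factors and the pairs of labels. -/
def ConfStruct.prod {U : Type v} {V : Type w} {L : Type u}
    (S₁ : ConfStruct U L) (S₂ : ConfStruct V L) : ConfStruct (StarProd U V) (L ⊕ L × L) where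
  E := {e | (∀ a, e.fst = some a → a ∈ S₁.E) ∧ ∀ b, e.snd = some b → b ∈ S₂.E}
  C := {x |
    (∀ e ∈ x, (∀ a, e.fst = some a → a ∈ S₁.E) ∧ ∀ b, e.snd = some b → b ∈ S₂.E) ∧
    StarProd.image₁ x ∈ S₁.C ∧ StarProd.image₂ x ∈ S₂.C ∧
    (∀ e ∈ x, ∀ e' ∈ x,
      ((∃ a, e.fst = some a ∧ e'.fst = some a) ∨ (∃ b, e.snd = some b ∧ e'.snd = some b)) →
        e = e') ∧
    (∀ e ∈ x, ∃ z ⊆ x, z.Finite ∧ StarProd.image₁ z ∈ S₁.C ∧ StarProd.image₂ z ∈ S₂.C ∧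
      e ∈ z) ∧
    (∀ e ∈ x, ∀ e' ∈ x, e ≠ e' → ∃ z ⊆ x,
      StarProd.image₁ z ∈ S₁.C ∧ StarProd.image₂ z ∈ S₂.C ∧ (e ∈ z ↔ e' ∉ z))}
  lab := fun
    | .left a => Sum.inl (S₁.lab a)
    | .right b => Sum.inl (S₂.lab b)
    | .both a b => Sum.inr (S₁.lab a, S₂.lab b)

/-- Relabelling. -/
def ConfStruct.relabel {U : Type v} {L : Type u} {M : Type w} (r : U → M) (S : ConfStruct U L) :
    ConfStruct U M where
  E := S.E
  C := S.C
  lab := r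

/-- Restriction to a set of events. -/
def ConfStruct.restrict {U : Type v} {L : Type u} (S : ConfStruct U L) (F : Set U) :
    ConfStruct U L where
  E := S.E ∩ F
  C := {x | x ∈ S.C ∧ x ⊆ F}
  lab := S.lab

/-- The coproduct. -/
def ConfStruct.coprod {U : Type v} {V : Type w} {L : Type u}
    (S₁ : ConfStruct U L) (S₂ : ConfStruct V L) : ConfStruct (U ⊕ V) L where
  E := Sum.inl '' S₁.E ∪ Sum.inr '' S₂.E
  C := {x | (∃ y ∈ S₁.C, x = Sum.inl '' y) ∨ ∃ y ∈ S₂.C, x = Sum.inr '' y}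
  lab := Sum.elim S₁.lab S₂.lab

/-- Prefixing by a new event `none` labelled `l`. -/
def ConfStruct.prefixing {U : Type v} {L : Type u} (l : L) (S : ConfStruct U L) :
    ConfStruct (Option U) L where
  E := insert none (some '' S.E)
  C := {x | x = ∅ ∨ ∃ y ∈ S.C, x = insert none (some '' y)}
  lab := fun e => e.elim l S.lab

/-- Maximal configurations. -/
def ConfStruct.IsMaximal {U : Type v} {L : Type u} (S : ConfStruct U L) (x : Set U) : Prop :=
  x ∈ S.C ∧ ∀ y ∈ S.C, x = y ∨ ¬ x ⊆ y

/-! ### CCS -/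

/-- Names and co-names. -/
inductive Action (N : Type u) : Type u
  | name (a : N) : Action N
  | coname (a : N) : Action N

/-- The complement. -/
def Action.co {N : Type u} : Action N → Action N
  | .name a => .coname a
  | .coname a => .name a

/-- The name underlying a name or co-name. -/
def Action.base {N : Type u} : Action N → N
  | .name a => a
  | .coname a => a

/-- Renaming. -/
def Action.rename {N : Type u} (f : N → N) : Action N → Action N
  | .name a => .name (f a)
  | .coname a => .coname (f a)

/-- Labels: names, co-names and `τ`. -/
inductive Label (N : Type u) : Type u
  | act (l : Action N) : Label N
  | tau : Label N

/-- The label is `a` or the complement of `a`. -/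
def Label.Mentions {N : Type u} (a : N) : Label N → Prop
  | .act l => l.base = a
  | .tau => False

/-- CCS terms in which every prefix occurrence carries a tag in `T`.  The ordinary CCS processes
are the terms with trivial tags, `CCS N Unit`; no operational or denotational rule looks at the
tags, which only serve to follow prefix occurrences along a computation.
`sum l s P k t Q` is the guarded sum `l.P + k.Q`. -/
inductive CCS (N : Type u) (T : Type) : Type u
  | nil : CCS N T
  | pre (l : Action N) (t : T) (P : CCS N T) : CCS N T
  | sum (l : Action N) (s : T) (P : CCS N T) (k : Action N) (t : T) (Q : CCS N T) : CCS N T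
  | par (P Q : CCS N T) : CCS N T
  | res (P : CCS N T) (a : N) : CCS N T

/-- Apply a function to the tags. -/
def CCS.mapTag {N : Type u} {T T' : Type} (g : T → T') : CCS N T → CCS N T'
  | .nil => .nil
  | .pre l t P => .pre l (g t) (P.mapTag g)
  | .sum l s P k t Q => .sum l (g s) (P.mapTag g) k (g t) (Q.mapTag g)
  | .par P Q => .par (P.mapTag g) (Q.mapTag g)
  | .res P a => .res (P.mapTag g) a

/-- Apply a function to all names, free and bound. -/
def CCS.rename {N : Type u} {T : Type} (f : N → N) : CCS N T → CCS N T
  | .nil => .nil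
  | .pre l t P => .pre (l.rename f) t (P.rename f)
  | .sum l s P k t Q => .sum (l.rename f) s (P.rename f) (k.rename f) t (Q.rename f)
  | .par P Q => .par (P.rename f) (Q.rename f)
  | .res P a => .res (P.rename f) (f a)

/-- Free names. -/
def CCS.freeNames {N : Type u} {T : Type} : CCS N T → Set N
  | .nil => ∅
  | .pre l _ P => insert l.base P.freeNames
  | .sum l _ P k _ Q => insert l.base P.freeNames ∪ insert k.base Q.freeNames
  | .par P Q => P.freeNames ∪ Q.freeNames
  | .res P a => P.freeNames \ {a}

/-- Renaming of bound names. -/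
inductive CCS.AlphaEq {N : Type u} {T : Type} : CCS N T → CCS N T → Prop
  | refl (P) : AlphaEq P P
  | symm {P Q} : AlphaEq P Q → AlphaEq Q P
  | trans {P Q S} : AlphaEq P Q → AlphaEq Q S → AlphaEq P S
  | pre {P P'} (l t) : AlphaEq P P' → AlphaEq (.pre l t P) (.pre l t P')
  | sum {P P' Q Q'} (l s k t) : AlphaEq P P' → AlphaEq Q Q' →
      AlphaEq (.sum l s P k t Q) (.sum l s P' k t Q')
  | par {P P' Q Q'} : AlphaEq P P' → AlphaEq Q Q' → AlphaEq (.par P Q) (.par P' Q')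
  | res {P P'} (a) : AlphaEq P P' → AlphaEq (.res P a) (.res P' a)
  | bound (P) (a : N) (f : N ≃ N) (hf : ∀ n ∈ P.freeNames, n ≠ a → f n = n) :
      AlphaEq (.res P a) (.res (P.rename f) (f a))

/-! ### The encoding of CCS -/

open Classical in
/-- Relabelling of the parallel composition: single labels are kept, pairs of complementary labels
become `τ`, and all other pairs are undefined (`none`). -/
noncomputable def syncLabel {N : Type u} : Label N ⊕ Label N × Label N → Option (Label N)
  | .inl l => some l
  | .inr (.act l, .act k) => if k = l.co then some .tau else none
  | .inr _ => none

/-- Parallel composition: the product, relabelled by `syncLabel` and restricted to the events whose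
new label is defined. -/
noncomputable def ConfStruct.par {U : Type v} {V : Type w} {N : Type u}
    (S₁ : ConfStruct U (Label N)) (S₂ : ConfStruct V (Label N)) :
    ConfStruct (StarProd U V) (Label N) :=
  ((S₁.prod S₂).restrict {e | syncLabel ((S₁.prod S₂).lab e) ≠ none}).relabel
    fun e => (syncLabel ((S₁.prod S₂).lab e)).getD .tau

/-- The type from which the events of the encoding of a CCS process are taken. -/
def CCS.Ev {N : Type u} {T : Type} : CCS N T → Type
  | .nil => Empty
  | .pre _ _ P => Option P.Ev
  | .sum _ _ P _ _ Q => Option P.Ev ⊕ Option Q.Ev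
  | .par P Q => StarProd P.Ev Q.Ev
  | .res P _ => P.Ev

/-- The encoding of CCS processes. -/
noncomputable def CCS.enc {N : Type u} {T : Type} :
    (P : CCS N T) → ConfStruct P.Ev (Label N)
  | .nil => ConfStruct.zero (U := Empty) (fun e => e.elim)
  | .pre l _ P => P.enc.prefixing (.act l)
  | .sum l _ P k _ Q => (P.enc.prefixing (.act l)).coprod (Q.enc.prefixing (.act k))
  | .par P Q => P.enc.par Q.enc
  | .res P a => P.enc.restrict {e | ¬ (P.enc.lab e).Mentions a}

/-! ### RCCS -/

/-- Memory stacks; `event i l t Q m` is `⟨i, l, Q⟩.m`, where `t` is the tag of the prefix `l` that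
was executed. -/
inductive Memory (N : Type u) (T : Type) : Type u
  | empty : Memory N T
  | fork (m : Memory N T) : Memory N T
  | event (i : ℕ) (l : Action N) (t : T) (Q : CCS N T) (m : Memory N T) : Memory N T

/-- Identifiers of a memory. -/
def Memory.ids {N : Type u} {T : Type} : Memory N T → Set ℕ
  | .empty => ∅
  | .fork m => m.ids
  | .event i _ _ _ m => insert i m.ids

/-- Free names of a memory. -/
def Memory.freeNames {N : Type u} {T : Type} : Memory N T → Set N
  | .empty => ∅
  | .fork m => m.freeNames
  | .event _ l _ Q m => insert l.base Q.freeNames ∪ m.freeNames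

/-- Apply a function to the tags. -/
def Memory.mapTag {N : Type u} {T T' : Type} (g : T → T') : Memory N T → Memory N T'
  | .empty => .empty
  | .fork m => .fork (m.mapTag g)
  | .event i l t Q m => .event i l (g t) (Q.mapTag g) (m.mapTag g)

/-- The pairs of an identifier and the tag of a prefix executed under this identifier. -/
def Memory.executed {N : Type u} {T : Type} : Memory N T → Set (ℕ × T)
  | .empty => ∅
  | .fork m => m.executed
  | .event i _ t _ m => insert (i, t) m.executed

/-- RCCS terms; the ordinary RCCS processes are the terms in `RCCS N Unit`. -/
inductive RCCS (N : Type u) (T : Type) : Type u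
  | thread (m : Memory N T) (P : CCS N T) : RCCS N T
  | par (R S : RCCS N T) : RCCS N T
  | res (R : RCCS N T) (a : N) : RCCS N T

/-- Identifiers of an RCCS process. -/
def RCCS.ids {N : Type u} {T : Type} : RCCS N T → Set ℕ
  | .thread m _ => m.ids
  | .par R S => R.ids ∪ S.ids
  | .res R _ => R.ids

/-- Apply a function to the tags. -/
def RCCS.mapTag {N : Type u} {T T' : Type} (g : T → T') : RCCS N T → RCCS N T'
  | .thread m P => .thread (m.mapTag g) (P.mapTag g)
  | .par R S => .par (R.mapTag g) (S.mapTag g)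
  | .res R a => .res (R.mapTag g) a

/-- The pairs of an identifier and the tag of a prefix executed under this identifier. -/
def RCCS.executed {N : Type u} {T : Type} : RCCS N T → Set (ℕ × T)
  | .thread m _ => m.executed
  | .par R S => R.executed ∪ S.executed
  | .res R _ => R.executed

/-- Structural congruence: distribution of memory, scope of restriction and renaming of bound
names. -/
inductive RCCS.Cong {N : Type u} {T : Type} : RCCS N T → RCCS N T → Prop
  | refl (R) : Cong R R
  | symm {R S} : Cong R S → Cong S R
  | trans {R S S'} : Cong R S → Cong S S' → Cong R S'
  | par {R R' S S'} : Cong R R' → Cong S S' → Cong (.par R S) (.par R' S')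
  | res {R R'} (a) : Cong R R' → Cong (.res R a) (.res R' a)
  | distribution (m P Q) :
      Cong (.thread m (.par P Q)) (.par (.thread (.fork m) P) (.thread (.fork m) Q))
  | scope (m P a) (ha : a ∉ m.freeNames) :
      Cong (.thread m (.res P a)) (.res (.thread m P) a)
  | alpha (m) {P Q} (h : P.AlphaEq Q) : Cong (.thread m P) (.thread m Q)

/-- Forward transitions.  A prefix `l.P` is read as `l.P + 0`, and either summand of a sum can be
executed. -/
inductive RCCS.Fwd {N : Type u} {T : Type} : RCCS N T → ℕ → Label N → RCCS N T → Prop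
  | act (m i l t P) (hi : i ∉ m.ids) :
      Fwd (.thread m (.pre l t P)) i (.act l) (.thread (.event i l t .nil m) P)
  | act_left (m i l s P k t Q) (hi : i ∉ m.ids) :
      Fwd (.thread m (.sum l s P k t Q)) i (.act l) (.thread (.event i l s (.pre k t Q) m) P)
  | act_right (m i l s P k t Q) (hi : i ∉ m.ids) :
      Fwd (.thread m (.sum l s P k t Q)) i (.act k) (.thread (.event i k t (.pre l s P) m) Q)
  | syn {R R' S S' i l} : Fwd R i (.act l) R' → Fwd S i (.act l.co) S' →
      Fwd (.par R S) i .tau (.par R' S')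
  | par_left {R R' i α} (S) (hi : i ∉ S.ids) : Fwd R i α R' → Fwd (.par R S) i α (.par R' S)
  | par_right {S S' i α} (R) (hi : i ∉ R.ids) : Fwd S i α S' → Fwd (.par R S) i α (.par R S')
  | res {R R' i α} (a) (ha : ¬ α.Mentions a) : Fwd R i α R' → Fwd (.res R a) i α (.res R' a)
  | cong {R₁ R R' R₁' i α} : Cong R₁ R → Fwd R i α R' → Cong R' R₁' → Fwd R₁ i α R₁'

/-- Backward transitions: every backward rule is the mirror image of a forward rule. -/
def RCCS.Bwd {N : Type u} {T : Type} (R : RCCS N T) (i : ℕ) (α : Label N) (S : RCCS N T) : Prop :=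
  RCCS.Fwd S i α R

/-- Finite sequences of forward and backward transitions. -/
def RCCS.Steps {N : Type u} {T : Type} : RCCS N T → RCCS N T → Prop :=
  Relation.ReflTransGen fun R S => ∃ i α, RCCS.Fwd R i α S ∨ RCCS.Bwd R i α S

/-- `R` is reachable from `∅ ▷ P`, that is, `P` is the origin of `R`. -/
def RCCS.HasOrigin {N : Type u} {T : Type} (R : RCCS N T) (P : CCS N T) : Prop :=
  RCCS.Steps (.thread .empty P) R

/-! ### The address of an RCCS process in the encoding of its origin -/

/-- Tag each prefix occurrence by its position in the term. -/
def CCS.locate {N : Type u} {T : Type} : CCS N T → CCS N (List Bool)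
  | .nil => .nil
  | .pre l _ P => .pre l [] (P.locate.mapTag fun p => false :: p)
  | .sum l _ P k _ Q =>
      .sum l [false] (P.locate.mapTag fun p => false :: false :: p)
        k [true] (Q.locate.mapTag fun p => true :: false :: p)
  | .par P Q => .par (P.locate.mapTag fun p => false :: p) (Q.locate.mapTag fun p => true :: p)
  | .res P a => .res P.locate a

/-- The positions of the prefixes whose execution an event of the encoding represents: one
position, or two for a synchronisation. -/
def CCS.positions {N : Type u} {T : Type} : (P : CCS N T) → P.Ev → Set (List Bool)
  | .nil => fun _ => ∅
  | .pre _ _ P => fun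
      | none => {[]}
      | some e => (fun p => false :: p) '' P.positions e
  | .sum _ _ P _ _ Q => fun
      | .inl none => {[false]}
      | .inl (some e) => (fun p => false :: false :: p) '' P.positions e
      | .inr none => {[true]}
      | .inr (some e) => (fun p => true :: false :: p) '' Q.positions e
  | .par P Q => fun
      | .left e => (fun p => false :: p) '' P.positions e
      | .right e => (fun p => true :: p) '' Q.positions e
      | .both e e' => (fun p => false :: p) '' P.positions e ∪ (fun p => true :: p) '' Q.positions e'
  | .res P _ => P.positions

/-- `x` is the address of `R` in the encoding of its origin `P`: following the prefix occurrences of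
`P` along a computation from `∅ ▷ P` to `R`, the set `x` consists of the events that this
computation has executed and not undone.  An event has been executed under the identifier `i` if the
prefix occurrences it represents are exactly the ones recorded under `i` in the memories. -/
def IsAddress {N : Type u} (P : CCS N Unit) (R : RCCS N Unit) (x : Set P.Ev) : Prop :=
  ∃ R' : RCCS N (List Bool), R'.HasOrigin P.locate ∧ R'.mapTag (fun _ => ()) = R ∧
    x = {e | ∃ i ∈ R'.ids, P.positions e = {p | (i, p) ∈ R'.executed}}

/-! ### Identified configuration structures and the encoding of memories -/

/-- The data of an identified configuration structure. -/
structure IdConfStruct (U : Type v) (L : Type u) (I : Type w) extends ConfStruct U L where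
  ident : U → I

/-- The axioms of identified configuration structures. -/
structure IdConfStruct.IsIdConf {U : Type v} {L : Type u} {I : Type w}
    (D : IdConfStruct U L I) : Prop where
  isConf : D.toConfStruct.IsConf
  collision_free : ∀ x ∈ D.C, ∀ e₁ ∈ x, ∀ e₂ ∈ x, e₁ ≠ e₂ → D.ident e₁ ≠ D.ident e₂

/-- The product of identified configuration structures. -/
def IdConfStruct.prod {U : Type v} {V : Type w} {L : Type u}
    (D₁ : IdConfStruct U L ℕ) (D₂ : IdConfStruct V L ℕ) :
    IdConfStruct (StarProd U V) (L ⊕ L × L) (StarProd ℕ ℕ) where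
  toConfStruct := D₁.toConfStruct.prod D₂.toConfStruct
  ident := fun
    | .left a => .left (D₁.ident a)
    | .right b => .right (D₂.ident b)
    | .both a b => .both (D₁.ident a) (D₂.ident b)

open Classical in
/-- Relabelling of the parallel composition of identified structures; `none` is the label `⊥`. -/
noncomputable def IdConfStruct.parLabel {U : Type v} {V : Type w} {N : Type u}
    (D₁ : IdConfStruct U (Label N) ℕ) (D₂ : IdConfStruct V (Label N) ℕ) :
    StarProd U V → Option (Label N)
  | .left a => if ∃ b ∈ D₂.E, D₁.ident a = D₂.ident b then none else some (D₁.lab a)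
  | .right b => if ∃ a ∈ D₁.E, D₁.ident a = D₂.ident b then none else some (D₂.lab b)
  | .both a b =>
      if D₁.ident a ≠ D₂.ident b then none
      else if ∃ l : Action N, D₁.lab a = .act l ∧ D₂.lab b = .act l.co then some .tau
      else if D₁.lab a = D₂.lab b then some (D₁.lab a)
      else none

/-- The identifiers `(i, ⋆)`, `(⋆, i)` and `(i, i)` of a product are identified with `i`. -/
def collapseId : StarProd ℕ ℕ → ℕ
  | .left i => i
  | .right i => i
  | .both i _ => i

/-- Parallel composition of identified configuration structures. -/
noncomputable def IdConfStruct.par {U : Type v} {V : Type w} {N : Type u}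
    (D₁ : IdConfStruct U (Label N) ℕ) (D₂ : IdConfStruct V (Label N) ℕ) :
    IdConfStruct (StarProd U V) (Label N) ℕ where
  toConfStruct := ((D₁.prod D₂).toConfStruct.restrict {e | D₁.parLabel D₂ e ≠ none}).relabel
    fun e => (D₁.parLabel D₂ e).getD .tau
  ident := fun e => collapseId ((D₁.prod D₂).ident e)

/-- The type from which the events of the encoding of a memory are taken. -/
def Memory.Ev {N : Type u} {T : Type} : Memory N T → Type
  | .empty => Empty
  | .fork m => m.Ev
  | .event _ _ _ _ m => Option m.Ev

/-- Add a new event `none` on top of the maximal configurations. -/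
def IdConfStruct.push {U : Type v} {L : Type u} {I : Type w} (i : I) (l : L)
    (D : IdConfStruct U L I) : IdConfStruct (Option U) L I where
  E := insert none (some '' D.E)
  C := {x | (∃ y ∈ D.C, x = some '' y) ∨
    ∃ y, D.toConfStruct.IsMaximal y ∧ x = insert none (some '' y)}
  lab := fun e => e.elim l D.lab
  ident := fun e => e.elim i D.ident

/-- The encoding of a memory. -/
def Memory.enc {N : Type u} {T : Type} : (m : Memory N T) → IdConfStruct m.Ev (Label N) ℕ
  | .empty =>
      { toConfStruct := ConfStruct.zero (U := Empty) (fun e => e.elim), ident := fun e => e.elim }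
  | .fork m => m.enc
  | .event i l _ _ m => m.enc.push i (.act l)

/-- The type from which the events of the memory encoding of an RCCS process are taken. -/
def RCCS.MemEv {N : Type u} {T : Type} : RCCS N T → Type
  | .thread m _ => m.Ev
  | .par R S => StarProd R.MemEv S.MemEv
  | .res R _ => R.MemEv

/-- The encoding of the memory of an RCCS process. -/
noncomputable def RCCS.encMem {N : Type u} {T : Type} :
    (R : RCCS N T) → IdConfStruct R.MemEv (Label N) ℕ
  | .thread m _ => m.enc
  | .par R S => R.encMem.par S.encMem
  | .res R _ => R.encMem

end RevCCS

/-! Executing a prefix only moves it from the term into a memory, so a reachable process still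
contains its whole origin. Give the prefix occurrences of the origin distinct tags. An event of the
encoding is then determined by the set of tags it executes, one or two of them, and `Sem` is the
encoding written in this form. It is unchanged by α-conversion (`CCS.AlphaEq.sem_eq`), and it has
the closure properties collected in `Sem.Good`.

The invariant is `Der R m s`: the process `R` arises from a thread with memory `m` whose process has
encoding `s`. Its rules read memories back: an event with action `l` and discarded alternative `K`
on top of `m` turns `s` into `l.s + K`, a fork composes two encodings in parallel, and a restriction
restricts. The last two rules also demand that the events executed after `m` form a configuration.
Structural congruence (`RCCS.Cong.der_iff`), forward steps (`RCCS.Fwd.der`) and backward steps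
(`RCCS.Fwd.der_bwd`) preserve the invariant. Hence the events executed on the way from the origin
form a configuration, `R.trace .empty`.

Induction on the same invariant computes the memory encoding (`Der.rep`). Its events have distinct
identifiers. A set of identifiers is a configuration iff it is a chain of `m`, or contains `m` and
leaves a configuration of `s` once `m` is removed. In a parallel composition, an identifier present
on both sides either belongs to the common memory, where the labels agree, or is a synchronisation,
where they are complementary. For empty `m`, the memory encoding is therefore the part of `s` below
the trace.

On the other side, `CCS.link_locate` identifies the usual encoding of the origin with `s`, and `x↓`
becomes the part of `s` below the same trace. Two structures below the same configuration are
isomorphic (`ConfStruct.Below.nonempty_iso`) and inherit the axioms from `Sem.Good`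
(`ConfStruct.Below.isConf`).

The given computation carries no tags; `RCCS.Steps.lift` supplies them. The delicate case is joining
two forked threads, whose memories must agree in their tags as well; the invariant guarantees this.
-/

namespace RevCCS

/-! ### Encodings whose events are sets of tags -/

/-- The encoding of a tagged CCS term with its events represented by the sets of tags of the
prefixes they execute. -/
@[ext]
structure Sem (N : Type u) (T : Type) where
  tags : Set T
  lin : Prop
  evs : Set T → Label N → Prop
  cfg : Set (Set T) → Prop

/-- The nonempty traces of the members of `X` on `τ`. -/
def part {T : Type} (τ : Set T) (X : Set (Set T)) : Set (Set T) :=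
  {B | B.Nonempty ∧ ∃ A ∈ X, A ∩ τ = B}

namespace Sem

variable {N : Type u} {T : Type}

def nil : Sem N T where
  tags := ∅
  lin := True
  evs := fun _ _ => False
  cfg := fun X => X = ∅

/-- The prefix is the event `{t}`. Deleting it from a configuration recovers the configuration of
the continuation provided that `t` is fresh, which `lin` records. -/
def pre (l : Action N) (t : T) (s : Sem N T) : Sem N T where
  tags := insert t s.tags
  lin := s.lin ∧ t ∉ s.tags
  evs := fun A α => (A = {t} ∧ α = .act l) ∨ s.evs A α
  cfg := fun X => X = ∅ ∨ {t} ∈ X ∧ s.cfg (X \ {{t}})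

def choice (s s' : Sem N T) : Sem N T where
  tags := s.tags ∪ s'.tags
  lin := s.lin ∧ s'.lin ∧ Disjoint s.tags s'.tags
  evs := fun A α => s.evs A α ∨ s'.evs A α
  cfg := fun X => s.cfg X ∨ s'.cfg X

/-- Events of a parallel composition. -/
def parEvs (s s' : Sem N T) (A : Set T) (α : Label N) : Prop :=
  s.evs A α ∨ s'.evs A α ∨
    ∃ B C l, s.evs B (.act l) ∧ s'.evs C (.act l.co) ∧ A = B ∪ C ∧ α = .tau

/-- The projections of the product become traces on the two tag sets, and sharing a component
becomes sharing a tag. The finiteness clause of the product has no counterpart, since a term has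
finitely many events. -/
def par (s s' : Sem N T) : Sem N T where
  tags := s.tags ∪ s'.tags
  lin := s.lin ∧ s'.lin ∧ Disjoint s.tags s'.tags
  evs := parEvs s s'
  cfg := fun X => (∀ A ∈ X, ∃ α, parEvs s s' A α) ∧
    s.cfg (part s.tags X) ∧ s'.cfg (part s'.tags X) ∧
    (∀ A ∈ X, ∀ B ∈ X, (A ∩ B).Nonempty → A = B) ∧
    ∀ A ∈ X, ∀ B ∈ X, A ≠ B → ∃ Z ⊆ X, s.cfg (part s.tags Z) ∧ s'.cfg (part s'.tags Z) ∧
      (A ∈ Z ↔ B ∉ Z)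

def res (a : N) (s : Sem N T) : Sem N T where
  tags := s.tags
  lin := s.lin
  evs := fun A α => s.evs A α ∧ ¬ α.Mentions a
  cfg := fun X => s.cfg X ∧ ∀ A ∈ X, ∃ α, s.evs A α ∧ ¬ α.Mentions a

/-- The properties of encodings of terms whose tags are distinct. -/
structure Good (s : Sem N T) : Prop where
  cfg_empty : s.cfg ∅
  exists_evs : ∀ X, s.cfg X → ∀ A ∈ X, ∃ α, s.evs A α
  nonempty : ∀ A α, s.evs A α → A.Nonempty
  subset_tags : ∀ A α, s.evs A α → A ⊆ s.tags
  label_unique : ∀ A α β, s.evs A α → s.evs A β → α = β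
  disj : ∀ X, s.cfg X → ∀ A ∈ X, ∀ B ∈ X, (A ∩ B).Nonempty → A = B
  inter : ∀ X Y Z, s.cfg X → s.cfg Y → s.cfg Z → Y ⊆ X → Z ⊆ X → s.cfg (Y ∩ Z)
  sUnion : ∀ X 𝒴, s.cfg X → (∀ Y ∈ 𝒴, s.cfg Y ∧ Y ⊆ X) → s.cfg (⋃₀ 𝒴)
  separated : ∀ X, s.cfg X → ∀ A ∈ X, ∀ B ∈ X, A ≠ B →
    ∃ Z ⊆ X, s.cfg Z ∧ (A ∈ Z ↔ B ∉ Z)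

theorem good_nil : (nil : Sem N T).Good where
  cfg_empty := rfl
  exists_evs := by rintro X rfl A hA; exact hA.elim
  nonempty := fun _ _ h => h.elim
  subset_tags := fun _ _ h => h.elim
  label_unique := fun _ _ _ h => h.elim
  disj := by rintro X rfl A hA; exact hA.elim
  inter := by
    rintro X Y Z - hY - - -
    simp only [nil] at *
    simp [hY]
  sUnion := by
    rintro X 𝒴 - h
    exact Set.sUnion_eq_empty.2 fun Y hY => (h Y hY).1
  separated := by rintro X rfl A hA; exact hA.elim

theorem Good.notMem_of_tag {s : Sem N T} (h : s.Good) {t : T} (ht : t ∉ s.tags)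
    {X : Set (Set T)} (hX : s.cfg X) {A : Set T} (hA : A ∈ X) : t ∉ A := by
  obtain ⟨α, hα⟩ := h.exists_evs X hX A hA
  exact fun h' => ht (h.subset_tags A α hα h')

theorem Good.notMem_of_tag' {s : Sem N T} (h : s.Good) {t : T} (ht : t ∉ s.tags)
    {X : Set (Set T)} (hX : s.cfg X) : {t} ∉ X :=
  fun hA => h.notMem_of_tag ht hX hA rfl

/-- Since `t` is fresh, deleting `{t}` reduces each closure property to `s`. The configuration
`{{t}}` separates the prefix from every other event. -/
theorem Good.pre {s : Sem N T} (h : s.Good) (l : Action N) {t : T} (ht : t ∉ s.tags) :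
    (s.pre l t).Good where
  cfg_empty := Or.inl rfl
  exists_evs := by
    rintro X (rfl | ⟨-, hX⟩) A hA
    · exact hA.elim
    by_cases hAt : A = {t}
    · exact ⟨_, Or.inl ⟨hAt, rfl⟩⟩
    obtain ⟨α, hα⟩ := h.exists_evs _ hX A ⟨hA, hAt⟩
    exact ⟨α, Or.inr hα⟩
  nonempty := by
    rintro A α (⟨rfl, -⟩ | hA)
    · exact Set.singleton_nonempty t
    · exact h.nonempty A α hA
  subset_tags := by
    rintro A α (⟨rfl, -⟩ | hA)
    · exact Set.singleton_subset_iff.2 (Set.mem_insert _ _)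
    · exact (h.subset_tags A α hA).trans (Set.subset_insert _ _)
  label_unique := by
    rintro A α β (⟨rfl, rfl⟩ | hA) (⟨hB, rfl⟩ | hB)
    · rfl
    · exact (ht (h.subset_tags _ _ hB rfl)).elim
    · exact (ht (h.subset_tags _ _ hA (hB ▸ rfl))).elim
    · exact h.label_unique A α β hA hB
  disj := by
    rintro X (rfl | ⟨-, hX⟩) A hA B hB hAB
    · exact hA.elim
    by_cases hAt : A = {t} <;> by_cases hBt : B = {t}
    · rw [hAt, hBt]
    · subst hAt
      obtain ⟨_, rfl, hu⟩ := hAB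
      exact (h.notMem_of_tag ht hX ⟨hB, hBt⟩ hu).elim
    · subst hBt
      obtain ⟨_, hu, rfl⟩ := hAB
      exact (h.notMem_of_tag ht hX ⟨hA, hAt⟩ hu).elim
    · exact h.disj _ hX A ⟨hA, hAt⟩ B ⟨hB, hBt⟩ hAB
  inter := by
    rintro X Y Z hX hY hZ hYX hZX
    rcases hY with rfl | ⟨htY, hY⟩
    · left; simp
    rcases hZ with rfl | ⟨htZ, hZ⟩
    · left; simp
    rcases hX with rfl | ⟨htX, hX⟩
    · exact (hYX htY).elim
    right
    refine ⟨⟨htY, htZ⟩, ?_⟩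
    have := h.inter _ _ _ hX hY hZ (Set.sdiff_subset_sdiff_left hYX) (Set.sdiff_subset_sdiff_left hZX)
    convert this using 1
    ext A
    simp only [Set.mem_sdiff, Set.mem_inter_iff]
    tauto
  sUnion := by
    rintro X 𝒴 hX h𝒴
    by_cases hne : ∃ Y ∈ 𝒴, {t} ∈ Y
    · right
      obtain ⟨Y, hY, htY⟩ := hne
      refine ⟨⟨Y, hY, htY⟩, ?_⟩
      rcases hX with rfl | ⟨-, hX⟩
      · exact ((h𝒴 Y hY).2 htY).elim
      -- Members of the family without `{t}` are empty, and contribute the empty configuration of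
      -- `s`.
      have := h.sUnion _ ((fun Y => Y \ {{t}}) '' 𝒴) hX (by
        rintro _ ⟨Y, hY, rfl⟩
        refine ⟨?_, Set.sdiff_subset_sdiff_left (h𝒴 Y hY).2⟩
        rcases (h𝒴 Y hY).1 with rfl | ⟨-, h'⟩
        · simpa using h.cfg_empty
        · exact h')
      convert this using 1
      ext A
      simp only [Set.mem_sdiff, Set.mem_sUnion, Set.mem_image]
      constructor
      · rintro ⟨⟨Z, hZ, hA⟩, hAt⟩
        exact ⟨_, ⟨Z, hZ, rfl⟩, hA, hAt⟩
      · rintro ⟨_, ⟨Z, hZ, rfl⟩, hA, hAt⟩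
        exact ⟨⟨Z, hZ, hA⟩, hAt⟩
    · left
      refine Set.sUnion_eq_empty.2 fun Y hY => ?_
      rcases (h𝒴 Y hY).1 with h' | ⟨h', -⟩
      · exact h'
      · exact (hne ⟨Y, hY, h'⟩).elim
  separated := by
    have hsing : (s.pre l t).cfg {{t}} := Or.inr ⟨rfl, by simpa using h.cfg_empty⟩
    rintro X (rfl | ⟨htX, hX⟩) A hA B hB hAB
    · exact hA.elim
    have hsub : {{t}} ⊆ X := Set.singleton_subset_iff.2 htX
    by_cases hAt : A = {t}
    · exact ⟨_, hsub, hsing, iff_of_true hAt (fun hBt => hAB (hAt.trans (Eq.symm hBt)))⟩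
    by_cases hBt : B = {t}
    · exact ⟨_, hsub, hsing, iff_of_false hAt (fun h' => h' hBt)⟩
    obtain ⟨Z, hZX, hZ, hsep⟩ := h.separated _ hX A ⟨hA, hAt⟩ B ⟨hB, hBt⟩ hAB
    -- Nonempty configurations contain the prefix event, so the separator found in `s` is completed
    -- by `{t}`.
    refine ⟨insert {t} Z, Set.insert_subset htX (hZX.trans Set.sdiff_subset), Or.inr ⟨Or.inl rfl, ?_⟩,
      ?_⟩
    · rwa [Set.insert_sdiff_self_of_notMem (h.notMem_of_tag' ht hZ)]
    · simpa [hAt, hBt] using hsep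

theorem choice_comm (s s' : Sem N T) : s.choice s' = s'.choice s := by
  ext
  · simp [choice, or_comm]
  · simp only [choice, disjoint_comm (a := s.tags)]; tauto
  · simp only [choice]; tauto
  · simp only [choice]; tauto

theorem Good.choice {s s' : Sem N T} (h : s.Good) (h' : s'.Good)
    (hd : Disjoint s.tags s'.tags) : (s.choice s').Good := by
  have hev : ∀ A α β, s.evs A α → s'.evs A β → False := fun A α β hA hB => by
    obtain ⟨t, ht⟩ := h.nonempty A α hA
    exact Set.disjoint_left.1 hd (h.subset_tags A α hA ht) (h'.subset_tags A β hB ht)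
  -- A nonempty `Y` from the other summand would share an event with `X`, whose tags would lie in
  -- both disjoint tag sets.
  have key : ∀ X Y, s.cfg X → (s.choice s').cfg Y → Y ⊆ X → s.cfg Y := by
    rintro X Y hX (hY | hY) hYX
    · exact hY
    · suffices Y = ∅ by rw [this]; exact h.cfg_empty
      refine Set.eq_empty_of_forall_notMem fun A hA => ?_
      obtain ⟨α, hα⟩ := h.exists_evs X hX A (hYX hA)
      obtain ⟨β, hβ⟩ := h'.exists_evs Y hY A hA
      exact hev A α β hα hβ
  have key' : ∀ X Y, s'.cfg X → (s.choice s').cfg Y → Y ⊆ X → s'.cfg Y := by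
    rintro X Y hX (hY | hY) hYX
    · suffices Y = ∅ by rw [this]; exact h'.cfg_empty
      refine Set.eq_empty_of_forall_notMem fun A hA => ?_
      obtain ⟨α, hα⟩ := h'.exists_evs X hX A (hYX hA)
      obtain ⟨β, hβ⟩ := h.exists_evs Y hY A hA
      exact hev A β α hβ hα
    · exact hY
  constructor
  · exact Or.inl h.cfg_empty
  · rintro X (hX | hX) A hA
    · exact (h.exists_evs X hX A hA).imp fun _ => Or.inl
    · exact (h'.exists_evs X hX A hA).imp fun _ => Or.inr
  · rintro A α (hA | hA)
    exacts [h.nonempty A α hA, h'.nonempty A α hA]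
  · rintro A α (hA | hA)
    exacts [(h.subset_tags A α hA).trans Set.subset_union_left,
      (h'.subset_tags A α hA).trans Set.subset_union_right]
  · rintro A α β (hA | hA) (hB | hB)
    exacts [h.label_unique A α β hA hB, (hev _ _ _ hA hB).elim, (hev _ _ _ hB hA).elim,
      h'.label_unique A α β hA hB]
  · rintro X (hX | hX)
    exacts [h.disj X hX, h'.disj X hX]
  · rintro X Y Z (hX | hX) hY hZ hYX hZX
    · exact Or.inl (h.inter X Y Z hX (key X Y hX hY hYX) (key X Z hX hZ hZX) hYX hZX)
    · exact Or.inr (h'.inter X Y Z hX (key' X Y hX hY hYX) (key' X Z hX hZ hZX) hYX hZX)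
  · rintro X 𝒴 (hX | hX) h𝒴
    · exact Or.inl (h.sUnion X 𝒴 hX fun Y hY =>
        ⟨key X Y hX (h𝒴 Y hY).1 (h𝒴 Y hY).2, (h𝒴 Y hY).2⟩)
    · exact Or.inr (h'.sUnion X 𝒴 hX fun Y hY =>
        ⟨key' X Y hX (h𝒴 Y hY).1 (h𝒴 Y hY).2, (h𝒴 Y hY).2⟩)
  · rintro X (hX | hX) A hA B hB hAB
    · obtain ⟨Z, h1, h2, h3⟩ := h.separated X hX A hA B hB hAB
      exact ⟨Z, h1, Or.inl h2, h3⟩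
    · obtain ⟨Z, h1, h2, h3⟩ := h'.separated X hX A hA B hB hAB
      exact ⟨Z, h1, Or.inr h2, h3⟩

/-! ### Projections of a parallel composition. -/

theorem part_mono {τ : Set T} {X Y : Set (Set T)} (h : X ⊆ Y) : part τ X ⊆ part τ Y :=
  fun _ ⟨hB, A, hA, hAB⟩ => ⟨hB, A, h hA, hAB⟩

theorem part_empty (τ : Set T) : part τ ∅ = ∅ := by
  simp [part]

theorem part_sUnion (τ : Set T) (𝒴 : Set (Set (Set T))) :
    part τ (⋃₀ 𝒴) = ⋃₀ (part τ '' 𝒴) := by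
  ext B
  simp only [part, Set.mem_sUnion, Set.mem_image, Set.mem_ofPred_eq]
  constructor
  · rintro ⟨hB, A, ⟨Y, hY, hA⟩, rfl⟩
    exact ⟨_, ⟨Y, hY, rfl⟩, hB, A, hA, rfl⟩
  · rintro ⟨_, ⟨Y, hY, rfl⟩, hB, A, hA, rfl⟩
    exact ⟨hB, A, ⟨Y, hY, hA⟩, rfl⟩

/-- Members of `X` with a common tag coincide, so a nonempty trace determines the member it comes
from. -/
theorem part_inter {τ : Set T} {X Y Z : Set (Set T)}
    (hX : ∀ A ∈ X, ∀ B ∈ X, (A ∩ B).Nonempty → A = B) (hY : Y ⊆ X) (hZ : Z ⊆ X) :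
    part τ (Y ∩ Z) = part τ Y ∩ part τ Z := by
  refine Set.Subset.antisymm
    (Set.subset_inter (part_mono Set.inter_subset_left) (part_mono Set.inter_subset_right)) ?_
  rintro B ⟨⟨hB, A, hA, hAB⟩, -, A', hA', hAB'⟩
  have : A = A' := by
    refine hX A (hY hA) A' (hZ hA') ?_
    obtain ⟨t, ht⟩ := hB
    have h1 : t ∈ A ∩ τ := hAB ▸ ht
    have h2 : t ∈ A' ∩ τ := hAB' ▸ ht
    exact ⟨t, h1.1, h2.1⟩
  subst this
  exact ⟨hB, A, ⟨hA, hA'⟩, hAB⟩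

theorem par_cfg_inter_part {s s' : Sem N T} (h : s.Good) (h' : s'.Good) {X Y Z : Set (Set T)}
    (hX : (s.par s').cfg X) (hYX : Y ⊆ X) (hZX : Z ⊆ X)
    (hY : s.cfg (part s.tags Y) ∧ s'.cfg (part s'.tags Y))
    (hZ : s.cfg (part s.tags Z) ∧ s'.cfg (part s'.tags Z)) :
    s.cfg (part s.tags (Y ∩ Z)) ∧ s'.cfg (part s'.tags (Y ∩ Z)) := by
  obtain ⟨-, h1, h2, hd, -⟩ := hX
  rw [part_inter hd hYX hZX, part_inter hd hYX hZX]
  exact ⟨h.inter _ _ _ h1 hY.1 hZ.1 (part_mono hYX) (part_mono hZX),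
    h'.inter _ _ _ h2 hY.2 hZ.2 (part_mono hYX) (part_mono hZX)⟩

/-- Separation is the only condition that needs an argument: a separator inside `X` is intersected
with `Y`, and by stability of the components its projections remain configurations. -/
theorem par_cfg_subset {s s' : Sem N T} (h : s.Good) (h' : s'.Good) {X Y : Set (Set T)}
    (hX : (s.par s').cfg X) (hYX : Y ⊆ X) (hY : s.cfg (part s.tags Y))
    (hY' : s'.cfg (part s'.tags Y)) : (s.par s').cfg Y := by
  refine ⟨fun A hA => hX.1 A (hYX hA), hY, hY', fun A hA B hB => hX.2.2.2.1 A (hYX hA) B (hYX hB),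
    fun A hA B hB hAB => ?_⟩
  obtain ⟨Z, hZX, hZ, hZ', hsep⟩ := hX.2.2.2.2 A (hYX hA) B (hYX hB) hAB
  have := par_cfg_inter_part h h' hX hZX hYX ⟨hZ, hZ'⟩ ⟨hY, hY'⟩
  exact ⟨Z ∩ Y, Set.inter_subset_right, this.1, this.2, by simpa [hA, hB] using hsep⟩

/-- The old configuration `X` itself separates the new event from all the old ones. -/
theorem par_cfg_insert {s s' : Sem N T} {X : Set (Set T)} {A : Set T} {α : Label N}
    (hX : (s.par s').cfg X) (hA : (s.par s').evs A α)
    (h1 : s.cfg (part s.tags (insert A X))) (h2 : s'.cfg (part s'.tags (insert A X)))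
    (hd : ∀ B ∈ insert A X, ∀ C ∈ insert A X, (B ∩ C).Nonempty → B = C) :
    (s.par s').cfg (insert A X) := by
  obtain ⟨hev, hp, hp', -, hsep⟩ := hX
  refine ⟨?_, h1, h2, hd, ?_⟩
  · rintro B (rfl | hB)
    exacts [⟨α, hA⟩, hev B hB]
  · intro B hB C hC hBC
    by_cases hBX : B ∈ X
    · by_cases hCX : C ∈ X
      · obtain ⟨Z, hZ, hZ'⟩ := hsep B hBX C hCX hBC
        exact ⟨Z, hZ.trans (Set.subset_insert _ _), hZ'⟩
      · exact ⟨X, Set.subset_insert _ _, hp, hp', iff_of_true hBX hCX⟩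
    · have hCX : C ∈ X := by
        rcases hC with rfl | hC
        · exact (hBC (hB.resolve_right hBX)).elim
        · exact hC
      exact ⟨X, Set.subset_insert _ _, hp, hp', iff_of_false hBX (fun h => h hCX)⟩

theorem Good.par {s s' : Sem N T} (h : s.Good) (h' : s'.Good)
    (hd : Disjoint s.tags s'.tags) : (s.par s').Good := by
  -- Nonempty events with tags in disjoint sets are incomparable. Hence the tag set of an event
  -- reveals whether it belongs to the left, to the right or to a synchronisation, which makes
  -- labels unique.
  have hev : ∀ A α B β, s.evs A α → s'.evs B β → ¬ A ⊆ B ∧ ¬ B ⊆ A := by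
    intro A α B β hA hB
    obtain ⟨t, ht⟩ := h.nonempty A α hA
    obtain ⟨t', ht'⟩ := h'.nonempty B β hB
    exact ⟨fun hs => Set.disjoint_left.1 hd (h.subset_tags A α hA ht) (h'.subset_tags B β hB (hs ht)),
      fun hs => Set.disjoint_left.1 hd (h.subset_tags A α hA (hs ht')) (h'.subset_tags B β hB ht')⟩
  refine ⟨?_, fun X hX => hX.1, ?_, ?_, ?_, fun X hX => hX.2.2.2.1, ?_, ?_, ?_⟩
  · refine ⟨by simp, ?_, ?_, by simp, by simp⟩
    · rw [part_empty]; exact h.cfg_empty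
    · rw [part_empty]; exact h'.cfg_empty
  · rintro A α (hA | hA | ⟨B, C, l, hB, hC, rfl, rfl⟩)
    exacts [h.nonempty A α hA, h'.nonempty A α hA, (h.nonempty B _ hB).mono Set.subset_union_left]
  · rintro A α (hA | hA | ⟨B, C, l, hB, hC, rfl, rfl⟩)
    exacts [(h.subset_tags A α hA).trans Set.subset_union_left,
      (h'.subset_tags A α hA).trans Set.subset_union_right,
      Set.union_subset_union (h.subset_tags B _ hB) (h'.subset_tags C _ hC)]
  · have hu : ∀ A α B C l, s.evs B (.act l) → s'.evs C (.act l.co) → A = B ∪ C →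
        ¬ s.evs A α ∧ ¬ s'.evs A α := by
      rintro A α B C l hB hC rfl
      exact ⟨fun hA => (hev _ _ _ _ hA hC).2 Set.subset_union_right,
        fun hA => (hev _ _ _ _ hB hA).1 Set.subset_union_left⟩
    rintro A α β (hA | hA | ⟨B, C, l, hB, hC, hA, rfl⟩) (hA' | hA' | ⟨B', C', l', hB', hC', hA', rfl⟩)
    · exact h.label_unique A α β hA hA'
    · exact ((hev _ _ _ _ hA hA').1 subset_rfl).elim
    · exact ((hu _ _ _ _ _ hB' hC' hA').1 hA).elim
    · exact ((hev _ _ _ _ hA' hA).1 subset_rfl).elim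
    · exact h'.label_unique A α β hA hA'
    · exact ((hu _ _ _ _ _ hB' hC' hA').2 hA).elim
    · exact ((hu _ _ _ _ _ hB hC hA).1 hA').elim
    · exact ((hu _ _ _ _ _ hB hC hA).2 hA').elim
    · rfl
  · intro X Y Z hX hY hZ hYX hZX
    have := par_cfg_inter_part h h' hX hYX hZX ⟨hY.2.1, hY.2.2.1⟩ ⟨hZ.2.1, hZ.2.2.1⟩
    exact par_cfg_subset h h' hX (Set.inter_subset_left.trans hYX) this.1 this.2
  · intro X 𝒴 hX h𝒴
    refine par_cfg_subset h h' hX (Set.sUnion_subset fun Y hY => (h𝒴 Y hY).2) ?_ ?_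
    · rw [part_sUnion]
      refine h.sUnion _ _ hX.2.1 ?_
      rintro _ ⟨Y, hY, rfl⟩
      exact ⟨(h𝒴 Y hY).1.2.1, part_mono (h𝒴 Y hY).2⟩
    · rw [part_sUnion]
      refine h'.sUnion _ _ hX.2.2.1 ?_
      rintro _ ⟨Y, hY, rfl⟩
      exact ⟨(h𝒴 Y hY).1.2.2.1, part_mono (h𝒴 Y hY).2⟩
  · intro X hX A hA B hB hAB
    obtain ⟨Z, hZX, hZ, hZ', hsep⟩ := hX.2.2.2.2 A hA B hB hAB
    exact ⟨Z, hZX, par_cfg_subset h h' hX hZX hZ hZ', hsep⟩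

theorem Good.res {s : Sem N T} (h : s.Good) (a : N) : (s.res a).Good where
  cfg_empty := ⟨h.cfg_empty, by simp⟩
  exists_evs := fun X hX => hX.2
  nonempty := fun A α hA => h.nonempty A α hA.1
  subset_tags := fun A α hA => h.subset_tags A α hA.1
  label_unique := fun A α β hA hB => h.label_unique A α β hA.1 hB.1
  disj := fun X hX => h.disj X hX.1
  inter := fun X Y Z hX hY hZ hYX hZX =>
    ⟨h.inter X Y Z hX.1 hY.1 hZ.1 hYX hZX, fun A hA => hY.2 A hA.1⟩
  sUnion := fun X 𝒴 hX h𝒴 =>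
    ⟨h.sUnion X 𝒴 hX.1 fun Y hY => ⟨(h𝒴 Y hY).1.1, (h𝒴 Y hY).2⟩, by
      rintro A ⟨Y, hY, hA⟩
      exact (h𝒴 Y hY).1.2 A hA⟩
  separated := fun X hX A hA B hB hAB => by
    obtain ⟨Z, hZX, hZ, hsep⟩ := h.separated X hX.1 A hA B hB hAB
    exact ⟨Z, hZX, ⟨hZ, fun C hC => hX.2 C (hZX hC)⟩, hsep⟩

/-! ### Laws of choice, prefix and restriction. -/

theorem choice_nil {s : Sem N T} (h : s.cfg ∅) : s.choice nil = s := by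
  ext
  · simp [choice, nil]
  · simp [choice, nil]
  · simp [choice, nil]
  · simp only [choice, nil]
    exact ⟨fun h' => h'.elim id fun h' => h' ▸ h, Or.inl⟩

theorem res_pre {l : Action N} {a : N} (hl : l.base ≠ a) (t : T) (s : Sem N T) :
    (s.pre l t).res a = (s.res a).pre l t := by
  have hm : ¬ (Label.act l).Mentions a := hl
  ext
  · rfl
  · rfl
  · simp only [res, pre]
    constructor
    · rintro ⟨h | h, h'⟩
      exacts [Or.inl h, Or.inr ⟨h, h'⟩]
    · rintro (⟨rfl, rfl⟩ | h)
      exacts [⟨Or.inl ⟨rfl, rfl⟩, hm⟩, ⟨Or.inr h.1, h.2⟩]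
  · rename_i X
    simp only [res, pre]
    constructor
    · rintro ⟨rfl | ⟨ht, hX⟩, h⟩
      · exact Or.inl rfl
      refine Or.inr ⟨ht, hX, ?_⟩
      rintro A ⟨hA, hAt⟩
      obtain ⟨α, ⟨rfl, -⟩ | hα, hα'⟩ := h A hA
      exacts [(hAt rfl).elim, ⟨α, hα, hα'⟩]
    · rintro (rfl | ⟨ht, hX, h⟩)
      · exact ⟨Or.inl rfl, by simp⟩
      refine ⟨Or.inr ⟨ht, hX⟩, fun A hA => ?_⟩
      by_cases hAt : A = {t}
      · exact ⟨_, Or.inl ⟨hAt, rfl⟩, hm⟩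
      · obtain ⟨α, hα, hα'⟩ := h A ⟨hA, hAt⟩
        exact ⟨α, Or.inr hα, hα'⟩

/-- Together with `res_pre`, this lets a restriction pass an executed prefix and its discarded
alternative, as needed for scope changes under a memory. -/
theorem res_choice {s s' : Sem N T} {a : N} (h : (s.choice s').Good) (h1 : s.Good) (h2 : s'.Good)
    (hs' : ∀ A α, s'.evs A α → ¬ α.Mentions a) :
    (s.choice s').res a = (s.res a).choice s' := by
  ext
  · rfl
  · rfl
  · simp only [res, choice]
    constructor
    · rintro ⟨h | h, h'⟩
      exacts [Or.inl ⟨h, h'⟩, Or.inr h]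
    · rintro (h | h)
      exacts [⟨Or.inl h.1, h.2⟩, ⟨Or.inr h, hs' _ _ h⟩]
  · rename_i X
    constructor
    · rintro ⟨hX | hX, h'⟩
      · refine Or.inl ⟨hX, fun A hA => ?_⟩
        obtain ⟨α, hα, hα'⟩ := h' A hA
        -- The label `α` might have been supplied by `s'`; uniqueness of labels in the choice moves
        -- it to `s`.
        obtain ⟨β, hβ⟩ := h1.exists_evs X hX A hA
        obtain rfl := h.label_unique A α β hα (Or.inl hβ)
        exact ⟨α, hβ, hα'⟩
      · exact Or.inr hX
    · rintro (hX | hX)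
      · exact ⟨Or.inl hX.1, fun A hA => (hX.2 A hA).imp fun _ h => ⟨Or.inl h.1, h.2⟩⟩
      · exact ⟨Or.inr hX, fun A hA => (h2.exists_evs X hX A hA).imp fun _ h =>
          ⟨Or.inr h, hs' _ _ h⟩⟩

end Sem

/-! ### The tag encoding of CCS terms -/

/-- The encoding of a tagged term with events represented by sets of tags. -/
def CCS.sem {N : Type u} {T : Type} : CCS N T → Sem N T
  | .nil => .nil
  | .pre l t P => P.sem.pre l t
  | .sum l s P k t Q => (P.sem.pre l s).choice (Q.sem.pre k t)
  | .par P Q => P.sem.par Q.sem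
  | .res P a => P.sem.res a

section

variable {N : Type u} {T : Type}

theorem CCS.good_sem {P : CCS N T} (h : P.sem.lin) : P.sem.Good := by
  induction P with
  | nil => exact Sem.good_nil
  | pre l t P ih => exact (ih h.1).pre l h.2
  | sum l s P k t Q ih ih' => exact ((ih h.1.1).pre l h.1.2).choice ((ih' h.2.1.1).pre k h.2.1.2) h.2.2
  | par P Q ih ih' => exact (ih h.1).par (ih' h.2.1) h.2.2
  | res P a ih => exact (ih h).res a

theorem CCS.base_mem_freeNames {P : CCS N T} {A : Set T} {l : Action N}
    (h : P.sem.evs A (.act l)) : l.base ∈ P.freeNames := by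
  induction P generalizing A l with
  | nil => exact h.elim
  | pre k t P ih =>
    rcases h with ⟨-, h⟩ | h
    · cases h; exact Or.inl rfl
    · exact Or.inr (ih h)
  | sum k s P k' t Q ih ih' =>
    rcases h with (⟨-, h⟩ | h) | (⟨-, h⟩ | h)
    · cases h; exact Or.inl (Or.inl rfl)
    · exact Or.inl (Or.inr (ih h))
    · cases h; exact Or.inr (Or.inl rfl)
    · exact Or.inr (Or.inr (ih' h))
  | par P Q ih ih' =>
    rcases h with h | h | ⟨_, _, _, _, _, _, h⟩
    exacts [Or.inl (ih h), Or.inr (ih' h), by cases h]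
  | res P a ih => exact ⟨ih h.1, h.2⟩

theorem CCS.not_mentions {P : CCS N T} {a : N} (ha : a ∉ P.freeNames) {A : Set T} {α : Label N}
    (h : P.sem.evs A α) : ¬ α.Mentions a := by
  cases α with
  | tau => exact id
  | act l => rintro rfl; exact ha (CCS.base_mem_freeNames h)

/-! ### Renaming and α-conversion. -/

/-- Renaming of labels. -/
def Label.rename (f : N → N) : Label N → Label N
  | .act l => .act (l.rename f)
  | .tau => .tau

theorem Action.rename_co (f : N → N) (l : Action N) : (l.rename f).co = l.co.rename f := by
  cases l <;> rfl

theorem Action.base_rename (f : N → N) (l : Action N) : (l.rename f).base = f l.base := by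
  cases l <;> rfl

theorem Action.rename_rename {f g : N → N} (h : ∀ n, g (f n) = n) (l : Action N) :
    (l.rename f).rename g = l := by
  cases l <;> simp [Action.rename, h]

theorem Action.co_ne (l : Action N) : l.co ≠ l := by
  cases l <;> simp [Action.co]

theorem Action.rename_injective (f : N ≃ N) : Function.Injective (Action.rename f) :=
  Function.LeftInverse.injective (g := Action.rename f.symm)
    fun l => Action.rename_rename f.symm_apply_apply l

theorem Label.rename_mentions (f : N ≃ N) (a : N) (α : Label N) :
    (α.rename f).Mentions (f a) ↔ α.Mentions a := by
  cases α with
  | tau => rfl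
  | act l => simp [Label.rename, Label.Mentions, Action.base_rename]

/-- Renaming of the labels of the events. -/
def Sem.rename (f : N → N) (s : Sem N T) : Sem N T where
  tags := s.tags
  lin := s.lin
  evs := fun A β => ∃ α, s.evs A α ∧ β = α.rename f
  cfg := s.cfg

theorem Sem.rename_pre (f : N → N) (l : Action N) (t : T) (s : Sem N T) :
    (s.pre l t).rename f = (s.rename f).pre (l.rename f) t := by
  ext A β
  · rfl
  · rfl
  · simp only [Sem.rename, Sem.pre]
    constructor
    · rintro ⟨α, ⟨rfl, rfl⟩ | h, rfl⟩
      exacts [Or.inl ⟨rfl, rfl⟩, Or.inr ⟨α, h, rfl⟩]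
    · rintro (⟨rfl, rfl⟩ | ⟨α, h, rfl⟩)
      exacts [⟨_, Or.inl ⟨rfl, rfl⟩, rfl⟩, ⟨α, Or.inr h, rfl⟩]
  · rfl

theorem Sem.rename_choice (f : N → N) (s s' : Sem N T) :
    (s.choice s').rename f = (s.rename f).choice (s'.rename f) := by
  ext A β
  · rfl
  · rfl
  · simp only [Sem.rename, Sem.choice, or_and_right, exists_or]
  · rfl

theorem Sem.rename_par (f : N ≃ N) (s s' : Sem N T) :
    (s.par s').rename f = (s.rename f).par (s'.rename f) := by
  have key : ∀ A β, (∃ α, Sem.parEvs s s' A α ∧ β = α.rename f) ↔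
      Sem.parEvs (s.rename f) (s'.rename f) A β := by
    intro A β
    constructor
    · rintro ⟨α, h | h | ⟨B, C, l, h1, h2, rfl, rfl⟩, rfl⟩
      · exact Or.inl ⟨α, h, rfl⟩
      · exact Or.inr (Or.inl ⟨α, h, rfl⟩)
      · exact Or.inr (Or.inr ⟨B, C, l.rename f, ⟨_, h1, rfl⟩,
          ⟨_, h2, congrArg Label.act (Action.rename_co f l)⟩, rfl, rfl⟩)
    · rintro (⟨α, h, rfl⟩ | ⟨α, h, rfl⟩ | ⟨B, C, l, ⟨α, h1, hα⟩, ⟨α', h2, hα'⟩, rfl, rfl⟩)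
      · exact ⟨α, Or.inl h, rfl⟩
      · exact ⟨α, Or.inr (Or.inl h), rfl⟩
      · cases α with
        | tau => cases hα
        | act k =>
          cases α' with
          | tau => cases hα'
          | act k' =>
            cases hα
            -- Injectivity of `f` matters here: identifying names could create new complementary
            -- pairs.
            have h3 : k' = k.co := Action.rename_injective f
              ((Label.act.inj hα').symm.trans (Action.rename_co f k))
            exact ⟨.tau, Or.inr (Or.inr ⟨B, C, k, h1, h3 ▸ h2, rfl, rfl⟩), rfl⟩
  ext X β
  · rfl
  · rfl
  · exact key X β
  · have : ∀ A, (∃ α, Sem.parEvs s s' A α) ↔ ∃ β, Sem.parEvs (s.rename f) (s'.rename f) A β := by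
      intro A
      simp only [← key]
      exact ⟨fun ⟨α, h⟩ => ⟨_, α, h, rfl⟩, fun ⟨_, α, h, _⟩ => ⟨α, h⟩⟩
    simp only [Sem.rename, Sem.par, this]

theorem Sem.rename_res (f : N ≃ N) (a : N) (s : Sem N T) :
    (s.res a).rename f = (s.rename f).res (f a) := by
  ext X β
  · rfl
  · rfl
  · constructor
    · rintro ⟨α, ⟨h, h'⟩, rfl⟩
      exact ⟨⟨α, h, rfl⟩, by rwa [Label.rename_mentions]⟩
    · rintro ⟨⟨α, h, rfl⟩, h'⟩
      exact ⟨α, ⟨h, by rwa [Label.rename_mentions] at h'⟩, rfl⟩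
  · refine and_congr_right fun _ => forall₂_congr fun A _ => ?_
    constructor
    · rintro ⟨α, h, h'⟩
      exact ⟨_, ⟨α, h, rfl⟩, by rwa [Label.rename_mentions]⟩
    · rintro ⟨_, ⟨α, h, rfl⟩, h'⟩
      exact ⟨α, h, by rwa [Label.rename_mentions] at h'⟩

theorem CCS.sem_rename (f : N ≃ N) (P : CCS N T) : (P.rename f).sem = P.sem.rename f := by
  induction P with
  | nil => ext <;> simp [CCS.rename, CCS.sem, Sem.rename, Sem.nil]
  | pre l t P ih => simp only [CCS.rename, CCS.sem, Sem.rename_pre, ih]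
  | sum l s P k t Q ih ih' =>
    simp only [CCS.rename, CCS.sem, Sem.rename_pre, Sem.rename_choice, ih, ih']
  | par P Q ih ih' => simp only [CCS.rename, CCS.sem, Sem.rename_par, ih, ih']
  | res P a ih => simp only [CCS.rename, CCS.sem, Sem.rename_res, ih]

theorem Sem.rename_eq_self {f : N → N} {s : Sem N T}
    (h : ∀ A α, s.evs A α → α.rename f = α) : s.rename f = s := by
  ext A β
  · rfl
  · rfl
  · constructor
    · rintro ⟨α, hα, rfl⟩; rwa [h A α hα]
    · intro hβ; exact ⟨β, hβ, (h A β hβ).symm⟩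
  · rfl

/-- A visible label that survives the restriction of `a` mentions a free name other than `a`, and
such names are fixed by the renaming. -/
theorem CCS.AlphaEq.sem_eq {P Q : CCS N T} (h : P.AlphaEq Q) : P.sem = Q.sem := by
  induction h with
  | refl => rfl
  | symm _ ih => exact ih.symm
  | trans _ _ ih ih' => exact ih.trans ih'
  | pre l t _ ih => simp only [CCS.sem, ih]
  | sum l s k t _ _ ih ih' => simp only [CCS.sem, ih, ih']
  | par _ _ ih ih' => simp only [CCS.sem, ih, ih']
  | res a _ ih => simp only [CCS.sem, ih]
  | bound P a f hf =>
    simp only [CCS.sem, CCS.sem_rename, ← Sem.rename_res]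
    refine (Sem.rename_eq_self ?_).symm
    rintro A α ⟨hα, ha⟩
    cases α with
    | tau => rfl
    | act l =>
      have h1 := hf _ (CCS.base_mem_freeNames hα) ha
      cases l <;> simpa [Label.rename, Action.rename, Action.base] using h1

end

section

variable {N : Type u} {T : Type}

/-! ### Memories and executed prefixes -/

/-- The tags executed under the identifier `i`. -/
def RCCS.ev (R : RCCS N T) (i : ℕ) : Set T := {t | (i, t) ∈ R.executed}

/-- The events of `R` that are not recorded in the memory `m`. -/
def RCCS.trace (R : RCCS N T) (m : Memory N T) : Set (Set T) := R.ev '' (R.ids \ m.ids)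

/-- The pairs of an identifier and an action executed under it. -/
def Memory.acts : Memory N T → Set (ℕ × Action N)
  | .empty => ∅
  | .fork m => m.acts
  | .event i l _ _ m => insert (i, l) m.acts

/-- The pairs of an identifier and an action executed under it. -/
def RCCS.acts : RCCS N T → Set (ℕ × Action N)
  | .thread m _ => m.acts
  | .par R S => R.acts ∪ S.acts
  | .res R _ => R.acts

/-- The number of constructors of a memory. -/
def Memory.height : Memory N T → ℕ
  | .empty => 0
  | .fork m => m.height + 1
  | .event _ _ _ _ m => m.height + 1

theorem Memory.mem_ids_iff {m : Memory N T} {i : ℕ} : i ∈ m.ids ↔ ∃ t, (i, t) ∈ m.executed := by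
  induction m with
  | empty => simp [Memory.ids, Memory.executed]
  | fork m ih => exact ih
  | event j l t Q m ih =>
    simp only [Memory.ids, Memory.executed, Set.mem_insert_iff, Prod.mk.injEq, exists_or, ih]
    simp

theorem Memory.mem_ids_iff_acts {m : Memory N T} {i : ℕ} : i ∈ m.ids ↔ ∃ l, (i, l) ∈ m.acts := by
  induction m with
  | empty => simp [Memory.ids, Memory.acts]
  | fork m ih => exact ih
  | event j l t Q m ih =>
    simp only [Memory.ids, Memory.acts, Set.mem_insert_iff, Prod.mk.injEq, exists_or, ih]
    simp

theorem RCCS.mem_ids_iff {R : RCCS N T} {i : ℕ} : i ∈ R.ids ↔ ∃ t, (i, t) ∈ R.executed := by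
  induction R with
  | thread m P => exact Memory.mem_ids_iff
  | par R S ih ih' =>
    simp only [RCCS.ids, RCCS.executed, Set.mem_union, exists_or, ih, ih']
  | res R a ih => exact ih

theorem RCCS.mem_ids_iff_acts {R : RCCS N T} {i : ℕ} : i ∈ R.ids ↔ ∃ l, (i, l) ∈ R.acts := by
  induction R with
  | thread m P => exact Memory.mem_ids_iff_acts
  | par R S ih ih' =>
    simp only [RCCS.ids, RCCS.acts, Set.mem_union, exists_or, ih, ih']
  | res R a ih => exact ih

theorem RCCS.ev_nonempty {R : RCCS N T} {i : ℕ} : (R.ev i).Nonempty ↔ i ∈ R.ids :=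
  RCCS.mem_ids_iff.symm

theorem RCCS.ev_eq_empty {R : RCCS N T} {i : ℕ} (h : i ∉ R.ids) : R.ev i = ∅ :=
  Set.not_nonempty_iff_eq_empty.1 (mt RCCS.ev_nonempty.1 h)

theorem RCCS.ev_par (R S : RCCS N T) (i : ℕ) : (R.par S).ev i = R.ev i ∪ S.ev i := rfl

theorem RCCS.ev_thread_event {i : ℕ} {l : Action N} {t : T} {K : CCS N T} {m : Memory N T}
    {P : CCS N T} (hi : i ∉ m.ids) : (RCCS.thread (.event i l t K m) P).ev i = {t} := by
  ext u
  simp only [RCCS.ev, RCCS.executed, Memory.executed]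
  constructor
  · rintro (h | h)
    · cases h; rfl
    · exact (hi (Memory.mem_ids_iff.2 ⟨u, h⟩)).elim
  · rintro rfl; exact Or.inl rfl

/-- `M.Above m`: the memory `M` consists of `m` and further memory events. -/
inductive Memory.Above (m : Memory N T) : Memory N T → Prop
  | refl : Above m m
  | event {M} (i l t K) : Above m M → Above m (.event i l t K M)

theorem Memory.Above.height_le {m M : Memory N T} (h : m.Above M) : m.height ≤ M.height := by
  induction h with
  | refl => exact le_rfl
  | event i l t K _ ih => exact ih.trans (Nat.le_succ _)

theorem Memory.not_above_event {m : Memory N T} (i l t K) :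
    ¬ (Memory.event i l t K m).Above m := fun h => by
  have := h.height_le
  simp [Memory.height] at this

theorem Memory.Above.of_event {i l t K} {m M : Memory N T} (h : (Memory.event i l t K m).Above M) :
    m.Above M := by
  induction h with
  | refl => exact .event _ _ _ _ .refl
  | event i l t K _ ih => exact .event _ _ _ _ ih

theorem Memory.Above.ids_subset {m M : Memory N T} (h : m.Above M) : m.ids ⊆ M.ids := by
  induction h with
  | refl => exact subset_rfl
  | event i l t K _ ih => exact ih.trans (Set.subset_insert _ _)

theorem Memory.Above.freeNames_subset {m M : Memory N T} (h : m.Above M) :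
    m.freeNames ⊆ M.freeNames := by
  induction h with
  | refl => exact subset_rfl
  | event i l t K _ ih => exact ih.trans Set.subset_union_right

/-- Only events are added in `Above`, and the upper memory has a fork on top. -/
theorem Memory.Above.fork_eq {m M : Memory N T} (h : (Memory.fork m).Above (.fork M)) : m = M := by
  cases h; rfl

theorem Memory.Above.event_event {i l t K j k u L} {m M : Memory N T}
    (h : (Memory.event i l t K m).Above (.event j k u L M)) :
    Memory.event i l t K m = .event j k u L M ∨ (Memory.event i l t K m).Above M := by
  cases h with
  | refl => exact Or.inl rfl
  | event _ _ _ _ h => exact Or.inr h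

/-! ### Derivatives of a thread -/

/-- `Der R m s`: the process `R` is reached from a thread with memory `m` whose process has the
encoding `s`. -/
inductive Der : RCCS N T → Memory N T → Sem N T → Prop
  | base (m P) : Der (.thread m P) m P.sem
  | event {R m s} (i l t K) : i ∉ m.ids → Der R (.event i l t K m) s →
      Der R m ((s.pre l t).choice K.sem)
  | par {R S m s s'} : Der R (.fork m) s → Der S (.fork m) s' →
      (s.par s').cfg ((R.par S).trace m) → Der (.par R S) m (s.par s')
  | res {R m s} (a) : a ∉ m.freeNames → Der R m s → (s.res a).cfg (R.trace m) → Der (.res R a) m (s.res a)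

theorem Der.ids_subset {R : RCCS N T} {m s} (h : Der R m s) : m.ids ⊆ R.ids := by
  induction h with
  | base m P => exact subset_rfl
  | event i l t K _ _ ih => exact (Set.subset_insert _ _).trans ih
  | par _ _ _ ih _ => exact Set.Subset.trans ih Set.subset_union_left
  | res a _ _ _ ih => exact ih

theorem Der.acts_subset {R : RCCS N T} {m s} (h : Der R m s) : m.acts ⊆ R.acts := by
  induction h with
  | base m P => exact subset_rfl
  | event i l t K _ _ ih => exact (Set.subset_insert _ _).trans ih
  | par _ _ _ ih _ => exact Set.Subset.trans ih Set.subset_union_left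
  | res a _ _ _ ih => exact ih

/-- Every later event has an identifier that is fresh for the memory below it, and both sides of a
fork copy `m`; so nothing is added under an identifier of `m`. -/
theorem Der.executed_iff {R : RCCS N T} {m s} (h : Der R m s) {i : ℕ} (hi : i ∈ m.ids) (t : T) :
    (i, t) ∈ R.executed ↔ (i, t) ∈ m.executed := by
  induction h with
  | base m P => rfl
  | event j l u K hj _ ih =>
    rw [ih (Or.inr hi)]
    refine or_iff_right fun h => hj ?_
    cases h
    exact hi
  | par _ _ _ ih ih' => exact (or_congr (ih hi) (ih' hi)).trans (or_self_iff)
  | res a _ _ _ ih => exact ih hi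

theorem Der.ev_event {R : RCCS N T} {i l t K m s} (h : Der R (.event i l t K m) s)
    (hi : i ∉ m.ids) : R.ev i = {t} := by
  rw [← RCCS.ev_thread_event (l := l) (t := t) (K := K) (P := .nil) hi]
  ext u
  exact h.executed_iff (Or.inl rfl) u

theorem Der.trace_event {R : RCCS N T} {i l t K m s} (h : Der R (.event i l t K m) s)
    (hi : i ∉ m.ids) : R.trace m = insert {t} (R.trace (.event i l t K m)) := by
  have : R.ids \ m.ids = insert i (R.ids \ (Memory.event i l t K m).ids) := by
    ext j
    have h2 : i ∈ R.ids := h.ids_subset (Or.inl rfl)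
    simp only [Memory.ids, Set.mem_sdiff, Set.mem_insert_iff]
    by_cases hj : j = i
    · subst hj; simp [h2, hi]
    · simp [hj]
  rw [RCCS.trace, this, Set.image_insert_eq, h.ev_event hi]
  rfl

theorem Der.ev_subset {R : RCCS N T} {m s} (h : Der R m s) {i : ℕ} (hi : i ∉ m.ids) :
    R.ev i ⊆ s.tags := by
  induction h with
  | base m P => rw [RCCS.ev_eq_empty hi]; exact Set.empty_subset _
  | event j l u K hj h ih =>
    by_cases hij : i = j
    · subst hij
      rw [h.ev_event hj]
      exact Set.singleton_subset_iff.2 (Or.inl (Or.inl rfl))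
    · exact (ih (fun h => h.elim hij hi)).trans
        ((Set.subset_insert _ _).trans Set.subset_union_left)
  | par _ _ _ ih ih' => exact Set.union_subset_union (ih hi) (ih' hi)
  | res a _ _ _ ih => exact ih hi

theorem Der.good {R : RCCS N T} {m s} (h : Der R m s) (hs : s.lin) : s.Good := by
  induction h with
  | base m P => exact CCS.good_sem hs
  | event i l t K _ _ ih =>
    exact ((ih hs.1.1).pre l hs.1.2).choice (CCS.good_sem hs.2.1) hs.2.2
  | par _ _ _ ih ih' => exact (ih hs.1).par (ih' hs.2.1) hs.2.2
  | res a _ _ _ ih => exact (ih hs).res a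

theorem par_id_unique {R S : RCCS N T} {m s s'} (hR : Der R (.fork m) s) (hS : Der S (.fork m) s')
    (hd : Disjoint s.tags s'.tags)
    (h1 : ∀ i j t, i ∉ m.ids → j ∉ m.ids → (i, t) ∈ R.executed → (j, t) ∈ R.executed → i = j)
    (h2 : ∀ i j t, i ∉ m.ids → j ∉ m.ids → (i, t) ∈ S.executed → (j, t) ∈ S.executed → i = j) :
    ∀ i j t, i ∉ m.ids → j ∉ m.ids → (i, t) ∈ (R.par S).executed →
      (j, t) ∈ (R.par S).executed → i = j := by
  rintro i j t hi hj (h | h) (h' | h')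
  · exact h1 i j t hi hj h h'
  · exact (Set.disjoint_left.1 hd (hR.ev_subset hi h) (hS.ev_subset hj h')).elim
  · exact (Set.disjoint_left.1 hd (hR.ev_subset hj h') (hS.ev_subset hi h)).elim
  · exact h2 i j t hi hj h h'

/-- A tag is consumed only once: the tag of a prefix does not recur in its continuation, and
parallel components have disjoint tags. Outside `m`, executed events with different identifiers are
therefore disjoint. -/
theorem Der.id_unique {R : RCCS N T} {m s} (h : Der R m s) (hs : s.lin) :
    ∀ i j t, i ∉ m.ids → j ∉ m.ids → (i, t) ∈ R.executed → (j, t) ∈ R.executed → i = j := by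
  induction h with
  | base m P =>
    intro i j t hi hj h
    exact (hi (RCCS.mem_ids_iff.2 ⟨t, h⟩)).elim
  | @event R m s k l u K hk h ih =>
    intro i j t hi hj h1 h2
    by_cases hik : i = k <;> by_cases hjk : j = k
    · exact hik.trans hjk.symm
    · subst hik
      have h3 : t ∈ R.ev i := h1
      rw [h.ev_event hk] at h3
      obtain rfl := h3
      exact (hs.1.2 (h.ev_subset (fun h => h.elim hjk hj) h2)).elim
    · subst hjk
      have h3 : t ∈ R.ev j := h2
      rw [h.ev_event hk] at h3
      obtain rfl := h3
      exact (hs.1.2 (h.ev_subset (fun h => h.elim hik hi) h1)).elim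
    · exact ih hs.1.1 i j t (fun h => h.elim hik hi) (fun h => h.elim hjk hj) h1 h2
  | par hR hS _ ih ih' => exact par_id_unique hR hS hs.2.2 (ih hs.1) (ih' hs.2.1)
  | res a _ _ _ ih => exact ih hs

theorem RCCS.trace_thread_self (m : Memory N T) (P : CCS N T) :
    (RCCS.thread m P).trace m = ∅ := by
  simp [RCCS.trace, RCCS.ids]

theorem Der.singleton_notMem_trace {R : RCCS N T} {m s} (h : Der R m s) {t : T}
    (ht : t ∉ s.tags) : {t} ∉ R.trace m := by
  rintro ⟨i, ⟨-, hi⟩, hit⟩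
  exact ht (h.ev_subset hi (hit ▸ rfl))

theorem Der.trace_cfg {R : RCCS N T} {m s} (h : Der R m s) (hs : s.lin) : s.cfg (R.trace m) := by
  induction h with
  | base m P => rw [RCCS.trace_thread_self]; exact (CCS.good_sem hs).cfg_empty
  | event i l t K hi h ih =>
    refine Or.inl (Or.inr ?_)
    rw [h.trace_event hi]
    refine ⟨Or.inl rfl, ?_⟩
    rw [Set.insert_sdiff_self_of_notMem (h.singleton_notMem_trace hs.1.2)]
    exact ih hs.1.1
  | par _ _ h _ _ => exact h
  | res a _ _ h _ => exact h

theorem par_ev_inter {R S : RCCS N T} {m s s'} (hR : Der R (.fork m) s)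
    (hS : Der S (.fork m) s') (hd : Disjoint s.tags s'.tags) {i : ℕ} (hi : i ∉ m.ids) :
    (R.par S).ev i ∩ s.tags = R.ev i ∧ (R.par S).ev i ∩ s'.tags = S.ev i := by
  rw [RCCS.ev_par, Set.union_inter_distrib_right, Set.union_inter_distrib_right,
    Set.inter_eq_left.2 (hR.ev_subset hi), Set.inter_eq_left.2 (hS.ev_subset hi),
    (hd.mono_left (hR.ev_subset hi)).inter_eq, (hd.symm.mono_left (hS.ev_subset hi)).inter_eq]
  simp

/-- Cutting a joint event down to the tags of one component leaves what that component recorded.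
Empty contributions are dropped by `part`, whence the intersection with the identifiers of the
component. -/
theorem part_image_ev {R S : RCCS N T} {m s s'} (hR : Der R (.fork m) s)
    (hS : Der S (.fork m) s') (hd : Disjoint s.tags s'.tags) {c : Set ℕ} (hc : Disjoint c m.ids) :
    part s.tags ((R.par S).ev '' c) = R.ev '' (c ∩ R.ids) ∧
      part s'.tags ((R.par S).ev '' c) = S.ev '' (c ∩ S.ids) := by
  constructor
  · ext B
    constructor
    · rintro ⟨hB, _, ⟨i, hi, rfl⟩, rfl⟩
      rw [(par_ev_inter hR hS hd (Set.disjoint_left.1 hc hi)).1] at hB ⊢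
      exact ⟨i, ⟨hi, RCCS.ev_nonempty.1 hB⟩, rfl⟩
    · rintro ⟨i, ⟨hi, hi'⟩, rfl⟩
      exact ⟨RCCS.ev_nonempty.2 hi', _, ⟨i, hi, rfl⟩,
        (par_ev_inter hR hS hd (Set.disjoint_left.1 hc hi)).1⟩
  · ext B
    constructor
    · rintro ⟨hB, _, ⟨i, hi, rfl⟩, rfl⟩
      rw [(par_ev_inter hR hS hd (Set.disjoint_left.1 hc hi)).2] at hB ⊢
      exact ⟨i, ⟨hi, RCCS.ev_nonempty.1 hB⟩, rfl⟩
    · rintro ⟨i, ⟨hi, hi'⟩, rfl⟩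
      exact ⟨RCCS.ev_nonempty.2 hi', _, ⟨i, hi, rfl⟩,
        (par_ev_inter hR hS hd (Set.disjoint_left.1 hc hi)).2⟩

theorem part_trace {R S : RCCS N T} {m s s'} (hR : Der R (.fork m) s)
    (hS : Der S (.fork m) s') (hd : Disjoint s.tags s'.tags) :
    part s.tags ((R.par S).trace m) = R.trace (.fork m) ∧
      part s'.tags ((R.par S).trace m) = S.trace (.fork m) := by
  have := part_image_ev hR hS hd (c := (R.par S).ids \ m.ids) Set.disjoint_sdiff_left
  have e1 : ((R.par S).ids \ m.ids) ∩ R.ids = R.ids \ m.ids := by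
    ext; simp only [RCCS.ids, Set.mem_inter_iff, Set.mem_sdiff, Set.mem_union]; tauto
  have e2 : ((R.par S).ids \ m.ids) ∩ S.ids = S.ids \ m.ids := by
    ext; simp only [RCCS.ids, Set.mem_inter_iff, Set.mem_sdiff, Set.mem_union]; tauto
  rwa [e1, e2] at this

/-- Restores the configuration condition of `Der.par` after a backward step, when the trace has
shrunk. -/
theorem Der.par_of_subset {R S : RCCS N T} {m s s'} (hR : Der R (.fork m) s)
    (hS : Der S (.fork m) s') (hs : (s.par s').lin) {X : Set (Set T)} (hX : (s.par s').cfg X)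
    (h : (R.par S).trace m ⊆ X) : Der (R.par S) m (s.par s') := by
  refine .par hR hS (Sem.par_cfg_subset (hR.good hs.1) (hS.good hs.2.1) hX h ?_ ?_)
  · rw [(part_trace hR hS hs.2.2).1]; exact hR.trace_cfg hs.1
  · rw [(part_trace hR hS hs.2.2).2]; exact hS.trace_cfg hs.2.1

/-- The counterpart for a forward step, when the trace has gained one event. -/
theorem Der.par_of_insert {R S : RCCS N T} {m s s'} (hR : Der R (.fork m) s)
    (hS : Der S (.fork m) s') (hs : (s.par s').lin) {X : Set (Set T)} (hX : (s.par s').cfg X)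
    {A : Set T} {α : Label N} (hA : (s.par s').evs A α)
    (h : (R.par S).trace m = insert A X) : Der (R.par S) m (s.par s') := by
  refine .par hR hS ?_
  rw [h]
  refine Sem.par_cfg_insert hX hA ?_ ?_ ?_ <;> rw [← h]
  · rw [(part_trace hR hS hs.2.2).1]; exact hR.trace_cfg hs.1
  · rw [(part_trace hR hS hs.2.2).2]; exact hS.trace_cfg hs.2.1
  · rintro _ ⟨i, hi, rfl⟩ _ ⟨j, hj, rfl⟩ ⟨t, ht, ht'⟩
    rw [par_id_unique hR hS hs.2.2 (hR.id_unique hs.1) (hS.id_unique hs.2.1) i j t hi.2 hj.2 ht ht']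

theorem Der.above {M m : Memory N T} {P s} (h : Der (.thread M P) m s) : m.Above M := by
  generalize hR : RCCS.thread M P = R at h
  induction h with
  | base m P => cases hR; exact .refl
  | event i l t K _ _ ih => exact (ih hR).of_event
  | par => cases hR
  | res => cases hR

/-- Reading back an event would place the memory above a strictly higher one. -/
theorem Der.eq_sem {m : Memory N T} {P s} (h : Der (.thread m P) m s) : s = P.sem := by
  cases h with
  | base => rfl
  | event i l t K _ h => exact (Memory.not_above_event _ _ _ _ h.above).elim

end

section

variable {N : Type u} {T : Type}

/-! ### Structural congruence preserves derivatives -/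

theorem RCCS.Cong.ids_eq {R S : RCCS N T} (h : R.Cong S) : R.ids = S.ids := by
  induction h with
  | refl => rfl
  | symm _ ih => exact ih.symm
  | trans _ _ ih ih' => exact ih.trans ih'
  | par _ _ ih ih' => simp only [RCCS.ids, ih, ih']
  | res a _ ih => exact ih
  | distribution m P Q => exact (Set.union_self _).symm
  | scope m P a ha => rfl
  | alpha m h => rfl

theorem RCCS.Cong.executed_eq {R S : RCCS N T} (h : R.Cong S) : R.executed = S.executed := by
  induction h with
  | refl => rfl
  | symm _ ih => exact ih.symm
  | trans _ _ ih ih' => exact ih.trans ih'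
  | par _ _ ih ih' => simp only [RCCS.executed, ih, ih']
  | res a _ ih => exact ih
  | distribution m P Q => exact (Set.union_self _).symm
  | scope m P a ha => rfl
  | alpha m h => rfl

theorem RCCS.Cong.acts_eq {R S : RCCS N T} (h : R.Cong S) : R.acts = S.acts := by
  induction h with
  | refl => rfl
  | symm _ ih => exact ih.symm
  | trans _ _ ih ih' => exact ih.trans ih'
  | par _ _ ih ih' => simp only [RCCS.acts, ih, ih']
  | res a _ ih => exact ih
  | distribution m P Q => exact (Set.union_self _).symm
  | scope m P a ha => rfl
  | alpha m h => rfl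

theorem RCCS.Cong.ev_eq {R S : RCCS N T} (h : R.Cong S) : R.ev = S.ev := by
  funext i
  simp only [RCCS.ev, h.executed_eq]

theorem RCCS.Cong.trace_eq {R S : RCCS N T} (h : R.Cong S) (m : Memory N T) :
    R.trace m = S.trace m := by
  simp only [RCCS.trace, h.ids_eq, h.ev_eq]

theorem Der.distribution {M m : Memory N T} {P Q s} (h : Der (.thread M (.par P Q)) m s)
    (hs : s.lin) : Der (.par (.thread (.fork M) P) (.thread (.fork M) Q)) m s := by
  generalize hR : RCCS.thread M (.par P Q) = R at h
  induction h with
  | base m P =>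
    cases hR
    refine .par (.base _ _) (.base _ _) ?_
    rw [← (RCCS.Cong.distribution M P Q).trace_eq, RCCS.trace_thread_self]
    exact (CCS.good_sem hs).cfg_empty
  | event i l t K hi _ ih => exact .event i l t K hi (ih hs.1.1 hR)
  | par => cases hR
  | res => cases hR

theorem Der.of_distribution {M m : Memory N T} {P Q s}
    (h : Der (.par (.thread (.fork M) P) (.thread (.fork M) Q)) m s) :
    Der (.thread M (.par P Q)) m s := by
  generalize hR : RCCS.par (.thread (.fork M) P) (.thread (.fork M) Q) = R at h
  induction h with
  | base => cases hR
  | event i l t K hi _ ih => exact .event i l t K hi (ih hR)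
  | par h h' _ _ _ =>
    cases hR
    -- No event follows the fork in either thread, so both premises are instances of `Der.base`.
    obtain rfl := h.above.fork_eq
    rw [h.eq_sem, h'.eq_sem]
    exact .base _ _
  | res => cases hR

theorem Der.scope {M m : Memory N T} {P a s} (h : Der (.thread M (.res P a)) m s)
    (ha : a ∉ M.freeNames) (hs : s.lin) : Der (.res (.thread M P) a) m s := by
  generalize hR : RCCS.thread M (.res P a) = R at h
  induction h with
  | base m P =>
    cases hR
    refine .res a ha (.base _ _) ?_
    rw [RCCS.trace_thread_self]
    exact (CCS.good_sem hs).cfg_empty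
  | event i l t K hi _ ih => exact .event i l t K hi (ih hs.1.1 hR)
  | par => cases hR
  | res => cases hR

/-- The name `a` occurs neither in the executed actions nor in the discarded alternatives of the
memory, so the restriction moves outward past each of them. -/
theorem Der.thread_res {M m : Memory N T} {P a s} (h : Der (.thread M P) m s)
    (ha : a ∉ M.freeNames) (hs : s.lin) : Der (.thread M (.res P a)) m (s.res a) := by
  generalize hR : RCCS.thread M P = R at h
  induction h with
  | base m P => cases hR; exact Der.base _ (CCS.res _ a)
  | @event R m s i l t K hi h ih =>
    subst hR
    have hfree : a ∉ (Memory.event i l t K m).freeNames := fun h' => ha (h.above.freeNames_subset h')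
    have hl : l.base ≠ a := fun h' => hfree (Or.inl (Or.inl h'.symm))
    have hK : a ∉ K.freeNames := fun h' => hfree (Or.inl (Or.inr h'))
    have hg := (h.good hs.1.1).pre l hs.1.2
    have hg' := CCS.good_sem hs.2.1
    rw [Sem.res_choice (hg.choice hg' hs.2.2) hg hg' fun A α => CCS.not_mentions hK,
      Sem.res_pre hl]
    exact .event i l t K hi (ih hs.1.1 rfl)
  | par => cases hR
  | res => cases hR

/-- Inversion for restriction. The rule `Der.res` may be followed by several `Der.event` steps; its
side condition on the memory allows the restriction to be pulled through all of them. -/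
theorem Der.of_res {R : RCCS N T} {a : N} {m s} (h : Der (.res R a) m s) (hs : s.lin) :
    ∃ s', s = s'.res a ∧ a ∉ m.freeNames ∧ Der R m s' := by
  generalize hU : RCCS.res R a = U at h
  induction h with
  | base => cases hU
  | @event _ m s i l t K hi h ih =>
    obtain ⟨s', rfl, ha, h'⟩ := ih hs.1.1 hU
    have hl : l.base ≠ a := fun h' => ha (Or.inl (Or.inl h'.symm))
    have hK : a ∉ K.freeNames := fun h' => ha (Or.inl (Or.inr h'))
    have hg := (h'.good hs.1.1).pre l hs.1.2
    have hg' := CCS.good_sem hs.2.1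
    refine ⟨(s'.pre l t).choice K.sem, ?_, fun h => ha (Or.inr h), .event i l t K hi h'⟩
    rw [Sem.res_choice (hg.choice hg' hs.2.2) hg hg' fun A α => CCS.not_mentions hK,
      Sem.res_pre hl]
  | par => cases hU
  | res a ha h _ _ => cases hU; exact ⟨_, rfl, ha, h⟩

theorem Der.of_scope {M m : Memory N T} {P a s} (h : Der (.res (.thread M P) a) m s)
    (ha : a ∉ M.freeNames) (hs : s.lin) : Der (.thread M (.res P a)) m s := by
  obtain ⟨s', rfl, -, h⟩ := h.of_res hs
  exact h.thread_res ha hs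

theorem Der.thread_congr {M m : Memory N T} {P Q s} (h : Der (.thread M P) m s)
    (hPQ : P.sem = Q.sem) : Der (.thread M Q) m s := by
  generalize hR : RCCS.thread M P = R at h
  induction h with
  | base m P => cases hR; rw [hPQ]; exact .base _ _
  | event i l t K hi _ ih => exact .event i l t K hi (ih hR)
  | par => cases hR
  | res => cases hR

theorem Der.par_congr {R R' S S' : RCCS N T} (hR : ∀ m s, s.lin → Der R m s → Der R' m s)
    (hS : ∀ m s, s.lin → Der S m s → Der S' m s)
    (ht : ∀ m, (R.par S).trace m = (R'.par S').trace m) {m s} (hs : s.lin)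
    (h : Der (.par R S) m s) : Der (.par R' S') m s := by
  generalize hU : RCCS.par R S = U at h
  induction h with
  | base => cases hU
  | event i l t K hi _ ih => exact .event i l t K hi (ih hs.1.1 hU)
  | par h h' hc _ _ =>
    cases hU
    exact .par (hR _ _ hs.1 h) (hS _ _ hs.2.1 h') (ht _ ▸ hc)
  | res => cases hU

theorem Der.res_congr {R R' : RCCS N T} {a : N} (hR : ∀ m s, s.lin → Der R m s → Der R' m s)
    (ht : ∀ m, R.trace m = R'.trace m) {m s} (hs : s.lin)
    (h : Der (.res R a) m s) : Der (.res R' a) m s := by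
  have hc := h.trace_cfg hs
  obtain ⟨s', rfl, ha, h⟩ := h.of_res hs
  exact .res a ha (hR _ _ hs h) (ht m ▸ hc)

theorem RCCS.Cong.der_iff {R S : RCCS N T} (h : R.Cong S) :
    ∀ m s, s.lin → (Der R m s ↔ Der S m s) := by
  induction h with
  | refl => exact fun _ _ _ => Iff.rfl
  | symm _ ih => exact fun m s hs => (ih m s hs).symm
  | trans _ _ ih ih' => exact fun m s hs => (ih m s hs).trans (ih' m s hs)
  | par h h' ih ih' =>
    exact fun m s hs => ⟨
      Der.par_congr (fun m s hs => (ih m s hs).1) (fun m s hs => (ih' m s hs).1)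
        (RCCS.Cong.par h h').trace_eq hs,
      Der.par_congr (fun m s hs => (ih m s hs).2) (fun m s hs => (ih' m s hs).2)
        (RCCS.Cong.par h h').symm.trace_eq hs⟩
  | res a h ih =>
    exact fun m s hs => ⟨Der.res_congr (fun m s hs => (ih m s hs).1) h.trace_eq hs,
      Der.res_congr (fun m s hs => (ih m s hs).2) h.symm.trace_eq hs⟩
  | distribution m P Q => exact fun m s hs => ⟨fun h => h.distribution hs, Der.of_distribution⟩
  | scope m P a ha => exact fun m s hs => ⟨fun h => h.scope ha hs, fun h => h.of_scope ha hs⟩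
  | alpha m h =>
    exact fun m s hs => ⟨fun h' => h'.thread_congr h.sem_eq, fun h' => h'.thread_congr h.sem_eq.symm⟩

/-! ### Transitions preserve derivatives -/

theorem RCCS.Fwd.notMem_ids {R R' : RCCS N T} {i α} (h : R.Fwd i α R') : i ∉ R.ids := by
  induction h with
  | act _ _ _ _ _ hi => exact hi
  | act_left _ _ _ _ _ _ _ _ hi => exact hi
  | act_right _ _ _ _ _ _ _ _ hi => exact hi
  | syn _ _ ih ih' => exact fun h => h.elim ih ih'
  | par_left S hi _ ih => exact fun h => h.elim ih hi
  | par_right R hi _ ih => exact fun h => h.elim hi ih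
  | res a _ _ ih => exact ih
  | cong h _ _ ih => rwa [h.ids_eq]

theorem RCCS.Fwd.ids_eq {R R' : RCCS N T} {i α} (h : R.Fwd i α R') : R'.ids = insert i R.ids := by
  induction h with
  | act => rfl
  | act_left => rfl
  | act_right => rfl
  | syn _ _ ih ih' =>
    simp only [RCCS.ids, ih, ih', Set.insert_union, Set.union_insert, Set.insert_idem]
  | par_left S hi _ ih => simp only [RCCS.ids, ih, Set.insert_union]
  | par_right R hi _ ih => simp only [RCCS.ids, ih, Set.union_insert]
  | res a _ _ ih => exact ih
  | cong h _ h' ih => rw [← h'.ids_eq, h.ids_eq, ih]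

theorem RCCS.Fwd.ev_eq {R R' : RCCS N T} {i α} (h : R.Fwd i α R') {j : ℕ} (hj : j ≠ i) :
    R'.ev j = R.ev j := by
  have key : ∀ (l t K P Q) (m : Memory N T),
      (RCCS.thread (.event i l t K m) P).ev j = (RCCS.thread m Q).ev j := by
    intro l t K P Q m
    ext u
    exact or_iff_right fun h => hj (congrArg Prod.fst h)
  induction h with
  | act => exact key ..
  | act_left => exact key ..
  | act_right => exact key ..
  | syn _ _ ih ih' => rw [RCCS.ev_par, RCCS.ev_par, ih hj key, ih' hj key]
  | par_left S hi _ ih => rw [RCCS.ev_par, RCCS.ev_par, ih hj key]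
  | par_right R hi _ ih => rw [RCCS.ev_par, RCCS.ev_par, ih hj key]
  | res a _ _ ih => exact ih hj key
  | cong h _ h' ih => rw [← h'.ev_eq, h.ev_eq, ih hj key]

theorem RCCS.Fwd.trace_eq {R R' : RCCS N T} {i α} (h : R.Fwd i α R') {m : Memory N T}
    (hi : i ∉ m.ids) : R'.trace m = insert (R'.ev i) (R.trace m) := by
  rw [RCCS.trace, h.ids_eq, Set.insert_sdiff_of_notMem _ hi, Set.image_insert_eq, RCCS.trace]
  congr 1
  refine Set.image_congr fun j hj => h.ev_eq ?_
  rintro rfl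
  exact h.notMem_ids hj.1

theorem RCCS.Fwd.trace_subset {R R' : RCCS N T} {i α} (h : R.Fwd i α R') (m : Memory N T) :
    R.trace m ⊆ R'.trace m := by
  rintro _ ⟨j, hj, rfl⟩
  refine ⟨j, ⟨h.ids_eq ▸ Or.inr hj.1, hj.2⟩, h.ev_eq ?_⟩
  rintro rfl
  exact h.notMem_ids hj.1

/-- A visible step is taken by one thread, where the identifier was fresh, while all other
components avoid it. -/
theorem RCCS.Fwd.acts_unique {R R' : RCCS N T} {i α} (h : R.Fwd i α R') :
    ∀ k, (i, k) ∈ R'.acts → ∀ l, α = .act l → k = l := by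
  have key : ∀ (i l t K P) (m : Memory N T) (_ : i ∉ m.ids) (k),
      (i, k) ∈ (RCCS.thread (.event i l t K m) P).acts → ∀ l', Label.act l = .act l' → k = l' := by
    rintro i l t K P m hi k (h | h) l' hl <;> cases hl
    · cases h; rfl
    · exact (hi (Memory.mem_ids_iff_acts.2 ⟨k, h⟩)).elim
  induction h with
  | act _ _ _ _ _ hi => exact key _ _ _ _ _ _ hi
  | act_left _ _ _ _ _ _ _ _ hi => exact key _ _ _ _ _ _ hi
  | act_right _ _ _ _ _ _ _ _ hi => exact key _ _ _ _ _ _ hi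
  | syn => intro k _ l hl; cases hl
  | par_left S hi _ ih =>
    intro k hk
    exact ih k (hk.resolve_right fun h => hi (RCCS.mem_ids_iff_acts.2 ⟨k, h⟩))
  | par_right R hi _ ih =>
    intro k hk
    exact ih k (hk.resolve_left fun h => hi (RCCS.mem_ids_iff_acts.2 ⟨k, h⟩))
  | res a _ _ ih => exact ih
  | cong _ _ h' ih => rwa [← h'.acts_eq]

theorem CCS.sem_pre_eq (l : Action N) (t : T) (P : CCS N T) :
    (CCS.pre l t P).sem = (P.sem.pre l t).choice CCS.nil.sem :=
  (Sem.choice_nil (Or.inl rfl)).symm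

theorem CCS.sem_sum_left (l : Action N) (s : T) (P : CCS N T) (k : Action N) (t : T)
    (Q : CCS N T) : (CCS.sum l s P k t Q).sem = (P.sem.pre l s).choice (CCS.pre k t Q).sem := rfl

theorem CCS.sem_sum_right (l : Action N) (s : T) (P : CCS N T) (k : Action N) (t : T)
    (Q : CCS N T) : (CCS.sum l s P k t Q).sem = (Q.sem.pre k t).choice (CCS.pre l s P).sem :=
  Sem.choice_comm _ _

/-- The derivation of a thread is a chain of `Der.event` steps over a `Der.base`. The new event is
inserted just above the base, and `hP` says that the encoding read back is the same. -/
theorem Der.thread_fwd {M m : Memory N T} {P s} (h : Der (.thread M P) m s) {i : ℕ}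
    (hi : i ∉ M.ids) {l t} {K P' : CCS N T} (hP : P.sem = (P'.sem.pre l t).choice K.sem) :
    Der (.thread (.event i l t K M) P') m s ∧
      s.evs ((RCCS.thread (.event i l t K M) P').ev i) (.act l) := by
  rw [RCCS.ev_thread_event hi]
  generalize hR : RCCS.thread M P = R at h
  induction h with
  | base m P =>
    cases hR
    rw [hP]
    exact ⟨.event i l t K hi (.base _ _), Or.inl (Or.inl ⟨rfl, rfl⟩)⟩
  | event i l t K hi _ ih => exact ⟨.event i l t K hi (ih hR).1, Or.inl (Or.inr (ih hR).2)⟩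
  | par => cases hR
  | res => cases hR

/-- The `Der.event` step next to the base is removed. It exists because `i` does not belong to `m`,
and a step that reads back `i` must be this one because `i` does not occur in `M`. -/
theorem Der.thread_bwd {M m : Memory N T} {P' s} {i : ℕ} {l t} {K P : CCS N T}
    (h : Der (.thread (.event i l t K M) P') m s)
    (hi : i ∉ M.ids) (him : i ∉ m.ids) (hP : P.sem = (P'.sem.pre l t).choice K.sem) :
    Der (.thread M P) m s := by
  generalize hR : RCCS.thread (.event i l t K M) P' = R at h
  induction h with
  | base m P => cases hR; exact (him (Or.inl rfl)).elim
  | event j k u L hj h ih =>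
    by_cases hij : i = j
    · subst hij
      subst hR
      rcases h.above.event_event with he | he
      · rw [he] at h
        obtain rfl := h.eq_sem
        cases he
        rw [← hP]
        exact .base _ _
      · exact (hi (he.ids_subset (Or.inl rfl))).elim
    · exact .event j k u L hj (ih (fun h => h.elim hij him) hR)
  | par => cases hR
  | res => cases hR

/-- The second conclusion strengthens the induction: knowing that the new tag set is an event of `s`
with the label of the transition re-establishes the configuration conditions of `Der.par` and
`Der.res`. -/
theorem RCCS.Fwd.der {R R' : RCCS N T} {i α} (h : R.Fwd i α R') :
    ∀ m s, s.lin → Der R m s → Der R' m s ∧ s.evs (R'.ev i) α := by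
  induction h with
  | act m i l t P hi => exact fun m s _ h => h.thread_fwd hi (CCS.sem_pre_eq l t P)
  | act_left m i l t P k u Q hi => exact fun m s _ h => h.thread_fwd hi (CCS.sem_sum_left ..)
  | act_right m i l t P k u Q hi => exact fun m s _ h => h.thread_fwd hi (CCS.sem_sum_right ..)
  | @syn R R' S S' i l hF hF' ih ih' =>
    intro m s hs h
    generalize hU : RCCS.par R S = U at h
    induction h with
    | base => cases hU
    | event j l t K hj _ ih => exact ⟨.event j l t K hj (ih hs.1.1 hU).1, Or.inl (Or.inr (ih hs.1.1 hU).2)⟩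
    | @par _ _ m s s' h h' hc _ _ =>
      cases hU
      obtain ⟨h1, h2⟩ := ih _ _ hs.1 h
      obtain ⟨h1', h2'⟩ := ih' _ _ hs.2.1 h'
      have hi : i ∉ m.ids := fun hi => hF.notMem_ids (h.ids_subset hi)
      have hev : (s.par s').evs ((R'.par S').ev i) .tau :=
        Or.inr (Or.inr ⟨_, _, l, h2, h2', rfl, rfl⟩)
      exact ⟨h1.par_of_insert h1' hs hc hev ((RCCS.Fwd.syn hF hF').trace_eq hi), hev⟩
    | res => cases hU
  | @par_left R R' i α S hiS hF ih =>
    intro m s hs h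
    generalize hU : RCCS.par R S = U at h
    induction h with
    | base => cases hU
    | event j l t K hj _ ih => exact ⟨.event j l t K hj (ih hs.1.1 hU).1, Or.inl (Or.inr (ih hs.1.1 hU).2)⟩
    | @par _ _ m s s' h h' hc _ _ =>
      cases hU
      obtain ⟨h1, h2⟩ := ih _ _ hs.1 h
      have hi : i ∉ m.ids := fun hi => hF.notMem_ids (h.ids_subset hi)
      have hev : (s.par s').evs ((R'.par S).ev i) α := by
        rw [RCCS.ev_par, RCCS.ev_eq_empty hiS, Set.union_empty]
        exact Or.inl h2
      exact ⟨h1.par_of_insert h' hs hc hev ((RCCS.Fwd.par_left S hiS hF).trace_eq hi), hev⟩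
    | res => cases hU
  | @par_right S S' i α R hiR hF ih =>
    intro m s hs h
    generalize hU : RCCS.par R S = U at h
    induction h with
    | base => cases hU
    | event j l t K hj _ ih => exact ⟨.event j l t K hj (ih hs.1.1 hU).1, Or.inl (Or.inr (ih hs.1.1 hU).2)⟩
    | @par _ _ m s s' h h' hc _ _ =>
      cases hU
      obtain ⟨h1, h2⟩ := ih _ _ hs.2.1 h'
      have hi : i ∉ m.ids := fun hi => hF.notMem_ids (h'.ids_subset hi)
      have hev : (s.par s').evs ((R.par S').ev i) α := by
        rw [RCCS.ev_par, RCCS.ev_eq_empty hiR, Set.empty_union]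
        exact Or.inr (Or.inl h2)
      exact ⟨h.par_of_insert h1 hs hc hev ((RCCS.Fwd.par_right R hiR hF).trace_eq hi), hev⟩
    | res => cases hU
  | @res R R' i α a ha hF ih =>
    intro m s hs h
    have hc := h.trace_cfg hs
    obtain ⟨s', rfl, hm, h⟩ := h.of_res hs
    obtain ⟨h1, h2⟩ := ih _ s' hs h
    have hi : i ∉ m.ids := fun hi => hF.notMem_ids (h.ids_subset hi)
    refine ⟨.res a hm h1 ⟨h1.trace_cfg hs, ?_⟩, h2, ha⟩
    rw [hF.trace_eq hi]
    rintro A (rfl | hA)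
    exacts [⟨α, h2, ha⟩, hc.2 A hA]
  | cong h _ h' ih =>
    intro m s hs hD
    have := ih m s hs ((h.der_iff m s hs).1 hD)
    rw [← h'.ev_eq]
    exact ⟨(h'.der_iff m s hs).1 this.1, this.2⟩

/-- After a synchronisation, `i` carries only `l` on one side and only `l.co` on the other. A shared
entry under `i` would force the two to coincide. -/
theorem RCCS.Fwd.notMem_shared {R R' S S' : RCCS N T} {i l} (h : R.Fwd i (.act l) R')
    (h' : S.Fwd i (.act l.co) S') {A : Set (ℕ × Action N)} (hR : A ⊆ R'.acts) (hS : A ⊆ S'.acts)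
    (k : Action N) : (i, k) ∉ A := fun hk =>
  l.co_ne ((h'.acts_unique k (hS hk) _ rfl).symm.trans (h.acts_unique k (hR hk) _ rfl))

/-- A derivative that is a parallel composition forks a common memory. -/
theorem Der.of_par {R S : RCCS N T} {m s} (h : Der (.par R S) m s) (hs : s.lin) :
    ∃ m' s₁ s₂, m.ids ⊆ m'.ids ∧ s₁.lin ∧ s₂.lin ∧ Der R (.fork m') s₁ ∧ Der S (.fork m') s₂ := by
  generalize hU : RCCS.par R S = U at h
  induction h with
  | base => cases hU
  | event j l t K hj _ ih =>
    obtain ⟨m', s₁, s₂, h, h'⟩ := ih hs.1.1 hU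
    exact ⟨m', s₁, s₂, (Set.subset_insert _ _).trans h, h'⟩
  | par h h' => cases hU; exact ⟨_, _, _, subset_rfl, hs.1, hs.2.1, h, h'⟩
  | res => cases hU

/-- The condition on `i` says that the undone event was executed after `m`. In a parallel
composition it is needed for the memory common to both sides: it holds because `i` avoids the idle
component or, for a synchronisation, by `RCCS.Fwd.notMem_shared`. -/
theorem RCCS.Fwd.der_bwd {R R' : RCCS N T} {i α} (h : R.Fwd i α R') :
    ∀ m s, s.lin → i ∉ m.ids → Der R' m s → Der R m s := by
  induction h with
  | act m i l t P hi => exact fun m s _ him h => h.thread_bwd hi him (CCS.sem_pre_eq l t P)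
  | act_left m i l t P k u Q hi =>
    exact fun m s _ him h => h.thread_bwd hi him (CCS.sem_sum_left ..)
  | act_right m i l t P k u Q hi =>
    exact fun m s _ him h => h.thread_bwd hi him (CCS.sem_sum_right ..)
  | @syn R R' S S' i l hF hF' ih ih' =>
    intro m s hs him h
    generalize hU : RCCS.par R' S' = U at h
    induction h with
    | base => cases hU
    | @event _ m _ j l t K hj h ih =>
      subst hU
      obtain ⟨m', _, _, hm, -, -, h1, h2⟩ := h.of_par hs.1.1
      refine .event j l t K hj (ih hs.1.1 (fun hi => ?_) rfl)
      obtain ⟨k, hk⟩ := Memory.mem_ids_iff_acts.1 (hm hi)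
      exact hF.notMem_shared hF' h1.acts_subset h2.acts_subset k hk
    | par h h' hc _ _ =>
      cases hU
      exact (ih (.fork _) _ hs.1 him h).par_of_subset (ih' (.fork _) _ hs.2.1 him h') hs hc
        ((RCCS.Fwd.syn hF hF').trace_subset _)
    | res => cases hU
  | @par_left R R' i α S hiS hF ih =>
    intro m s hs him h
    generalize hU : RCCS.par R' S = U at h
    induction h with
    | base => cases hU
    | @event _ m _ j l t K hj h ih =>
      subst hU
      obtain ⟨m', _, _, hm, -, -, h1, h2⟩ := h.of_par hs.1.1
      exact .event j l t K hj (ih hs.1.1 (fun hi => hiS (h2.ids_subset (hm hi))) rfl)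
    | par h h' hc _ _ =>
      cases hU
      exact (ih (.fork _) _ hs.1 him h).par_of_subset h' hs hc
        ((RCCS.Fwd.par_left S hiS hF).trace_subset _)
    | res => cases hU
  | @par_right S S' i α R hiR hF ih =>
    intro m s hs him h
    generalize hU : RCCS.par R S' = U at h
    induction h with
    | base => cases hU
    | @event _ m _ j l t K hj h ih =>
      subst hU
      obtain ⟨m', _, _, hm, -, -, h1, h2⟩ := h.of_par hs.1.1
      exact .event j l t K hj (ih hs.1.1 (fun hi => hiR (h1.ids_subset (hm hi))) rfl)
    | par h h' hc _ _ =>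
      cases hU
      exact h.par_of_subset (ih (.fork _) _ hs.2.1 him h') hs hc
        ((RCCS.Fwd.par_right R hiR hF).trace_subset _)
    | res => cases hU
  | @res R R' i α a ha hF ih =>
    intro m s hs him h
    have hc := h.trace_cfg hs
    obtain ⟨s', rfl, hm, h⟩ := h.of_res hs
    have h1 := ih _ s' hs him h
    exact .res a hm h1 ⟨h1.trace_cfg hs, fun A hA => hc.2 A (hF.trace_subset m hA)⟩
  | cong h _ h' ih =>
    intro m s hs him hD
    exact (h.der_iff m s hs).2 (ih m s hs him ((h'.der_iff m s hs).2 hD))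

theorem RCCS.Steps.der {R S : RCCS N T} (h : R.Steps S) {s : Sem N T} (hs : s.lin)
    (hR : Der R .empty s) : Der S .empty s := by
  induction h with
  | refl => exact hR
  | tail _ h ih =>
    obtain ⟨i, α, h | h⟩ := h
    · exact (h.der _ _ hs ih).1
    · exact RCCS.Fwd.der_bwd h _ _ hs (fun h => h) ih

end

/-! ### Finite products of configuration structures -/

theorem StarProd.ext' {A : Type v} {B : Type w} {e e' : StarProd A B} (h : e.fst = e'.fst)
    (h' : e.snd = e'.snd) : e = e' := by
  cases e <;> cases e' <;> simp_all [StarProd.fst, StarProd.snd]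

instance StarProd.instFinite {A : Type v} {B : Type w} [Finite A] [Finite B] :
    Finite (StarProd A B) :=
  Finite.of_injective (fun e : StarProd A B => (e.fst, e.snd)) fun _ _ h =>
    StarProd.ext' (congrArg Prod.fst h) (congrArg Prod.snd h)

/-- With finitely many events, `x` witnesses its own finiteness condition. -/
theorem ConfStruct.mem_prod_restrict {U : Type v} {V : Type w} {L : Type u} [Finite U] [Finite V]
    (S₁ : ConfStruct U L) (S₂ : ConfStruct V L) (F : Set (StarProd U V))
    (x : Set (StarProd U V)) :
    x ∈ ((S₁.prod S₂).restrict F).C ↔ x ⊆ ((S₁.prod S₂).restrict F).E ∧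
      StarProd.image₁ x ∈ S₁.C ∧ StarProd.image₂ x ∈ S₂.C ∧
      (∀ e ∈ x, ∀ e' ∈ x,
        ((∃ a, e.fst = some a ∧ e'.fst = some a) ∨ (∃ b, e.snd = some b ∧ e'.snd = some b)) →
          e = e') ∧
      (∀ e ∈ x, ∀ e' ∈ x, e ≠ e' → ∃ z ⊆ x,
        StarProd.image₁ z ∈ S₁.C ∧ StarProd.image₂ z ∈ S₂.C ∧ (e ∈ z ↔ e' ∉ z)) := by
  constructor
  · rintro ⟨⟨h1, h2, h3, h4, -, h5⟩, hF⟩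
    exact ⟨fun e he => ⟨h1 e he, hF he⟩, h2, h3, h4, h5⟩
  · rintro ⟨h1, h2, h3, h4, h5⟩
    exact ⟨⟨fun e he => (h1 he).1, h2, h3, h4,
      fun e he => ⟨x, subset_rfl, Set.toFinite x, h2, h3, he⟩, h5⟩, fun e he => (h1 he).2⟩

/-! ### Parallel composition of identified structures -/

namespace IdConfStruct

variable {U : Type v} {V : Type w} {N : Type u}
  {D₁ : IdConfStruct U (Label N) ℕ} {D₂ : IdConfStruct V (Label N) ℕ}

theorem par_left_mem {a : U} : StarProd.left a ∈ (D₁.par D₂).E ↔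
    a ∈ D₁.E ∧ D₁.ident a ∉ D₂.ident '' D₂.E := by
  have h1 : (∃ b ∈ D₂.E, D₁.ident a = D₂.ident b) ↔ D₁.ident a ∈ D₂.ident '' D₂.E :=
    exists_congr fun b => and_congr_right fun _ => eq_comm
  have h2 : D₁.parLabel D₂ (.left a) ≠ none ↔ D₁.ident a ∉ D₂.ident '' D₂.E := by
    rw [← h1, parLabel]
    split_ifs with h
    · exact iff_of_false (fun h' => h' rfl) (fun h' => h' h)
    · exact iff_of_true (Option.some_ne_none _) h
  refine and_congr ⟨fun h => h.1 a rfl, fun h => ⟨fun a' ha' => ?_, fun b hb => ?_⟩⟩ h2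
  · cases ha'; exact h
  · cases hb

theorem par_right_mem {b : V} : StarProd.right b ∈ (D₁.par D₂).E ↔
    b ∈ D₂.E ∧ D₂.ident b ∉ D₁.ident '' D₁.E := by
  have h2 : D₁.parLabel D₂ (.right b) ≠ none ↔ D₂.ident b ∉ D₁.ident '' D₁.E := by
    rw [parLabel]
    split_ifs with h
    · exact iff_of_false (fun h' => h' rfl) (fun h' => h' h)
    · exact iff_of_true (Option.some_ne_none _) h
  refine and_congr ⟨fun h => h.2 b rfl, fun h => ⟨fun a ha => ?_, fun b' hb' => ?_⟩⟩ h2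
  · cases ha
  · cases hb'; exact h

theorem par_both_mem {a : U} {b : V} : StarProd.both a b ∈ (D₁.par D₂).E ↔
    a ∈ D₁.E ∧ b ∈ D₂.E ∧ D₁.ident a = D₂.ident b ∧
      ((∃ l : Action N, D₁.lab a = .act l ∧ D₂.lab b = .act l.co) ∨ D₁.lab a = D₂.lab b) := by
  have h2 : D₁.parLabel D₂ (.both a b) ≠ none ↔ D₁.ident a = D₂.ident b ∧
      ((∃ l : Action N, D₁.lab a = .act l ∧ D₂.lab b = .act l.co) ∨ D₁.lab a = D₂.lab b) := by
    rw [parLabel]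
    split_ifs with h h' h''
    · exact iff_of_false (fun h' => h' rfl) fun h' => h h'.1
    · exact iff_of_true (Option.some_ne_none _) ⟨not_not.1 h, Or.inl h'⟩
    · exact iff_of_true (Option.some_ne_none _) ⟨not_not.1 h, Or.inr h''⟩
    · exact iff_of_false (fun h' => h' rfl) fun h => h.2.elim h' h''
  rw [← and_assoc]
  refine and_congr ⟨fun h => ⟨h.1 a rfl, h.2 b rfl⟩,
    fun h => ⟨fun a' ha' => ?_, fun b' hb' => ?_⟩⟩ h2
  · cases ha'; exact h.1
  · cases hb'; exact h.2

theorem par_fst_mem {e : StarProd U V} (he : e ∈ (D₁.par D₂).E) {a : U} (ha : e.fst = some a) :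
    a ∈ D₁.E ∧ D₁.ident a = (D₁.par D₂).ident e := by
  cases e with
  | left a' => cases ha; exact ⟨(par_left_mem.1 he).1, rfl⟩
  | right b => cases ha
  | both a' b => cases ha; exact ⟨(par_both_mem.1 he).1, rfl⟩

theorem par_snd_mem {e : StarProd U V} (he : e ∈ (D₁.par D₂).E) {b : V} (hb : e.snd = some b) :
    b ∈ D₂.E ∧ D₂.ident b = (D₁.par D₂).ident e := by
  cases e with
  | left a' => cases hb
  | right b => cases hb; exact ⟨(par_right_mem.1 he).1, rfl⟩
  | both a' b =>
    cases hb
    exact ⟨(par_both_mem.1 he).2.1, (par_both_mem.1 he).2.2.1.symm⟩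

theorem exists_par_fst {e : StarProd U V} (he : e ∈ (D₁.par D₂).E)
    (h : (D₁.par D₂).ident e ∈ D₁.ident '' D₁.E) : ∃ a, e.fst = some a := by
  cases e with
  | left a => exact ⟨a, rfl⟩
  | right b => exact ((par_right_mem.1 he).2 h).elim
  | both a b => exact ⟨a, rfl⟩

theorem exists_par_snd {e : StarProd U V} (he : e ∈ (D₁.par D₂).E)
    (h : (D₁.par D₂).ident e ∈ D₂.ident '' D₂.E) : ∃ b, e.snd = some b := by
  cases e with
  | left a => exact ((par_left_mem.1 he).2 h).elim
  | right b => exact ⟨b, rfl⟩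
  | both a b => exact ⟨b, rfl⟩

theorem ident_image₁ {c : Set (StarProd U V)} (hc : c ⊆ (D₁.par D₂).E) :
    D₁.ident '' StarProd.image₁ c = (D₁.par D₂).ident '' c ∩ D₁.ident '' D₁.E := by
  ext i
  constructor
  · rintro ⟨a, ⟨e, he, ha⟩, rfl⟩
    obtain ⟨h1, h2⟩ := par_fst_mem (hc he) ha
    exact ⟨⟨e, he, h2.symm⟩, a, h1, rfl⟩
  · rintro ⟨⟨e, he, rfl⟩, h⟩
    obtain ⟨a, ha⟩ := exists_par_fst (hc he) h
    exact ⟨a, ⟨e, he, ha⟩, (par_fst_mem (hc he) ha).2⟩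

theorem ident_image₂ {c : Set (StarProd U V)} (hc : c ⊆ (D₁.par D₂).E) :
    D₂.ident '' StarProd.image₂ c = (D₁.par D₂).ident '' c ∩ D₂.ident '' D₂.E := by
  ext i
  constructor
  · rintro ⟨b, ⟨e, he, hb⟩, rfl⟩
    obtain ⟨h1, h2⟩ := par_snd_mem (hc he) hb
    exact ⟨⟨e, he, h2.symm⟩, b, h1, rfl⟩
  · rintro ⟨⟨e, he, rfl⟩, h⟩
    obtain ⟨b, hb⟩ := exists_par_snd (hc he) h
    exact ⟨b, ⟨e, he, hb⟩, (par_snd_mem (hc he) hb).2⟩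

theorem image₁_subset {c : Set (StarProd U V)} (hc : c ⊆ (D₁.par D₂).E) :
    StarProd.image₁ c ⊆ D₁.E := fun _ ⟨_, he, ha⟩ => (par_fst_mem (hc he) ha).1

theorem image₂_subset {c : Set (StarProd U V)} (hc : c ⊆ (D₁.par D₂).E) :
    StarProd.image₂ c ⊆ D₂.E := fun _ ⟨_, he, hb⟩ => (par_snd_mem (hc he) hb).1

/-- A single event is kept only if its identifier is absent from the other side. So the identifier
decides which components an event has, and injectivity on each side decides what they are. -/
theorem par_injOn (h₁ : Set.InjOn D₁.ident D₁.E) (h₂ : Set.InjOn D₂.ident D₂.E) :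
    Set.InjOn (D₁.par D₂).ident (D₁.par D₂).E := by
  intro e he e' he' h
  refine StarProd.ext' ?_ ?_
  · by_cases hi : (D₁.par D₂).ident e ∈ D₁.ident '' D₁.E
    · obtain ⟨a, ha⟩ := exists_par_fst he hi
      obtain ⟨a', ha'⟩ := exists_par_fst he' (h ▸ hi)
      obtain ⟨h1, h2⟩ := par_fst_mem he ha
      obtain ⟨h1', h2'⟩ := par_fst_mem he' ha'
      rw [ha, ha', h₁ h1 h1' (h2.trans (h.trans h2'.symm))]
    · have key : ∀ e'' ∈ (D₁.par D₂).E, (D₁.par D₂).ident e'' ∉ D₁.ident '' D₁.E →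
          e''.fst = none := fun e'' he'' hi' => Option.eq_none_iff_forall_not_mem.2 fun a ha =>
        hi' ⟨a, par_fst_mem he'' ha⟩
      rw [key e he hi, key e' he' (h ▸ hi)]
  · by_cases hi : (D₁.par D₂).ident e ∈ D₂.ident '' D₂.E
    · obtain ⟨a, ha⟩ := exists_par_snd he hi
      obtain ⟨a', ha'⟩ := exists_par_snd he' (h ▸ hi)
      obtain ⟨h1, h2⟩ := par_snd_mem he ha
      obtain ⟨h1', h2'⟩ := par_snd_mem he' ha'
      rw [ha, ha', h₂ h1 h1' (h2.trans (h.trans h2'.symm))]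
    · have key : ∀ e'' ∈ (D₁.par D₂).E, (D₁.par D₂).ident e'' ∉ D₂.ident '' D₂.E →
          e''.snd = none := fun e'' he'' hi' => Option.eq_none_iff_forall_not_mem.2 fun a ha =>
        hi' ⟨a, par_snd_mem he'' ha⟩
      rw [key e he hi, key e' he' (h ▸ hi)]

/-- An identifier common to both sides can survive only through a pair, and `h` ensures that such
pairs are kept. -/
theorem par_ident_image (h : ∀ a ∈ D₁.E, ∀ b ∈ D₂.E, D₁.ident a = D₂.ident b →
      (∃ l : Action N, D₁.lab a = .act l ∧ D₂.lab b = .act l.co) ∨ D₁.lab a = D₂.lab b) :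
    (D₁.par D₂).ident '' (D₁.par D₂).E = D₁.ident '' D₁.E ∪ D₂.ident '' D₂.E := by
  ext i
  constructor
  · rintro ⟨e, he, rfl⟩
    cases e with
    | left a => exact Or.inl ⟨a, (par_left_mem.1 he).1, rfl⟩
    | right b => exact Or.inr ⟨b, (par_right_mem.1 he).1, rfl⟩
    | both a b => exact Or.inl ⟨a, (par_both_mem.1 he).1, rfl⟩
  · by_cases hi : i ∈ D₁.ident '' D₁.E
    · obtain ⟨a, ha, rfl⟩ := hi
      intro _
      by_cases hi' : D₁.ident a ∈ D₂.ident '' D₂.E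
      · obtain ⟨b, hb, hab⟩ := hi'
        exact ⟨.both a b, par_both_mem.2 ⟨ha, hb, hab.symm, h a ha b hb hab.symm⟩, rfl⟩
      · exact ⟨.left a, par_left_mem.2 ⟨ha, hi'⟩, rfl⟩
    · intro h'
      obtain ⟨b, hb, rfl⟩ := h'.resolve_left hi
      exact ⟨.right b, par_right_mem.2 ⟨hb, hi⟩, rfl⟩

/-- Configurations of a parallel composition in terms of identifiers. -/
theorem mem_par_iff [Finite U] [Finite V] (h₁ : Set.InjOn D₁.ident D₁.E)
    (h₂ : Set.InjOn D₂.ident D₂.E) {F₁ F₂ : Set ℕ → Prop}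
    (hC₁ : ∀ c ⊆ D₁.E, c ∈ D₁.C ↔ F₁ (D₁.ident '' c))
    (hC₂ : ∀ c ⊆ D₂.E, c ∈ D₂.C ↔ F₂ (D₂.ident '' c)) {F : Set ℕ → Prop}
    (hF : ∀ c ⊆ (D₁.par D₂).ident '' (D₁.par D₂).E,
      F c ↔ F₁ (c ∩ D₁.ident '' D₁.E) ∧ F₂ (c ∩ D₂.ident '' D₂.E))
    (hsep : ∀ c, F c → ∀ i ∈ c, ∀ j ∈ c, i ≠ j → ∃ z ⊆ c, F z ∧ (i ∈ z ↔ j ∉ z))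
    {c : Set (StarProd U V)} (hc : c ⊆ (D₁.par D₂).E) :
    c ∈ (D₁.par D₂).C ↔ F ((D₁.par D₂).ident '' c) := by
  have key : ∀ z ⊆ (D₁.par D₂).E, F ((D₁.par D₂).ident '' z) ↔
      StarProd.image₁ z ∈ D₁.C ∧ StarProd.image₂ z ∈ D₂.C := fun z hz => by
    rw [hF _ (Set.image_mono hz), hC₁ _ (image₁_subset hz), hC₂ _ (image₂_subset hz),
      ident_image₁ hz, ident_image₂ hz]
  have hinj := par_injOn h₁ h₂
  refine (ConfStruct.mem_prod_restrict _ _ _ c).trans ⟨fun h => (key c hc).2 ⟨h.2.1, h.2.2.1⟩,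
    fun h => ⟨hc, ((key c hc).1 h).1, ((key c hc).1 h).2, ?_, ?_⟩⟩
  · rintro e he e' he' (⟨a, ha, ha'⟩ | ⟨b, hb, hb'⟩)
    · exact hinj (hc he) (hc he')
        ((par_fst_mem (hc he) ha).2.symm.trans (par_fst_mem (hc he') ha').2)
    · exact hinj (hc he) (hc he')
        ((par_snd_mem (hc he) hb).2.symm.trans (par_snd_mem (hc he') hb').2)
  · intro e he e' he' hne
    obtain ⟨z, hz, hFz, hs⟩ := hsep _ h _ ⟨e, he, rfl⟩ _ ⟨e', he', rfl⟩
      fun h => hne (hinj (hc he) (hc he') h)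
    -- The separating set of identifiers is pulled back to a set of events of `c`.
    have himg : (D₁.par D₂).ident '' (c ∩ (D₁.par D₂).ident ⁻¹' z) = z := by
      rw [Set.image_inter_preimage, Set.inter_eq_right.2 hz]
    have hz' : F ((D₁.par D₂).ident '' (c ∩ (D₁.par D₂).ident ⁻¹' z)) := by rwa [himg]
    rw [key _ (Set.inter_subset_left.trans hc)] at hz'
    exact ⟨_, Set.inter_subset_left, hz'.1, hz'.2, by simpa [he, he'] using hs⟩

end IdConfStruct

section

variable {N : Type u} {T : Type}

/-! ### Encodings of memories -/

/-- Sets of identifiers of configurations of a memory. -/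
def Memory.Chain : Memory N T → Set ℕ → Prop
  | .empty => fun c => c = ∅
  | .fork m => m.Chain
  | .event i _ _ _ m => fun c => m.Chain c ∨ c = insert i m.ids

/-- The identifiers of a memory are distinct. -/
def Memory.Wf : Memory N T → Prop
  | .empty => True
  | .fork m => m.Wf
  | .event i _ _ _ m => i ∉ m.ids ∧ m.Wf

theorem Memory.Chain.subset {m : Memory N T} {c : Set ℕ} (h : m.Chain c) : c ⊆ m.ids := by
  induction m with
  | empty => exact h.le
  | fork m ih => exact ih h
  | event i l t K m ih =>
    rcases h with h | rfl
    exacts [(ih h).trans (Set.subset_insert _ _), subset_rfl]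

theorem Memory.chain_ids (m : Memory N T) : m.Chain m.ids := by
  induction m with
  | empty => rfl
  | fork m ih => exact ih
  | event i l t K m ih => exact Or.inr rfl

theorem Memory.Wf.separated {m : Memory N T} (hm : m.Wf) {c : Set ℕ} (h : m.Chain c) :
    ∀ i ∈ c, ∀ j ∈ c, i ≠ j → ∃ z ⊆ c, m.Chain z ∧ (i ∈ z ↔ j ∉ z) := by
  induction m generalizing c with
  | empty => subst h; exact fun i hi => hi.elim
  | fork m ih => exact ih hm h
  | event k l t K m ih =>
    rcases h with h | rfl
    · intro i hi j hj hij
      obtain ⟨z, h1, h2, h3⟩ := ih hm.2 h i hi j hj hij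
      exact ⟨z, h1, Or.inl h2, h3⟩
    · intro i hi j hj hij
      have hsub : m.ids ⊆ insert k m.ids := Set.subset_insert _ _
      rcases hi with rfl | hi
      · exact ⟨m.ids, hsub, Or.inl m.chain_ids,
          iff_of_false hm.1 fun h => h (hj.resolve_left hij.symm)⟩
      rcases hj with rfl | hj
      · exact ⟨m.ids, hsub, Or.inl m.chain_ids, iff_of_true hi hm.1⟩
      obtain ⟨z, h1, h2, h3⟩ := ih hm.2 m.chain_ids i hi j hj hij
      exact ⟨z, h1.trans hsub, Or.inl h2, h3⟩

theorem Memory.Wf.acts_unique {m : Memory N T} (hm : m.Wf) {i l l'} (h : (i, l) ∈ m.acts)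
    (h' : (i, l') ∈ m.acts) : l = l' := by
  induction m with
  | empty => exact h.elim
  | fork m ih => exact ih hm h h'
  | event k l t K m ih =>
    have key : ∀ l'', (k, l'') ∉ m.acts := fun l'' h => hm.1 (Memory.mem_ids_iff_acts.2 ⟨_, h⟩)
    rcases h with h | h <;> rcases h' with h' | h'
    · cases h; cases h'; rfl
    · cases h; exact (key _ h').elim
    · cases h'; exact (key _ h).elim
    · exact ih hm.2 h h'

theorem Memory.ids_mapTag {T' : Type} (g : T → T') (m : Memory N T) : (m.mapTag g).ids = m.ids := by
  induction m with
  | empty => rfl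
  | fork m ih => exact ih
  | event i l t K m ih => simp only [Memory.mapTag, Memory.ids, ih]

/-- The structure `D` represents the memory `m`. -/
structure Memory.Rep {U : Type v} (D : IdConfStruct U (Label N) ℕ) (m : Memory N T) : Prop where
  inj : Set.InjOn D.ident D.E
  image : D.ident '' D.E = m.ids
  lab : ∀ e ∈ D.E, ∃ l, (D.ident e, l) ∈ m.acts ∧ D.lab e = .act l
  subset : ∀ c ∈ D.C, c ⊆ D.E
  conf : ∀ c ⊆ D.E, c ∈ D.C ↔ m.Chain (D.ident '' c)

/-- The set of all events is itself a configuration, so a newly pushed event lies above everything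
recorded before. -/
theorem Memory.Rep.isMaximal_iff {U : Type v} {D : IdConfStruct U (Label N) ℕ} {m : Memory N T}
    (h : m.Rep D) (y : Set U) : D.toConfStruct.IsMaximal y ↔ y = D.E := by
  have hE : D.E ∈ D.C := (h.conf _ subset_rfl).2 (by rw [h.image]; exact m.chain_ids)
  constructor
  · rintro ⟨h1, h2⟩
    exact (h2 _ hE).resolve_right fun h' => h' (h.subset y h1)
  · rintro rfl
    refine ⟨hE, fun z hz => or_iff_not_imp_right.2 fun h' => ?_⟩
    exact (not_not.1 h').antisymm (h.subset z hz)

theorem Memory.Rep.push {U : Type v} {D : IdConfStruct U (Label N) ℕ} {m : Memory N T}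
    (h : m.Rep D) {i : ℕ} (hi : i ∉ m.ids) (l : Action N) (t : T) (K : CCS N T) :
    (Memory.event i l t K m).Rep (D.push i (.act l)) := by
  have hid : ∀ e ∈ D.E, D.ident e ≠ i := fun e he hei => hi (h.image ▸ ⟨e, he, hei⟩)
  have hinj : Set.InjOn (D.push i (.act l)).ident (D.push i (.act l)).E := by
    rintro _ (rfl | ⟨e, he, rfl⟩) _ (rfl | ⟨e', he', rfl⟩) hee
    · rfl
    · exact (hid e' he' hee.symm).elim
    · exact (hid e he hee).elim
    · exact congrArg some (h.inj he he' hee)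
  have himg : (D.push i (.act l)).ident '' (D.push i (.act l)).E = insert i m.ids := by
    simp only [IdConfStruct.push, Set.image_insert_eq, Set.image_image, Option.elim]
    rw [h.image]
  have hsome : ∀ y : Set U, (D.push i (.act l)).ident '' (some '' y) = D.ident '' y := fun y => by
    simp only [IdConfStruct.push, Set.image_image, Option.elim]
  have hC : ∀ c, c ∈ (D.push i (.act l)).C ↔
      (∃ y ∈ D.C, c = some '' y) ∨ c = (D.push i (.act l)).E := fun c => by
    simp only [IdConfStruct.push, Set.mem_ofPred_eq, h.isMaximal_iff, exists_eq_left]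
  refine ⟨hinj, himg, ?_, ?_, ?_⟩
  · rintro _ (rfl | ⟨e, he, rfl⟩)
    · exact ⟨l, Or.inl rfl, rfl⟩
    · obtain ⟨k, hk, hk'⟩ := h.lab e he
      exact ⟨k, Or.inr hk, hk'⟩
  · intro c hc
    rcases (hC c).1 hc with ⟨y, hy, rfl⟩ | rfl
    · exact (Set.image_mono (h.subset y hy)).trans (Set.subset_insert _ _)
    · exact subset_rfl
  · intro c hc
    rw [hC]
    refine or_congr ⟨?_, fun hch => ?_⟩ ?_
    · rintro ⟨y, hy, rfl⟩
      rw [hsome]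
      exact (h.conf y (h.subset y hy)).1 hy
    · have hnone : none ∉ c := fun hn => hi (hch.subset ⟨none, hn, rfl⟩)
      have hcs : c = some '' (some ⁻¹' c) := by
        rw [Set.image_preimage_eq_iff.2]
        intro e he
        cases e with
        | none => exact (hnone he).elim
        | some e => exact ⟨e, rfl⟩
      refine ⟨some ⁻¹' c, ?_, hcs⟩
      rw [h.conf, ← hsome, ← hcs]
      · exact hch
      · intro e he
        obtain h' | ⟨e', he', h'⟩ := hc he
        · cases h'
        · cases h'; exact he'
    · rw [← Memory.ids.eq_3 i l t K, Memory.ids, ← himg, hinj.image_eq_image_iff hc subset_rfl]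

theorem Memory.Wf.rep {T' : Type} (g : T → T') {m : Memory N T} (hm : m.Wf) :
    m.Rep (m.mapTag g).enc := by
  induction m with
  | empty =>
    refine ⟨?_, ?_, ?_, ?_, ?_⟩
    · rintro ⟨⟩
    · exact Set.image_empty _
    · rintro ⟨⟩
    · rintro c hc; exact hc.le
    · intro c _; exact Set.image_eq_empty.symm
  | fork m ih =>
    have h := ih hm
    exact ⟨h.inj, h.image, h.lab, h.subset, h.conf⟩
  | event i l t K m ih => exact (ih hm.2).push hm.1 l t K

/-! ### Encodings of the memories of derivatives -/

/-- The sets of identifiers of configurations of a derivative. -/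
def ConfIds (m : Memory N T) (s : Sem N T) (φ : ℕ → Set T) (c : Set ℕ) : Prop :=
  m.Chain c ∨ m.ids ⊆ c ∧ s.cfg (φ '' (c \ m.ids))

theorem confIds_iff_of_subset {m : Memory N T} {s : Sem N T} (h0 : s.cfg ∅) {φ : ℕ → Set T}
    {c : Set ℕ} (hc : m.ids ⊆ c) : ConfIds m s φ c ↔ s.cfg (φ '' (c \ m.ids)) := by
  refine ⟨?_, fun h => Or.inr ⟨hc, h⟩⟩
  rintro (h | h)
  · rw [h.subset.antisymm hc, Set.sdiff_self, Set.image_empty]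
    exact h0
  · exact h.2

theorem confIds_iff_of_not_subset {m : Memory N T} {s : Sem N T} {φ : ℕ → Set T}
    {c : Set ℕ} (hc : ¬ m.ids ⊆ c) : ConfIds m s φ c ↔ m.Chain c :=
  or_iff_left fun h => hc h.1

/-- Two identifiers of `m` are separated within the memory, and one inside from one outside by
`m.ids`. For two outside, a separator in `s` is placed on top of `m.ids`. -/
theorem Der.confIds_separated {R : RCCS N T} {m s} (h : Der R m s) (hs : s.lin) (hm : m.Wf)
    {c : Set ℕ} (hc : ConfIds m s R.ev c) (hcR : c ⊆ R.ids) :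
    ∀ i ∈ c, ∀ j ∈ c, i ≠ j → ∃ z ⊆ c, ConfIds m s R.ev z ∧ (i ∈ z ↔ j ∉ z) := by
  intro i hi j hj hij
  rcases hc with hc | ⟨hmc, hc⟩
  · obtain ⟨z, h1, h2, h3⟩ := hm.separated hc i hi j hj hij
    exact ⟨z, h1, Or.inl h2, h3⟩
  by_cases him : i ∈ m.ids <;> by_cases hjm : j ∈ m.ids
  · obtain ⟨z, h1, h2, h3⟩ := hm.separated m.chain_ids i him j hjm hij
    exact ⟨z, h1.trans hmc, Or.inl h2, h3⟩
  · exact ⟨_, hmc, Or.inl m.chain_ids, iff_of_true him hjm⟩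
  · exact ⟨_, hmc, Or.inl m.chain_ids, iff_of_false him fun h => h hjm⟩
  · have hne : R.ev i ≠ R.ev j := fun he => by
      obtain ⟨t, ht⟩ := RCCS.ev_nonempty.2 (hcR hi)
      exact hij (h.id_unique hs i j t him hjm ht (he ▸ ht : t ∈ R.ev j))
    obtain ⟨Z, hZ, hcfg, hsep⟩ := (h.good hs).separated _ hc _ ⟨i, ⟨hi, him⟩, rfl⟩ _
      ⟨j, ⟨hj, hjm⟩, rfl⟩ hne
    have hd : (m.ids ∪ {k ∈ c \ m.ids | R.ev k ∈ Z}) \ m.ids = {k ∈ c \ m.ids | R.ev k ∈ Z} := by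
      ext k; simp only [Set.mem_sdiff, Set.mem_union, Set.mem_ofPred_eq]; tauto
    refine ⟨m.ids ∪ {k ∈ c \ m.ids | R.ev k ∈ Z}, ?_, Or.inr ⟨Set.subset_union_left, ?_⟩, ?_⟩
    · exact Set.union_subset hmc fun k hk => hk.1.1
    · rw [hd]
      convert hcfg
      ext A
      constructor
      · rintro ⟨k, hk, rfl⟩; exact hk.2
      · intro hA
        obtain ⟨k, hk, rfl⟩ := hZ hA
        exact ⟨k, ⟨hk, hA⟩, rfl⟩
    · simpa [him, hjm, hi, hj] using hsep

/-- If `c` contains `m`, the rest of `c` gives a subset of the trace, which is a configuration, so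
only its two projections have to be checked. Otherwise only chains of the common memory are
possible, and they look the same on both sides. -/
theorem Der.confIds_par {R S : RCCS N T} {m s s'} (hR : Der R (.fork m) s)
    (hS : Der S (.fork m) s') (hs : (s.par s').lin) (hc : (s.par s').cfg ((R.par S).trace m))
    {c : Set ℕ} (hcs : c ⊆ R.ids ∪ S.ids) :
    ConfIds m (s.par s') (R.par S).ev c ↔
      ConfIds (.fork m) s R.ev (c ∩ R.ids) ∧ ConfIds (.fork m) s' S.ev (c ∩ S.ids) := by
  have hmR : m.ids ⊆ R.ids := hR.ids_subset
  have hmS : m.ids ⊆ S.ids := hS.ids_subset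
  have hg := hR.good hs.1
  have hg' := hS.good hs.2.1
  by_cases hmc : m.ids ⊆ c
  · rw [confIds_iff_of_subset (hg.par hg' hs.2.2).cfg_empty hmc,
      confIds_iff_of_subset (m := .fork m) hg.cfg_empty (Set.subset_inter hmc hmR),
      confIds_iff_of_subset (m := .fork m) hg'.cfg_empty (Set.subset_inter hmc hmS)]
    obtain ⟨h1, h2⟩ := part_image_ev hR hS hs.2.2 (c := c \ m.ids) Set.disjoint_sdiff_left
    have e1 : (c ∩ R.ids) \ (Memory.fork m).ids = c \ m.ids ∩ R.ids := by
      ext; simp only [Memory.ids, Set.mem_inter_iff, Set.mem_sdiff]; tauto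
    have e2 : (c ∩ S.ids) \ (Memory.fork m).ids = c \ m.ids ∩ S.ids := by
      ext; simp only [Memory.ids, Set.mem_inter_iff, Set.mem_sdiff]; tauto
    rw [e1, e2, ← h1, ← h2]
    refine ⟨fun h => ⟨h.2.1, h.2.2.1⟩, fun h => Sem.par_cfg_subset hg hg' hc ?_ h.1 h.2⟩
    exact Set.image_mono (Set.sdiff_subset_sdiff_left hcs)
  · have hR' : ¬ (Memory.fork m).ids ⊆ c ∩ R.ids := fun h => hmc (h.trans Set.inter_subset_left)
    have hS' : ¬ (Memory.fork m).ids ⊆ c ∩ S.ids := fun h => hmc (h.trans Set.inter_subset_left)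
    rw [confIds_iff_of_not_subset hmc, confIds_iff_of_not_subset hR',
      confIds_iff_of_not_subset hS']
    constructor
    · intro h
      rw [Set.inter_eq_left.2 (h.subset.trans hmR), Set.inter_eq_left.2 (h.subset.trans hmS)]
      exact ⟨h, h⟩
    · rintro ⟨h, h'⟩
      -- The part of `c` in `S` is a chain of `m`, and `R` contains all identifiers of `m`.
      have : c ⊆ R.ids := fun i hi => (hcs hi).elim id fun h'' => hmR (h'.subset ⟨hi, h''⟩)
      rwa [Set.inter_eq_left.2 this] at h

/-- The event `i` can be counted as the last link of the memory or as the first event of the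
process. The alternative `K` adds nothing, none of its prefixes having been executed. -/
theorem Der.confIds_event {R : RCCS N T} {i l t K m s} (h : Der R (.event i l t K m) s)
    (hi : i ∉ m.ids) (hs : ((s.pre l t).choice K.sem).lin) {c : Set ℕ} (hcR : c ⊆ R.ids) :
    ConfIds m ((s.pre l t).choice K.sem) R.ev c ↔ ConfIds (.event i l t K m) s R.ev c := by
  have hg := h.good hs.1.1
  have hD := Der.event i l t K hi h
  have hev := h.ev_event hi
  have hd : ∀ c : Set ℕ, c \ insert i m.ids = (c \ m.ids) \ {i} := fun c => by
    ext; simp only [Set.mem_sdiff, Set.mem_insert_iff, Set.mem_singleton_iff]; tauto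
  have hev' : ∀ j ∈ c \ m.ids, R.ev j = {t} → j = i := fun j hj hjt =>
    hD.id_unique hs j i t hj.2 hi (hjt ▸ rfl : t ∈ R.ev j) (hev ▸ rfl : t ∈ R.ev i)
  have himg : R.ev '' (c \ m.ids) \ {{t}} = R.ev '' (c \ insert i m.ids) := by
    ext A
    constructor
    · rintro ⟨⟨j, hj, rfl⟩, hA⟩
      exact ⟨j, hd c ▸ ⟨hj, fun hji => hA (by rw [Set.mem_singleton_iff.1 hji, hev]; rfl)⟩, rfl⟩
    · rintro ⟨j, hj, rfl⟩
      rw [hd] at hj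
      exact ⟨⟨j, hj.1, rfl⟩, fun hjt => hj.2 (hev' j hj.1 hjt)⟩
  constructor
  · rintro (hc | ⟨hmc, (hc | ⟨ht, hc⟩) | hc⟩)
    · exact Or.inl (Or.inl hc)
    · rw [Set.image_eq_empty, Set.sdiff_eq_empty] at hc
      rw [hc.antisymm hmc]
      exact Or.inl (Or.inl m.chain_ids)
    · obtain ⟨j, hj, hjt⟩ := ht
      obtain rfl := hev' j hj hjt
      rw [himg] at hc
      exact Or.inr ⟨Set.insert_subset hj.1 hmc, hc⟩
    -- An executed event belonging to `K` would have a tag both in `K` and in the disjoint summand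
    -- of `l`.
    · suffices c \ m.ids = ∅ by
        rw [(Set.sdiff_eq_empty.1 this).antisymm hmc]
        exact Or.inl (Or.inl m.chain_ids)
      refine Set.eq_empty_of_forall_notMem fun j hj => ?_
      obtain ⟨α, hα⟩ := (CCS.good_sem hs.2.1).exists_evs _ hc _ ⟨j, hj, rfl⟩
      obtain ⟨u, hu⟩ := RCCS.ev_nonempty.2 (hcR hj.1)
      refine Set.disjoint_left.1 hs.2.2 ?_ ((CCS.good_sem hs.2.1).subset_tags _ _ hα hu)
      by_cases hji : j = i
      · subst hji
        rw [hev] at hu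
        exact Or.inl hu
      · exact Or.inr (h.ev_subset (fun h' => h'.elim hji hj.2) hu)
  · rintro ((hc | rfl) | ⟨hmc, hc⟩)
    · exact Or.inl hc
    · refine Or.inr ⟨Set.subset_insert _ _, Or.inl (Or.inr ⟨⟨i, ⟨Or.inl rfl, hi⟩, hev⟩, ?_⟩)⟩
      rw [himg, Set.sdiff_self, Set.image_empty]
      exact hg.cfg_empty
    · refine Or.inr ⟨(Set.subset_insert _ _).trans hmc,
        Or.inl (Or.inr ⟨⟨i, ⟨hmc (Or.inl rfl), hi⟩, hev⟩, ?_⟩)⟩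
      rw [himg]
      exact hc

/-- The structure `D` represents the derivative `R` of a thread with memory `m` whose process has
the encoding `s`. -/
structure Rep {U : Type v} (D : IdConfStruct U (Label N) ℕ) (R : RCCS N T) (m : Memory N T)
    (s : Sem N T) : Prop where
  inj : Set.InjOn D.ident D.E
  image : D.ident '' D.E = R.ids
  lab_mem : ∀ e ∈ D.E, D.ident e ∈ m.ids → ∃ l, (D.ident e, l) ∈ m.acts ∧ D.lab e = .act l
  lab_ev : ∀ e ∈ D.E, D.ident e ∉ m.ids → s.evs (R.ev (D.ident e)) (D.lab e)
  subset : ∀ c ∈ D.C, c ⊆ D.E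
  conf : ∀ c ⊆ D.E, c ∈ D.C ↔ ConfIds m s R.ev (D.ident '' c)

theorem Rep.mem_ids {U : Type v} {D : IdConfStruct U (Label N) ℕ} {R : RCCS N T} {m s}
    (h : Rep D R m s) {e : U} (he : e ∈ D.E) : D.ident e ∈ R.ids :=
  h.image ▸ Set.mem_image_of_mem _ he

theorem Rep.image_subset {U : Type v} {D : IdConfStruct U (Label N) ℕ} {R : RCCS N T} {m s}
    (h : Rep D R m s) {c : Set U} (hc : c ⊆ D.E) : D.ident '' c ⊆ R.ids :=
  h.image ▸ Set.image_mono hc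

theorem Rep.par {U : Type v} {V : Type w} [Finite U] [Finite V]
    {D₁ : IdConfStruct U (Label N) ℕ} {D₂ : IdConfStruct V (Label N) ℕ} {R S : RCCS N T} {m s s'}
    (h₁ : Rep D₁ R (.fork m) s) (h₂ : Rep D₂ S (.fork m) s') (hR : Der R (.fork m) s)
    (hS : Der S (.fork m) s') (hs : (s.par s').lin) (hc : (s.par s').cfg ((R.par S).trace m))
    (hm : m.Wf) : Rep (D₁.par D₂) (R.par S) m (s.par s') := by
  have hg := hR.good hs.1
  have hg' := hS.good hs.2.1
  have hmem : ∀ a ∈ D₁.E, ∀ b ∈ D₂.E, D₁.ident a = D₂.ident b → D₁.ident a ∈ m.ids →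
      ∃ l, (D₁.ident a, l) ∈ m.acts ∧ D₁.lab a = .act l ∧ D₂.lab b = .act l := by
    intro a ha b hb hab hi
    obtain ⟨l, hl, hal⟩ := h₁.lab_mem a ha hi
    obtain ⟨l', hl', hbl⟩ := h₂.lab_mem b hb (hab ▸ hi : D₂.ident b ∈ m.ids)
    rw [← hab] at hl'
    exact ⟨l, hl, hal, hm.acts_unique hl hl' ▸ hbl⟩
  have hsync : ∀ a ∈ D₁.E, ∀ b ∈ D₂.E, D₁.ident a = D₂.ident b → D₁.ident a ∉ m.ids →
      ∃ l : Action N, D₁.lab a = .act l ∧ D₂.lab b = .act l.co := by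
    intro a ha b hb hab hi
    have ha' := h₁.mem_ids ha
    have hb' : D₁.ident a ∈ S.ids := hab ▸ h₂.mem_ids hb
    obtain ⟨t, ht⟩ := RCCS.ev_nonempty.2 ha'
    obtain ⟨t', ht'⟩ := RCCS.ev_nonempty.2 hb'
    -- The trace is a configuration, so the joint tag set is an event. Having tags of both
    -- components it must be a synchronisation, and its two halves are the contributions of `R` and
    -- `S`.
    obtain ⟨α, hα | hα | ⟨B, C, l, hB, hC, hBC, -⟩⟩ := hc.1 _ ⟨D₁.ident a, ⟨Or.inl ha', hi⟩, rfl⟩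
    · exact (Set.disjoint_left.1 hs.2.2 (hg.subset_tags _ _ hα (Or.inr ht'))
        (hS.ev_subset hi ht')).elim
    · exact (Set.disjoint_left.1 hs.2.2 (hR.ev_subset hi ht)
        (hg'.subset_tags _ _ hα (Or.inl ht))).elim
    · have hBs := hg.subset_tags _ _ hB
      have hCs := hg'.subset_tags _ _ hC
      obtain ⟨e1, e2⟩ := par_ev_inter hR hS hs.2.2 hi
      rw [hBC, Set.union_inter_distrib_right, Set.inter_eq_left.2 hBs,
        (hs.2.2.symm.mono_left hCs).inter_eq, Set.union_empty] at e1
      rw [hBC, Set.union_inter_distrib_right, Set.inter_eq_left.2 hCs,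
        (hs.2.2.mono_left hBs).inter_eq, Set.empty_union] at e2
      have hla := h₁.lab_ev a ha hi
      have hlb := h₂.lab_ev b hb (hab ▸ hi : D₂.ident b ∉ m.ids)
      rw [← hab] at hlb
      rw [e1] at hB
      rw [e2] at hC
      exact ⟨l, hg.label_unique _ _ _ hla hB, hg'.label_unique _ _ _ hlb hC⟩
  have himg : (D₁.par D₂).ident '' (D₁.par D₂).E = R.ids ∪ S.ids := by
    rw [IdConfStruct.par_ident_image, h₁.image, h₂.image]
    intro a ha b hb hab
    by_cases hi : D₁.ident a ∈ m.ids
    · obtain ⟨l, -, h1, h2⟩ := hmem a ha b hb hab hi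
      exact Or.inr (h1.trans h2.symm)
    · exact Or.inl (hsync a ha b hb hab hi)
  refine ⟨IdConfStruct.par_injOn h₁.inj h₂.inj, himg, ?_, ?_, ?_, ?_⟩
  · intro e he hi
    cases e with
    | left a =>
      rw [IdConfStruct.par_left_mem, h₂.image] at he
      exact (he.2 (hS.ids_subset hi)).elim
    | right b =>
      rw [IdConfStruct.par_right_mem, h₁.image] at he
      exact (he.2 (hR.ids_subset hi)).elim
    | both a b =>
      obtain ⟨ha, hb, hab, -⟩ := IdConfStruct.par_both_mem.1 he
      obtain ⟨l, hl, h1, h2⟩ := hmem a ha b hb hab hi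
      refine ⟨l, hl, ?_⟩
      change (D₁.parLabel D₂ (.both a b)).getD .tau = _
      -- `parLabel` tests complementary labels before equal ones, so a pair from the common memory
      -- must be shown not to become `τ`.
      have hne : ¬ ∃ k : Action N, D₁.lab a = .act k ∧ D₂.lab b = .act k.co := by
        rintro ⟨k, h, h'⟩
        obtain rfl := Label.act.inj (h1.symm.trans h)
        exact l.co_ne (Label.act.inj (h2.symm.trans h')).symm
      rw [IdConfStruct.parLabel, if_neg (not_not.2 hab), if_neg hne, if_pos (h1.trans h2.symm)]
      exact h1
  · intro e he hi
    cases e with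
    | left a =>
      have he' := IdConfStruct.par_left_mem.1 he
      have hlab : (D₁.par D₂).lab (.left a) = D₁.lab a := by
        have : ¬ ∃ b ∈ D₂.E, D₁.ident a = D₂.ident b := fun ⟨b, hb, hab⟩ => he'.2 ⟨b, hb, hab.symm⟩
        change (D₁.parLabel D₂ (.left a)).getD .tau = _
        simp only [IdConfStruct.parLabel, if_neg this, Option.getD]
      rw [hlab, RCCS.ev_par, RCCS.ev_eq_empty (R := S) (h₂.image ▸ he'.2), Set.union_empty]
      exact Or.inl (h₁.lab_ev a he'.1 hi)
    | right b =>
      have he' := IdConfStruct.par_right_mem.1 he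
      have hlab : (D₁.par D₂).lab (.right b) = D₂.lab b := by
        have : ¬ ∃ a ∈ D₁.E, D₁.ident a = D₂.ident b := fun ⟨a, ha, hab⟩ => he'.2 ⟨a, ha, hab⟩
        change (D₁.parLabel D₂ (.right b)).getD .tau = _
        simp only [IdConfStruct.parLabel, if_neg this, Option.getD]
      rw [hlab, RCCS.ev_par, RCCS.ev_eq_empty (R := R) (h₁.image ▸ he'.2), Set.empty_union]
      exact Or.inr (Or.inl (h₂.lab_ev b he'.1 hi))
    | both a b =>
      obtain ⟨ha, hb, hab, -⟩ := IdConfStruct.par_both_mem.1 he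
      obtain ⟨l, h1, h2⟩ := hsync a ha b hb hab hi
      have hlab : (D₁.par D₂).lab (.both a b) = .tau := by
        have : ∃ l : Action N, D₁.lab a = .act l ∧ D₂.lab b = .act l.co := ⟨l, h1, h2⟩
        change (D₁.parLabel D₂ (.both a b)).getD .tau = _
        simp only [IdConfStruct.parLabel, hab, ne_eq, not_true, if_false, if_pos this, Option.getD]
      rw [hlab]
      refine Or.inr (Or.inr ⟨_, _, l, h1 ▸ h₁.lab_ev a ha hi, ?_, rfl, rfl⟩)
      have := h₂.lab_ev b hb (hab ▸ hi : D₂.ident b ∉ m.ids)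
      rwa [h2, ← hab] at this
  · intro c hc
    exact ((ConfStruct.mem_prod_restrict _ _ _ c).1 hc).1
  · intro c hcE
    have hD : Der (R.par S) m (s.par s') := .par hR hS hc
    refine (IdConfStruct.mem_par_iff (F := fun c => c ⊆ R.ids ∪ S.ids ∧
      ConfIds m (s.par s') (R.par S).ev c) h₁.inj h₂.inj h₁.conf h₂.conf ?_ ?_ hcE).trans
      (and_iff_right (himg ▸ Set.image_mono hcE))
    · intro d hd
      rw [himg] at hd
      rw [h₁.image, h₂.image, hR.confIds_par hS hs hc hd]
      exact and_iff_right hd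
    · rintro d ⟨hd, hd'⟩ i hi j hj hij
      obtain ⟨z, h1, h2, h3⟩ := hD.confIds_separated hs hm hd' hd i hi j hj hij
      exact ⟨z, h1, ⟨h1.trans hd, h2⟩, h3⟩

instance Memory.finite_ev (m : Memory N T) : Finite m.Ev := by
  induction m with
  | empty => exact inferInstanceAs (Finite Empty)
  | fork m ih => exact ih
  | event i l t K m ih => exact inferInstanceAs (Finite (Option m.Ev))

instance RCCS.finite_memEv (R : RCCS N T) : Finite R.MemEv := by
  induction R with
  | thread m P => exact inferInstanceAs (Finite m.Ev)
  | par R S ih ih' => exact inferInstanceAs (Finite (StarProd R.MemEv S.MemEv))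
  | res R a ih => exact ih

/-- Memory encodings ignore tags, hence the arbitrary `g`. In the case `event`, the identifier
passes from the memory to the process without changing the structure. In the case `res`, the trace
being a configuration rules out the restricted labels. -/
theorem Der.rep {T' : Type} (g : T → T') {R : RCCS N T} {m s} (h : Der R m s) (hs : s.lin)
    (hm : m.Wf) : Rep (R.mapTag g).encMem R m s := by
  induction h with
  | base m P =>
    have h := hm.rep g
    refine ⟨h.inj, h.image, fun e he _ => h.lab e he, fun e he hi => ?_, h.subset, fun c hc => ?_⟩
    · exact (hi (h.image ▸ ⟨e, he, rfl⟩)).elim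
    · refine (h.conf c hc).trans ⟨Or.inl, fun h' => h'.elim id fun h' => ?_⟩
      exact ((h.image ▸ Set.image_mono hc : _ ⊆ m.ids).antisymm h'.1) ▸ m.chain_ids
  | @event R m s i l t K hi hD ih =>
    have h := ih hs.1.1 ⟨hi, hm⟩
    refine ⟨h.inj, h.image, fun e he hei => ?_, fun e he hei => ?_, h.subset, fun c hc => ?_⟩
    · obtain ⟨k, hk, hk'⟩ := h.lab_mem e he (Or.inr hei)
      refine ⟨k, hk.resolve_left fun h' => hi ?_, hk'⟩
      have h'' : (R.mapTag g).encMem.ident e = i := congrArg Prod.fst h'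
      exact h'' ▸ hei
    · by_cases hei' : (R.mapTag g).encMem.ident e = i
      · obtain ⟨k, hk, hk'⟩ := h.lab_mem e he (Or.inl hei')
        have hkl : k = l := by
          refine congrArg Prod.snd (hk.resolve_right fun h' => hei ?_)
          exact Memory.mem_ids_iff_acts.2 ⟨k, h'⟩
        rw [hk', hkl, hei', hD.ev_event hi]
        exact Or.inl (Or.inl ⟨rfl, rfl⟩)
      · exact Or.inl (Or.inr (h.lab_ev e he fun h' => h'.elim hei' hei))
    · rw [h.conf c hc, hD.confIds_event hi hs (h.image_subset hc)]
  | par hR hS hc ih ih' =>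
    exact (ih hs.1 hm).par (ih' hs.2.1 hm) hR hS hs hc hm
  | @res R m s a ha hD hc ih =>
    have h := ih hs hm
    refine ⟨h.inj, h.image, h.lab_mem, fun e he hei => ?_, h.subset, fun c hcE => ?_⟩
    · refine ⟨h.lab_ev e he hei, ?_⟩
      obtain ⟨α, hα, hα'⟩ := hc.2 _ ⟨_, ⟨h.mem_ids he, hei⟩, rfl⟩
      rwa [(hD.good hs).label_unique _ _ _ hα (h.lab_ev e he hei)] at hα'
    · refine (h.conf c hcE).trans (or_congr_right (and_congr_right fun _ => ⟨fun h' => ⟨h', ?_⟩,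
        fun h' => h'.1⟩))
      exact fun A hA => hc.2 A (Set.image_mono (Set.sdiff_subset_sdiff_left
        (h.image_subset hcE)) hA)

end

section

variable {N : Type u} {T : Type}

/-! ### The tag encoding and the encoding of located terms -/

/-- The structure `S` is isomorphic to the encoding `s` along `pos`. -/
structure Link {U : Type v} (S : ConfStruct U (Label N)) (s : Sem N T) (pos : U → Set T) :
    Prop where
  inj : Function.Injective pos
  nonempty : ∀ e, (pos e).Nonempty
  subset : ∀ e, pos e ⊆ s.tags
  evs : ∀ A α, s.evs A α ↔ ∃ e ∈ S.E, pos e = A ∧ S.lab e = α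
  conf : ∀ x, x ∈ S.C ↔ s.cfg (pos '' x)

theorem Link.evs_pos {U : Type v} {S : ConfStruct U (Label N)} {s : Sem N T} {pos : U → Set T}
    (h : Link S s pos) (e : U) (α : Label N) : s.evs (pos e) α ↔ e ∈ S.E ∧ S.lab e = α := by
  rw [h.evs]
  constructor
  · rintro ⟨e', he', hee', hα⟩
    obtain rfl := h.inj hee'
    exact ⟨he', hα⟩
  · rintro ⟨he, hα⟩
    exact ⟨e, he, rfl, hα⟩

theorem Link.exists_evs_pos {U : Type v} {S : ConfStruct U (Label N)} {s : Sem N T}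
    {pos : U → Set T} (h : Link S s pos) (e : U) : (∃ α, s.evs (pos e) α) ↔ e ∈ S.E := by
  simp only [h.evs_pos, exists_and_left, exists_eq', and_true]

theorem Link.nil (pos : Empty → Set T) (lab : Empty → Label N) :
    Link (ConfStruct.zero lab) Sem.nil pos where
  inj := fun e => e.elim
  nonempty := fun e => e.elim
  subset := fun e => e.elim
  evs := fun _ _ => iff_of_false id fun ⟨e, _⟩ => e.elim
  conf := fun _ => Set.image_eq_empty.symm

theorem Link.pre {U : Type v} {S : ConfStruct U (Label N)} {s : Sem N T} {pos : U → Set T}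
    (h : Link S s pos) (l : Action N) {t : T} (ht : t ∉ s.tags)
    {pos' : Option U → Set T} (h0 : pos' none = {t}) (h1 : ∀ e, pos' (some e) = pos e) :
    Link (S.prefixing (.act l)) (s.pre l t) pos' := by
  have hne : ∀ e, pos e ≠ {t} := fun e he => ht (h.subset e (he ▸ rfl))
  have hmem : ∀ x : Set (Option U), {t} ∈ pos' '' x ↔ none ∈ x := by
    intro x
    refine ⟨?_, fun hx => ⟨none, hx, h0⟩⟩
    rintro ⟨_ | e, he, het⟩
    · exact he
    · exact (hne e ((h1 e).symm.trans het)).elim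
  have hdiff : ∀ x : Set (Option U), pos' '' x \ {{t}} = pos '' (some ⁻¹' x) := by
    intro x
    ext A
    constructor
    · rintro ⟨⟨_ | e, he, rfl⟩, hA⟩
      · exact (hA h0).elim
      · exact ⟨e, he, (h1 e).symm⟩
    · rintro ⟨e, he, rfl⟩
      exact ⟨⟨some e, he, h1 e⟩, hne e⟩
  constructor
  · rintro (_ | e) (_ | e') hee
    · rfl
    · exact (hne e' ((h1 e').symm.trans (hee.symm.trans h0))).elim
    · exact (hne e ((h1 e).symm.trans (hee.trans h0))).elim
    · rw [h1, h1] at hee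
      exact congrArg some (h.inj hee)
  · rintro (_ | e)
    · rw [h0]; exact Set.singleton_nonempty t
    · rw [h1]; exact h.nonempty e
  · rintro (_ | e)
    · rw [h0]; exact Set.singleton_subset_iff.2 (Or.inl rfl)
    · rw [h1]; exact (h.subset e).trans (Set.subset_insert _ _)
  · intro A α
    constructor
    · rintro (⟨rfl, rfl⟩ | hA)
      · exact ⟨none, Or.inl rfl, h0, rfl⟩
      · obtain ⟨e, he, rfl, rfl⟩ := (h.evs A α).1 hA
        exact ⟨some e, Or.inr ⟨e, he, rfl⟩, h1 e, rfl⟩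
    · rintro ⟨_, rfl | ⟨e, he, rfl⟩, rfl, rfl⟩
      · exact Or.inl ⟨h0, rfl⟩
      · exact Or.inr ((h.evs _ _).2 ⟨e, he, (h1 e).symm, rfl⟩)
  · intro x
    refine or_congr Set.image_eq_empty.symm ?_
    rw [hmem, hdiff]
    constructor
    · rintro ⟨y, hy, rfl⟩
      refine ⟨Or.inl rfl, (h.conf _).1 ?_⟩
      convert hy
      ext e
      simp
    · rintro ⟨hx, hc⟩
      refine ⟨_, (h.conf _).2 hc, ?_⟩
      ext (_ | e)
      · simp [hx]
      · simp

theorem Link.choice {U : Type v} {V : Type w} {S₁ : ConfStruct U (Label N)}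
    {S₂ : ConfStruct V (Label N)} {s₁ s₂ : Sem N T} {pos₁ : U → Set T} {pos₂ : V → Set T}
    (h₁ : Link S₁ s₁ pos₁) (h₂ : Link S₂ s₂ pos₂) (hg₁ : s₁.Good) (hg₂ : s₂.Good)
    (hd : Disjoint s₁.tags s₂.tags) {pos' : U ⊕ V → Set T} (hl : ∀ e, pos' (.inl e) = pos₁ e)
    (hr : ∀ e, pos' (.inr e) = pos₂ e) : Link (S₁.coprod S₂) (s₁.choice s₂) pos' := by
  have himl : ∀ y : Set U, pos' '' (Sum.inl '' y) = pos₁ '' y := fun y => by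
    rw [Set.image_image]; exact Set.image_congr fun e _ => hl e
  have himr : ∀ y : Set V, pos' '' (Sum.inr '' y) = pos₂ '' y := fun y => by
    rw [Set.image_image]; exact Set.image_congr fun e _ => hr e
  have hne : ∀ e e', pos₁ e ≠ pos₂ e' := fun e e' he => by
    obtain ⟨t, ht⟩ := h₁.nonempty e
    exact Set.disjoint_left.1 hd (h₁.subset e ht) (h₂.subset e' (he ▸ ht))
  constructor
  · rintro (e | e) (e' | e') hee
    · rw [hl, hl] at hee; rw [h₁.inj hee]
    · rw [hl, hr] at hee; exact (hne _ _ hee).elim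
    · rw [hl, hr] at hee; exact (hne _ _ hee.symm).elim
    · rw [hr, hr] at hee; rw [h₂.inj hee]
  · rintro (e | e)
    · rw [hl]; exact h₁.nonempty e
    · rw [hr]; exact h₂.nonempty e
  · rintro (e | e)
    · rw [hl]; exact (h₁.subset e).trans Set.subset_union_left
    · rw [hr]; exact (h₂.subset e).trans Set.subset_union_right
  · intro A α
    constructor
    · rintro (hA | hA)
      · obtain ⟨e, he, rfl, rfl⟩ := (h₁.evs A α).1 hA
        exact ⟨.inl e, Or.inl ⟨e, he, rfl⟩, hl e, rfl⟩
      · obtain ⟨e, he, rfl, rfl⟩ := (h₂.evs A α).1 hA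
        exact ⟨.inr e, Or.inr ⟨e, he, rfl⟩, hr e, rfl⟩
    · rintro ⟨_, ⟨e, he, rfl⟩ | ⟨e, he, rfl⟩, rfl, rfl⟩
      · exact Or.inl ((h₁.evs _ _).2 ⟨e, he, (hl e).symm, rfl⟩)
      · exact Or.inr ((h₂.evs _ _).2 ⟨e, he, (hr e).symm, rfl⟩)
  · intro x
    refine or_congr ⟨?_, fun hx => ?_⟩ ⟨?_, fun hx => ?_⟩
    · rintro ⟨y, hy, rfl⟩
      rw [himl]; exact (h₁.conf y).1 hy
    · have : x = Sum.inl '' (Sum.inl ⁻¹' x) := by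
        rw [Set.image_preimage_eq_iff.2]
        rintro (e | e) he
        · exact ⟨e, rfl⟩
        · obtain ⟨α, hα⟩ := hg₁.exists_evs _ hx _ ⟨_, he, hr e⟩
          obtain ⟨e', -, he', -⟩ := (h₁.evs _ _).1 hα
          exact (hne e' e he').elim
      refine ⟨_, (h₁.conf _).2 ?_, this⟩
      rwa [this, himl] at hx
    · rintro ⟨y, hy, rfl⟩
      rw [himr]; exact (h₂.conf y).1 hy
    · have : x = Sum.inr '' (Sum.inr ⁻¹' x) := by
        rw [Set.image_preimage_eq_iff.2]
        rintro (e | e) he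
        · obtain ⟨α, hα⟩ := hg₂.exists_evs _ hx _ ⟨_, he, hl e⟩
          obtain ⟨e', -, he', -⟩ := (h₂.evs _ _).1 hα
          exact (hne e e' he'.symm).elim
        · exact ⟨e, rfl⟩
      refine ⟨_, (h₂.conf _).2 ?_, this⟩
      rwa [this, himr] at hx

theorem Link.res {U : Type v} {S : ConfStruct U (Label N)} {s : Sem N T} {pos : U → Set T}
    (h : Link S s pos) (hg : s.Good) (a : N) :
    Link (S.restrict {e | ¬ (S.lab e).Mentions a}) (s.res a) pos where
  inj := h.inj
  nonempty := h.nonempty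
  subset := h.subset
  evs := fun A α => by
    constructor
    · rintro ⟨hA, ha⟩
      obtain ⟨e, he, rfl, rfl⟩ := (h.evs A α).1 hA
      exact ⟨e, ⟨he, ha⟩, rfl, rfl⟩
    · rintro ⟨e, he, rfl, rfl⟩
      exact ⟨(h.evs_pos _ _).2 ⟨he.1, rfl⟩, he.2⟩
  conf := fun x => by
    refine (and_congr_left fun _ => h.conf x).trans (and_congr_right fun hx => ?_)
    rw [Set.forall_mem_image]
    refine forall₂_congr fun e he => ?_
    obtain ⟨α, hα⟩ := hg.exists_evs _ hx _ ⟨e, he, rfl⟩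
    have hE := ((h.evs_pos e α).1 hα).1
    simp only [h.evs_pos, hE, true_and, exists_eq_left']
    rfl

open Classical in
theorem syncLabel_inr_eq {α β : Label N} :
    syncLabel (.inr (α, β)) = if ∃ l : Action N, α = .act l ∧ β = .act l.co then some .tau
      else none := by
  cases α with
  | tau => rw [if_neg]; · rfl
           rintro ⟨l, h, -⟩; cases h
  | act l =>
    cases β with
    | tau => rw [if_neg]; · rfl
             rintro ⟨l, -, h⟩; cases h
    | act k =>
      simp only [syncLabel]
      congr 1
      simp only [Label.act.injEq, exists_eq_left']

namespace ConfStruct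

variable {U : Type v} {V : Type w} {S₁ : ConfStruct U (Label N)} {S₂ : ConfStruct V (Label N)}

theorem par_left_mem {a : U} : StarProd.left a ∈ (S₁.par S₂).E ↔ a ∈ S₁.E := by
  refine ⟨fun h => h.1.1 a rfl, fun h => ⟨⟨fun a' ha' => ?_, fun b hb => ?_⟩,
    Option.some_ne_none _⟩⟩
  · cases ha'; exact h
  · cases hb

theorem par_right_mem {b : V} : StarProd.right b ∈ (S₁.par S₂).E ↔ b ∈ S₂.E := by
  refine ⟨fun h => h.1.2 b rfl, fun h => ⟨⟨fun a ha => ?_, fun b' hb' => ?_⟩,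
    Option.some_ne_none _⟩⟩
  · cases ha
  · cases hb'; exact h

theorem par_both_mem {a : U} {b : V} : StarProd.both a b ∈ (S₁.par S₂).E ↔
    a ∈ S₁.E ∧ b ∈ S₂.E ∧ ∃ l : Action N, S₁.lab a = .act l ∧ S₂.lab b = .act l.co := by
  have h2 : syncLabel (.inr (S₁.lab a, S₂.lab b)) ≠ none ↔
      ∃ l : Action N, S₁.lab a = .act l ∧ S₂.lab b = .act l.co := by
    rw [syncLabel_inr_eq]
    split_ifs with h
    · exact iff_of_true (Option.some_ne_none _) h
    · exact iff_of_false (fun h' => h' rfl) h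
  rw [← and_assoc]
  refine and_congr ⟨fun h => ⟨h.1 a rfl, h.2 b rfl⟩,
    fun h => ⟨fun a' ha' => ?_, fun b' hb' => ?_⟩⟩ h2
  · cases ha'; exact h.1
  · cases hb'; exact h.2

theorem par_both_lab {a : U} {b : V} (h : StarProd.both a b ∈ (S₁.par S₂).E) :
    (S₁.par S₂).lab (.both a b) = .tau := by
  change (syncLabel (.inr (S₁.lab a, S₂.lab b))).getD .tau = _
  rw [syncLabel_inr_eq, if_pos (par_both_mem.1 h).2.2]
  rfl

end ConfStruct

/-- Intersecting a tag set with the tags of one side recovers the component of the event on that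
side. This turns projections of the product into `part`. -/
theorem Link.par {U : Type v} {V : Type w} [Finite U] [Finite V] {S₁ : ConfStruct U (Label N)}
    {S₂ : ConfStruct V (Label N)} {s₁ s₂ : Sem N T} {pos₁ : U → Set T} {pos₂ : V → Set T}
    (h₁ : Link S₁ s₁ pos₁) (h₂ : Link S₂ s₂ pos₂) (hg₁ : s₁.Good) (hg₂ : s₂.Good)
    (hd : Disjoint s₁.tags s₂.tags) {pos' : StarProd U V → Set T}
    (hl : ∀ e, pos' (.left e) = pos₁ e) (hr : ∀ e, pos' (.right e) = pos₂ e)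
    (hb : ∀ e e', pos' (.both e e') = pos₁ e ∪ pos₂ e') :
    Link (S₁.par S₂) (s₁.par s₂) pos' := by
  have hi1 : ∀ e, pos' e ∩ s₁.tags = e.fst.elim ∅ pos₁ := by
    rintro (a | b | ⟨a, b⟩)
    · rw [hl]; exact Set.inter_eq_left.2 (h₁.subset a)
    · rw [hr]; exact (hd.symm.mono_left (h₂.subset b)).inter_eq
    · rw [hb, Set.union_inter_distrib_right, Set.inter_eq_left.2 (h₁.subset a),
        (hd.symm.mono_left (h₂.subset b)).inter_eq, Set.union_empty]; rfl
  have hi2 : ∀ e, pos' e ∩ s₂.tags = e.snd.elim ∅ pos₂ := by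
    rintro (a | b | ⟨a, b⟩)
    · rw [hl]; exact (hd.mono_left (h₁.subset a)).inter_eq
    · rw [hr]; exact Set.inter_eq_left.2 (h₂.subset b)
    · rw [hb, Set.union_inter_distrib_right, Set.inter_eq_left.2 (h₂.subset b),
        (hd.mono_left (h₁.subset a)).inter_eq, Set.empty_union]; rfl
  have hinj : Function.Injective pos' := by
    intro e e' hee
    refine StarProd.ext' ?_ ?_
    · have h := (hi1 e).symm.trans ((congrArg (· ∩ s₁.tags) hee).trans (hi1 e'))
      cases h3 : e.fst <;> cases h4 : e'.fst <;> rw [h3, h4] at h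
      · exact ((h₁.nonempty _).ne_empty h.symm).elim
      · exact ((h₁.nonempty _).ne_empty h).elim
      · exact congrArg some (h₁.inj h)
    · have h := (hi2 e).symm.trans ((congrArg (· ∩ s₂.tags) hee).trans (hi2 e'))
      cases h3 : e.snd <;> cases h4 : e'.snd <;> rw [h3, h4] at h
      · exact ((h₂.nonempty _).ne_empty h.symm).elim
      · exact ((h₂.nonempty _).ne_empty h).elim
      · exact congrArg some (h₂.inj h)
  have hevs : ∀ A α, (s₁.par s₂).evs A α ↔
      ∃ e ∈ (S₁.par S₂).E, pos' e = A ∧ (S₁.par S₂).lab e = α := by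
    intro A α
    constructor
    · rintro (hA | hA | ⟨B, C, l, hB, hC, rfl, rfl⟩)
      · obtain ⟨e, he, rfl, rfl⟩ := (h₁.evs A α).1 hA
        exact ⟨.left e, ConfStruct.par_left_mem.2 he, hl e, rfl⟩
      · obtain ⟨e, he, rfl, rfl⟩ := (h₂.evs A α).1 hA
        exact ⟨.right e, ConfStruct.par_right_mem.2 he, hr e, rfl⟩
      · obtain ⟨e, he, rfl, hle⟩ := (h₁.evs _ _).1 hB
        obtain ⟨e', he', rfl, hle'⟩ := (h₂.evs _ _).1 hC
        have hm := ConfStruct.par_both_mem.2 ⟨he, he', l, hle, hle'⟩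
        exact ⟨.both e e', hm, hb e e', ConfStruct.par_both_lab hm⟩
    · rintro ⟨e, he, rfl, rfl⟩
      cases e with
      | left a =>
        rw [hl]
        exact Or.inl ((h₁.evs_pos _ _).2 ⟨ConfStruct.par_left_mem.1 he, rfl⟩)
      | right b =>
        rw [hr]
        exact Or.inr (Or.inl ((h₂.evs_pos _ _).2 ⟨ConfStruct.par_right_mem.1 he, rfl⟩))
      | both a b =>
        obtain ⟨ha, hb', l, h1, h2⟩ := ConfStruct.par_both_mem.1 he
        rw [hb, ConfStruct.par_both_lab he]
        exact Or.inr (Or.inr ⟨_, _, l, (h₁.evs_pos _ _).2 ⟨ha, h1⟩,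
          (h₂.evs_pos _ _).2 ⟨hb', h2⟩, rfl, rfl⟩)
  have hp1 : ∀ x, part s₁.tags (pos' '' x) = pos₁ '' StarProd.image₁ x := by
    intro x
    ext B
    constructor
    · rintro ⟨hB, _, ⟨e, he, rfl⟩, rfl⟩
      rw [hi1] at hB ⊢
      cases h : e.fst with
      | none => rw [h] at hB; exact (Set.not_nonempty_empty hB).elim
      | some a => exact ⟨a, ⟨e, he, h⟩, rfl⟩
    · rintro ⟨a, ⟨e, he, h⟩, rfl⟩
      exact ⟨h₁.nonempty a, _, ⟨e, he, rfl⟩, by rw [hi1, h]; rfl⟩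
  have hp2 : ∀ x, part s₂.tags (pos' '' x) = pos₂ '' StarProd.image₂ x := by
    intro x
    ext B
    constructor
    · rintro ⟨hB, _, ⟨e, he, rfl⟩, rfl⟩
      rw [hi2] at hB ⊢
      cases h : e.snd with
      | none => rw [h] at hB; exact (Set.not_nonempty_empty hB).elim
      | some a => exact ⟨a, ⟨e, he, h⟩, rfl⟩
    · rintro ⟨a, ⟨e, he, h⟩, rfl⟩
      exact ⟨h₂.nonempty a, _, ⟨e, he, rfl⟩, by rw [hi2, h]; rfl⟩
  refine ⟨hinj, ?_, ?_, hevs, ?_⟩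
  · rintro (a | b | ⟨a, b⟩)
    · rw [hl]; exact h₁.nonempty a
    · rw [hr]; exact h₂.nonempty b
    · rw [hb]; exact (h₁.nonempty a).mono Set.subset_union_left
  · rintro (a | b | ⟨a, b⟩)
    · rw [hl]; exact (h₁.subset a).trans Set.subset_union_left
    · rw [hr]; exact (h₂.subset b).trans Set.subset_union_right
    · rw [hb]; exact Set.union_subset_union (h₁.subset a) (h₂.subset b)
  · intro x
    refine (ConfStruct.mem_prod_restrict _ _ _ x).trans ?_
    have hE : x ⊆ (S₁.par S₂).E ↔ ∀ A ∈ pos' '' x, ∃ α, Sem.parEvs s₁ s₂ A α := by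
      rw [Set.forall_mem_image]
      refine forall₂_congr fun e he => ?_
      constructor
      · intro h
        exact ⟨_, (hevs _ _).2 ⟨e, h, rfl, rfl⟩⟩
      · rintro ⟨α, hα⟩
        obtain ⟨e', he', h, -⟩ := (hevs _ _).1 hα
        exact hinj h ▸ he'
    refine and_congr hE ?_
    rw [hp1, hp2, h₁.conf, h₂.conf]
    refine and_congr_right fun hc1 => and_congr_right fun hc2 => and_congr ?_ ?_
    · rw [Set.forall_mem_image]
      refine forall₂_congr fun e he => ?_
      rw [Set.forall_mem_image]
      refine forall₂_congr fun e' he' => ?_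
      rw [hinj.eq_iff]
      refine imp_congr_left ⟨?_, ?_⟩
      · rintro (⟨a, ha, ha'⟩ | ⟨b, hb, hb'⟩)
        · obtain ⟨t, ht⟩ := h₁.nonempty a
          have h1 := hi1 e
          have h2 := hi1 e'
          rw [ha] at h1
          rw [ha'] at h2
          exact ⟨t, (h1.symm ▸ ht : t ∈ pos' e ∩ s₁.tags).1, (h2.symm ▸ ht : t ∈ pos' e' ∩ s₁.tags).1⟩
        · obtain ⟨t, ht⟩ := h₂.nonempty b
          have h1 := hi2 e
          have h2 := hi2 e'
          rw [hb] at h1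
          rw [hb'] at h2
          exact ⟨t, (h1.symm ▸ ht : t ∈ pos' e ∩ s₂.tags).1, (h2.symm ▸ ht : t ∈ pos' e' ∩ s₂.tags).1⟩
      -- A common tag only says that two components on one side overlap; they coincide by
      -- `Sem.Good.disj`, since the projection is a configuration.
      · rintro ⟨t, ht, ht'⟩
        have hpos : pos' e ⊆ s₁.tags ∪ s₂.tags := by
          rcases e with a | b | ⟨a, b⟩
          · rw [hl]; exact (h₁.subset a).trans Set.subset_union_left
          · rw [hr]; exact (h₂.subset b).trans Set.subset_union_right
          · rw [hb]; exact Set.union_subset_union (h₁.subset a) (h₂.subset b)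
        rcases hpos ht with hts | hts
        · have h1 : t ∈ pos' e ∩ s₁.tags := ⟨ht, hts⟩
          have h2 : t ∈ pos' e' ∩ s₁.tags := ⟨ht', hts⟩
          rw [hi1] at h1 h2
          cases h3 : e.fst with
          | none => rw [h3] at h1; exact h1.elim
          | some a =>
            cases h4 : e'.fst with
            | none => rw [h4] at h2; exact h2.elim
            | some a' =>
              rw [h3] at h1
              rw [h4] at h2
              have := hg₁.disj _ hc1 _ ⟨a, ⟨e, he, h3⟩, rfl⟩ _ ⟨a', ⟨e', he', h4⟩, rfl⟩ ⟨t, h1, h2⟩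
              exact Or.inl ⟨a, rfl, congrArg some (h₁.inj this).symm⟩
        · have h1 : t ∈ pos' e ∩ s₂.tags := ⟨ht, hts⟩
          have h2 : t ∈ pos' e' ∩ s₂.tags := ⟨ht', hts⟩
          rw [hi2] at h1 h2
          cases h3 : e.snd with
          | none => rw [h3] at h1; exact h1.elim
          | some a =>
            cases h4 : e'.snd with
            | none => rw [h4] at h2; exact h2.elim
            | some a' =>
              rw [h3] at h1
              rw [h4] at h2
              have := hg₂.disj _ hc2 _ ⟨a, ⟨e, he, h3⟩, rfl⟩ _ ⟨a', ⟨e', he', h4⟩, rfl⟩ ⟨t, h1, h2⟩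
              exact Or.inr ⟨a, rfl, congrArg some (h₂.inj this).symm⟩
    · rw [Set.forall_mem_image]
      refine forall₂_congr fun e he => ?_
      rw [Set.forall_mem_image]
      refine forall₂_congr fun e' he' => ?_
      rw [hinj.ne_iff]
      refine imp_congr_right fun _ => ⟨?_, ?_⟩
      · rintro ⟨z, hz, hz1, hz2, hsep⟩
        refine ⟨pos' '' z, Set.image_mono hz, ?_, ?_, ?_⟩
        · rw [hp1]; exact (h₁.conf _).1 hz1
        · rw [hp2]; exact (h₂.conf _).1 hz2
        · rwa [hinj.mem_set_image, hinj.mem_set_image]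
      · rintro ⟨Z, hZ, hz1, hz2, hsep⟩
        obtain ⟨z, hz, rfl⟩ := Set.subset_image_iff.1 hZ
        rw [hp1] at hz1
        rw [hp2] at hz2
        rw [hinj.mem_set_image, hinj.mem_set_image] at hsep
        exact ⟨z, hz, (h₁.conf _).2 hz1, (h₂.conf _).2 hz2, hsep⟩

instance CCS.finite_ev (P : CCS N T) : Finite P.Ev := by
  induction P with
  | nil => exact inferInstanceAs (Finite Empty)
  | pre l t P ih => exact inferInstanceAs (Finite (Option P.Ev))
  | sum l s P k t Q ih ih' => exact inferInstanceAs (Finite (Option P.Ev ⊕ Option Q.Ev))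
  | par P Q ih ih' => exact inferInstanceAs (Finite (StarProd P.Ev Q.Ev))
  | res P a ih => exact ih

theorem CCS.mapTag_mapTag {T' T'' : Type} (g : T → T') (h : T' → T'') (P : CCS N T) :
    (P.mapTag g).mapTag h = P.mapTag (h ∘ g) := by
  induction P with
  | nil => rfl
  | pre l t P ih => simp only [CCS.mapTag, ih, Function.comp_apply]
  | sum l s P k t Q ih ih' => simp only [CCS.mapTag, ih, ih', Function.comp_apply]
  | par P Q ih ih' => simp only [CCS.mapTag, ih, ih']
  | res P a ih => simp only [CCS.mapTag, ih]

theorem CCS.tags_locate {T₀ : Type} (P : CCS N T₀) (g : List Bool → T) :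
    (P.locate.mapTag g).sem.tags ⊆ Set.range g := by
  induction P generalizing g with
  | nil => exact Set.empty_subset _
  | pre l t P ih =>
    simp only [CCS.locate, CCS.mapTag, CCS.mapTag_mapTag, CCS.sem, Sem.pre]
    exact Set.insert_subset ⟨_, rfl⟩ ((ih _).trans (Set.range_comp_subset_range _ _))
  | sum l s P k t Q ih ih' =>
    simp only [CCS.locate, CCS.mapTag, CCS.mapTag_mapTag, CCS.sem, Sem.pre, Sem.choice]
    exact Set.union_subset
      (Set.insert_subset ⟨_, rfl⟩ ((ih _).trans (Set.range_comp_subset_range _ _)))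
      (Set.insert_subset ⟨_, rfl⟩ ((ih' _).trans (Set.range_comp_subset_range _ _)))
  | par P Q ih ih' =>
    simp only [CCS.locate, CCS.mapTag, CCS.mapTag_mapTag, CCS.sem, Sem.par]
    exact Set.union_subset ((ih _).trans (Set.range_comp_subset_range _ _))
      ((ih' _).trans (Set.range_comp_subset_range _ _))
  | res P a ih => exact ih g

/-- Locating a subterm prepends a path to all its positions, so the induction needs an arbitrary
injective `g`. Tags are distinct because the paths diverge. -/
theorem CCS.link_locate {T₀ : Type} (P : CCS N T₀) (g : List Bool → T)
    (hg : Function.Injective g) : (P.locate.mapTag g).sem.lin ∧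
      Link P.enc (P.locate.mapTag g).sem (fun e => g '' P.positions e) := by
  induction P generalizing g with
  | nil => exact ⟨trivial, Link.nil _ _⟩
  | pre l t P ih =>
    simp only [CCS.locate, CCS.mapTag, CCS.mapTag_mapTag, CCS.sem]
    have hinj : Function.Injective (g ∘ fun p => false :: p) := hg.comp (List.cons_injective)
    obtain ⟨h1, h2⟩ := ih _ hinj
    have ht : g [] ∉ (P.locate.mapTag (g ∘ fun p => false :: p)).sem.tags := fun h => by
      obtain ⟨p, hp⟩ := CCS.tags_locate P _ h
      exact List.cons_ne_nil _ _ (hg hp)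
    exact ⟨⟨h1, ht⟩, h2.pre l ht (Set.image_singleton) fun e => (Set.image_comp _ _ _).symm⟩
  | sum l s P k t Q ih ih' =>
    simp only [CCS.locate, CCS.mapTag, CCS.mapTag_mapTag, CCS.sem]
    have hinj : Function.Injective (g ∘ fun p => false :: false :: p) :=
      hg.comp (List.cons_injective.comp List.cons_injective)
    have hinj' : Function.Injective (g ∘ fun p => true :: false :: p) :=
      hg.comp (List.cons_injective.comp List.cons_injective)
    obtain ⟨h1, h2⟩ := ih _ hinj
    obtain ⟨h1', h2'⟩ := ih' _ hinj'
    have ht : g [false] ∉ (P.locate.mapTag (g ∘ fun p => false :: false :: p)).sem.tags :=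
      fun h => by
        obtain ⟨p, hp⟩ := CCS.tags_locate P _ h
        exact absurd (hg hp) (by simp)
    have ht' : g [true] ∉ (Q.locate.mapTag (g ∘ fun p => true :: false :: p)).sem.tags :=
      fun h => by
        obtain ⟨p, hp⟩ := CCS.tags_locate Q _ h
        exact absurd (hg hp) (by simp)
    have hd : Disjoint
        (insert (g [false]) (P.locate.mapTag (g ∘ fun p => false :: false :: p)).sem.tags)
        (insert (g [true]) (Q.locate.mapTag (g ∘ fun p => true :: false :: p)).sem.tags) := by
      have key : ∀ u ∈ insert (g [false])
          (P.locate.mapTag (g ∘ fun p => false :: false :: p)).sem.tags,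
          ∃ p, g (false :: p) = u := by
        rintro u (rfl | hu)
        · exact ⟨_, rfl⟩
        · obtain ⟨p, rfl⟩ := CCS.tags_locate P _ hu
          exact ⟨_, rfl⟩
      have key' : ∀ u ∈ insert (g [true])
          (Q.locate.mapTag (g ∘ fun p => true :: false :: p)).sem.tags,
          ∃ p, g (true :: p) = u := by
        rintro u (rfl | hu)
        · exact ⟨_, rfl⟩
        · obtain ⟨p, rfl⟩ := CCS.tags_locate Q _ hu
          exact ⟨_, rfl⟩
      refine Set.disjoint_left.2 fun u hu hu' => ?_
      obtain ⟨p, hp⟩ := key u hu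
      obtain ⟨q, hq⟩ := key' u hu'
      exact absurd (hg (hp.trans hq.symm)) (by simp)
    refine ⟨⟨⟨h1, ht⟩, ⟨h1', ht'⟩, hd⟩, Link.choice
      (h2.pre l ht (pos' := fun e => g '' (CCS.sum l s P k t Q).positions (.inl e))
        Set.image_singleton fun e => (Set.image_comp _ _ _).symm)
      (h2'.pre k ht' (pos' := fun e => g '' (CCS.sum l s P k t Q).positions (.inr e))
        Set.image_singleton fun e => (Set.image_comp _ _ _).symm)
      ((CCS.good_sem h1).pre l ht) ((CCS.good_sem h1').pre k ht') hd
      (fun _ => rfl) (fun _ => rfl)⟩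
  | par P Q ih ih' =>
    simp only [CCS.locate, CCS.mapTag, CCS.mapTag_mapTag, CCS.sem]
    obtain ⟨h1, h2⟩ := ih (g ∘ fun p => false :: p) (hg.comp List.cons_injective)
    obtain ⟨h1', h2'⟩ := ih' (g ∘ fun p => true :: p) (hg.comp List.cons_injective)
    have hd : Disjoint (P.locate.mapTag (g ∘ fun p => false :: p)).sem.tags
        (Q.locate.mapTag (g ∘ fun p => true :: p)).sem.tags := by
      refine Set.disjoint_left.2 fun u hu hu' => ?_
      obtain ⟨p, rfl⟩ := CCS.tags_locate P _ hu
      obtain ⟨q, hq⟩ := CCS.tags_locate Q _ hu'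
      exact absurd (hg hq) (by simp)
    refine ⟨⟨h1, h1', hd⟩, h2.par h2' (CCS.good_sem h1) (CCS.good_sem h1') hd
      (fun e => (Set.image_comp _ _ _).symm) (fun e => (Set.image_comp _ _ _).symm)
      fun e e' => ?_⟩
    simp only [Set.image_comp, ← Set.image_union]
    rfl
  | res P a ih =>
    obtain ⟨h1, h2⟩ := ih g hg
    exact ⟨h1, h2.res (CCS.good_sem h1) a⟩

end

section

variable {N : Type u} {T T' : Type}

/-! ### Lifting computations along maps of tags -/

theorem CCS.mapTag_rename (g : T → T') (f : N → N) (P : CCS N T) :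
    (P.rename f).mapTag g = (P.mapTag g).rename f := by
  induction P with
  | nil => rfl
  | pre l t P ih => simp only [CCS.mapTag, CCS.rename, ih]
  | sum l s P k t Q ih ih' => simp only [CCS.mapTag, CCS.rename, ih, ih']
  | par P Q ih ih' => simp only [CCS.mapTag, CCS.rename, ih, ih']
  | res P a ih => simp only [CCS.mapTag, CCS.rename, ih]

theorem CCS.rename_rename_symm (f : N ≃ N) (P : CCS N T) : (P.rename f.symm).rename f = P := by
  have h : ∀ l : Action N, (l.rename f.symm).rename f = l :=
    Action.rename_rename f.apply_symm_apply
  induction P with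
  | nil => rfl
  | pre l t P ih => simp only [CCS.rename, ih, h]
  | sum l s P k t Q ih ih' => simp only [CCS.rename, ih, ih', h]
  | par P Q ih ih' => simp only [CCS.rename, ih, ih']
  | res P a ih => simp only [CCS.rename, ih, Equiv.apply_symm_apply]

theorem CCS.rename_symm_rename (f : N ≃ N) (P : CCS N T) : (P.rename f).rename f.symm = P :=
  CCS.rename_rename_symm f.symm P

theorem CCS.freeNames_mapTag (g : T → T') (P : CCS N T) : (P.mapTag g).freeNames = P.freeNames := by
  induction P with
  | nil => rfl
  | pre l t P ih => simp only [CCS.mapTag, CCS.freeNames, ih]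
  | sum l s P k t Q ih ih' => simp only [CCS.mapTag, CCS.freeNames, ih, ih']
  | par P Q ih ih' => simp only [CCS.mapTag, CCS.freeNames, ih, ih']
  | res P a ih => simp only [CCS.mapTag, CCS.freeNames, ih]

theorem Memory.freeNames_mapTag (g : T → T') (m : Memory N T) :
    (m.mapTag g).freeNames = m.freeNames := by
  induction m with
  | empty => rfl
  | fork m ih => exact ih
  | event i l t K m ih => simp only [Memory.mapTag, Memory.freeNames, ih, CCS.freeNames_mapTag]

theorem Memory.acts_mapTag (g : T → T') (m : Memory N T) : (m.mapTag g).acts = m.acts := by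
  induction m with
  | empty => rfl
  | fork m ih => exact ih
  | event i l t K m ih => simp only [Memory.mapTag, Memory.acts, ih]

theorem RCCS.ids_mapTag (g : T → T') (R : RCCS N T) : (R.mapTag g).ids = R.ids := by
  induction R with
  | thread m P => exact m.ids_mapTag g
  | par R S ih ih' => simp only [RCCS.mapTag, RCCS.ids, ih, ih']
  | res R a ih => exact ih

theorem RCCS.acts_mapTag (g : T → T') (R : RCCS N T) : (R.mapTag g).acts = R.acts := by
  induction R with
  | thread m P => exact m.acts_mapTag g
  | par R S ih ih' => simp only [RCCS.mapTag, RCCS.acts, ih, ih']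
  | res R a ih => exact ih

/-! ### Inversion of tag maps, and the lifting lemmas. -/

theorem CCS.mapTag_eq_pre {g : T → T'} {P : CCS N T} {l t Q} (h : P.mapTag g = .pre l t Q) :
    ∃ t₀ Q₀, P = .pre l t₀ Q₀ ∧ g t₀ = t ∧ Q₀.mapTag g = Q := by
  cases P <;> simp only [CCS.mapTag, CCS.pre.injEq, reduceCtorEq] at h
  obtain ⟨rfl, rfl, rfl⟩ := h
  exact ⟨_, _, rfl, rfl, rfl⟩

theorem CCS.mapTag_eq_sum {g : T → T'} {P : CCS N T} {l s Q k t S}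
    (h : P.mapTag g = .sum l s Q k t S) : ∃ s₀ Q₀ t₀ S₀, P = .sum l s₀ Q₀ k t₀ S₀ ∧ g s₀ = s ∧
      Q₀.mapTag g = Q ∧ g t₀ = t ∧ S₀.mapTag g = S := by
  cases P <;> simp only [CCS.mapTag, CCS.sum.injEq, reduceCtorEq] at h
  obtain ⟨rfl, rfl, rfl, rfl, rfl, rfl⟩ := h
  exact ⟨_, _, _, _, rfl, rfl, rfl, rfl, rfl⟩

theorem CCS.mapTag_eq_nil {g : T → T'} {P : CCS N T} (h : P.mapTag g = .nil) : P = .nil := by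
  cases P <;> simp only [CCS.mapTag, reduceCtorEq] at h
  rfl

theorem CCS.mapTag_eq_par {g : T → T'} {P : CCS N T} {Q S} (h : P.mapTag g = .par Q S) :
    ∃ Q₀ S₀, P = .par Q₀ S₀ ∧ Q₀.mapTag g = Q ∧ S₀.mapTag g = S := by
  cases P <;> simp only [CCS.mapTag, CCS.par.injEq, reduceCtorEq] at h
  exact ⟨_, _, rfl, h⟩

theorem CCS.mapTag_eq_res {g : T → T'} {P : CCS N T} {Q a} (h : P.mapTag g = .res Q a) :
    ∃ Q₀, P = .res Q₀ a ∧ Q₀.mapTag g = Q := by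
  cases P <;> simp only [CCS.mapTag, CCS.res.injEq, reduceCtorEq] at h
  obtain ⟨rfl, rfl⟩ := h
  exact ⟨_, rfl, rfl⟩

theorem Memory.mapTag_eq_fork {g : T → T'} {m : Memory N T} {m'} (h : m.mapTag g = .fork m') :
    ∃ m₀, m = .fork m₀ ∧ m₀.mapTag g = m' := by
  cases m <;> simp only [Memory.mapTag, Memory.fork.injEq, reduceCtorEq] at h
  exact ⟨_, rfl, h⟩

theorem Memory.mapTag_eq_event {g : T → T'} {m : Memory N T} {i l t K m'}
    (h : m.mapTag g = .event i l t K m') : ∃ t₀ K₀ m₀, m = .event i l t₀ K₀ m₀ ∧ g t₀ = t ∧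
      K₀.mapTag g = K ∧ m₀.mapTag g = m' := by
  cases m <;> simp only [Memory.mapTag, Memory.event.injEq, reduceCtorEq] at h
  obtain ⟨rfl, rfl, rfl, rfl, rfl⟩ := h
  exact ⟨_, _, _, rfl, rfl, rfl, rfl⟩

theorem RCCS.mapTag_eq_thread {g : T → T'} {R : RCCS N T} {m P}
    (h : R.mapTag g = .thread m P) : ∃ m₀ P₀, R = .thread m₀ P₀ ∧ m₀.mapTag g = m ∧
      P₀.mapTag g = P := by
  cases R <;> simp only [RCCS.mapTag, RCCS.thread.injEq, reduceCtorEq] at h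
  exact ⟨_, _, rfl, h⟩

theorem RCCS.mapTag_eq_par {g : T → T'} {R : RCCS N T} {Q S} (h : R.mapTag g = .par Q S) :
    ∃ Q₀ S₀, R = .par Q₀ S₀ ∧ Q₀.mapTag g = Q ∧ S₀.mapTag g = S := by
  cases R <;> simp only [RCCS.mapTag, RCCS.par.injEq, reduceCtorEq] at h
  exact ⟨_, _, rfl, h⟩

theorem RCCS.mapTag_eq_res {g : T → T'} {R : RCCS N T} {Q a} (h : R.mapTag g = .res Q a) :
    ∃ Q₀, R = .res Q₀ a ∧ Q₀.mapTag g = Q := by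
  cases R <;> simp only [RCCS.mapTag, RCCS.res.injEq, reduceCtorEq] at h
  obtain ⟨rfl, rfl⟩ := h
  exact ⟨_, rfl, rfl⟩

/-- Both directions are carried along because of `symm`; a change of bound name is lifted backward
by the inverse renaming. -/
theorem CCS.AlphaEq.lift {P Q : CCS N T'} (h : P.AlphaEq Q) (g : T → T') :
    (∀ P₀ : CCS N T, P₀.mapTag g = P → ∃ Q₀, P₀.AlphaEq Q₀ ∧ Q₀.mapTag g = Q) ∧
      ∀ Q₀ : CCS N T, Q₀.mapTag g = Q → ∃ P₀, Q₀.AlphaEq P₀ ∧ P₀.mapTag g = P := by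
  induction h with
  | refl P => exact ⟨fun P₀ h => ⟨P₀, .refl _, h⟩, fun P₀ h => ⟨P₀, .refl _, h⟩⟩
  | symm _ ih => exact ih.symm
  | trans _ _ ih ih' =>
    constructor
    · intro P₀ h
      obtain ⟨Q₀, h1, h2⟩ := ih.1 P₀ h
      obtain ⟨S₀, h3, h4⟩ := ih'.1 Q₀ h2
      exact ⟨S₀, h1.trans h3, h4⟩
    · intro P₀ h
      obtain ⟨Q₀, h1, h2⟩ := ih'.2 P₀ h
      obtain ⟨S₀, h3, h4⟩ := ih.2 Q₀ h2
      exact ⟨S₀, h1.trans h3, h4⟩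
  | pre l t _ ih =>
    constructor <;> intro P₀ h0 <;> obtain ⟨t₀, Q₀, rfl, rfl, h⟩ := CCS.mapTag_eq_pre h0
    · obtain ⟨S₀, h1, rfl⟩ := ih.1 Q₀ h
      exact ⟨_, .pre l t₀ h1, rfl⟩
    · obtain ⟨S₀, h1, rfl⟩ := ih.2 Q₀ h
      exact ⟨_, .pre l t₀ h1, rfl⟩
  | sum l s k t _ _ ih ih' =>
    constructor <;> intro P₀ h0 <;>
      obtain ⟨s₀, Q₀, t₀, S₀, rfl, rfl, h, rfl, h'⟩ := CCS.mapTag_eq_sum h0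
    · obtain ⟨Q₁, h1, rfl⟩ := ih.1 Q₀ h
      obtain ⟨S₁, h1', rfl⟩ := ih'.1 S₀ h'
      exact ⟨_, .sum l s₀ k t₀ h1 h1', rfl⟩
    · obtain ⟨Q₁, h1, rfl⟩ := ih.2 Q₀ h
      obtain ⟨S₁, h1', rfl⟩ := ih'.2 S₀ h'
      exact ⟨_, .sum l s₀ k t₀ h1 h1', rfl⟩
  | par _ _ ih ih' =>
    constructor <;> intro P₀ h0 <;> obtain ⟨Q₀, S₀, rfl, h, h'⟩ := CCS.mapTag_eq_par h0
    · obtain ⟨Q₁, h1, rfl⟩ := ih.1 Q₀ h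
      obtain ⟨S₁, h1', rfl⟩ := ih'.1 S₀ h'
      exact ⟨_, .par h1 h1', rfl⟩
    · obtain ⟨Q₁, h1, rfl⟩ := ih.2 Q₀ h
      obtain ⟨S₁, h1', rfl⟩ := ih'.2 S₀ h'
      exact ⟨_, .par h1 h1', rfl⟩
  | res a _ ih =>
    constructor <;> intro P₀ h0 <;> obtain ⟨Q₀, rfl, h⟩ := CCS.mapTag_eq_res h0
    · obtain ⟨Q₁, h1, rfl⟩ := ih.1 Q₀ h
      exact ⟨_, .res a h1, rfl⟩
    · obtain ⟨Q₁, h1, rfl⟩ := ih.2 Q₀ h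
      exact ⟨_, .res a h1, rfl⟩
  | bound P a f hf =>
    have key : ∀ Q₀ : CCS N T, Q₀.mapTag g = P →
        CCS.AlphaEq (.res Q₀ a) (.res (Q₀.rename f) (f a)) := by
      rintro Q₀ rfl
      rw [CCS.freeNames_mapTag] at hf
      exact .bound Q₀ a f hf
    constructor <;> intro P₀ h0 <;> obtain ⟨Q₀, rfl, h⟩ := CCS.mapTag_eq_res h0
    · exact ⟨_, key Q₀ h, by rw [CCS.mapTag, CCS.mapTag_rename, h]⟩
    · have h' : (Q₀.rename f.symm).mapTag g = P := by
        rw [CCS.mapTag_rename, h, CCS.rename_symm_rename]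
      refine ⟨.res (Q₀.rename f.symm) a, ?_, by rw [CCS.mapTag, h']⟩
      have := key _ h'
      rw [CCS.rename_rename_symm] at this
      exact this.symm

/-- The derivation is there for undoing a distribution: memories that agree after forgetting tags
might differ before, but both threads derive from one forked memory. -/
theorem RCCS.Cong.lift {R S : RCCS N T'} (h : R.Cong S) (g : T → T') :
    (∀ (R₀ : RCCS N T) m s, R₀.mapTag g = R → s.lin → Der R₀ m s →
        ∃ S₀, R₀.Cong S₀ ∧ S₀.mapTag g = S) ∧
      ∀ (S₀ : RCCS N T) m s, S₀.mapTag g = S → s.lin → Der S₀ m s →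
        ∃ R₀, S₀.Cong R₀ ∧ R₀.mapTag g = R := by
  induction h with
  | refl R => exact ⟨fun R₀ _ _ h _ _ => ⟨R₀, .refl _, h⟩, fun R₀ _ _ h _ _ => ⟨R₀, .refl _, h⟩⟩
  | symm _ ih => exact ih.symm
  | trans _ _ ih ih' =>
    constructor
    · intro R₀ m s h hs hD
      obtain ⟨S₀, h1, h2⟩ := ih.1 R₀ m s h hs hD
      obtain ⟨U₀, h3, h4⟩ := ih'.1 S₀ m s h2 hs ((h1.der_iff m s hs).1 hD)
      exact ⟨U₀, h1.trans h3, h4⟩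
    · intro R₀ m s h hs hD
      obtain ⟨S₀, h1, h2⟩ := ih'.2 R₀ m s h hs hD
      obtain ⟨U₀, h3, h4⟩ := ih.2 S₀ m s h2 hs ((h1.der_iff m s hs).1 hD)
      exact ⟨U₀, h1.trans h3, h4⟩
  | par _ _ ih ih' =>
    constructor <;> intro R₀ m s h0 hs hD <;> obtain ⟨Q₀, S₀, rfl, h, h'⟩ := RCCS.mapTag_eq_par h0 <;>
      obtain ⟨m', s₁, s₂, -, hs₁, hs₂, hD₁, hD₂⟩ := hD.of_par hs
    · obtain ⟨Q₁, h1, rfl⟩ := ih.1 Q₀ _ _ h hs₁ hD₁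
      obtain ⟨S₁, h1', rfl⟩ := ih'.1 S₀ _ _ h' hs₂ hD₂
      exact ⟨_, .par h1 h1', rfl⟩
    · obtain ⟨Q₁, h1, rfl⟩ := ih.2 Q₀ _ _ h hs₁ hD₁
      obtain ⟨S₁, h1', rfl⟩ := ih'.2 S₀ _ _ h' hs₂ hD₂
      exact ⟨_, .par h1 h1', rfl⟩
  | res a _ ih =>
    constructor <;> intro R₀ m s h0 hs hD <;> obtain ⟨Q₀, rfl, h⟩ := RCCS.mapTag_eq_res h0 <;>
      obtain ⟨s', rfl, -, hD⟩ := hD.of_res hs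
    · obtain ⟨Q₁, h1, rfl⟩ := ih.1 Q₀ _ s' h hs hD
      exact ⟨_, .res a h1, rfl⟩
    · obtain ⟨Q₁, h1, rfl⟩ := ih.2 Q₀ _ s' h hs hD
      exact ⟨_, .res a h1, rfl⟩
  | distribution m P Q =>
    constructor
    · intro R₀ m s h0 hs hD
      obtain ⟨m₀, P₀, rfl, rfl, h⟩ := RCCS.mapTag_eq_thread h0
      obtain ⟨Q₀, S₀, rfl, rfl, rfl⟩ := CCS.mapTag_eq_par h
      exact ⟨_, .distribution _ _ _, rfl⟩
    · intro R₀ m s h0 hs hD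
      obtain ⟨R₁, R₂, rfl, h1, h2⟩ := RCCS.mapTag_eq_par h0
      obtain ⟨m₁, P₁, rfl, h3, rfl⟩ := RCCS.mapTag_eq_thread h1
      obtain ⟨m₁, rfl, rfl⟩ := Memory.mapTag_eq_fork h3
      obtain ⟨m₂, P₂, rfl, h4, rfl⟩ := RCCS.mapTag_eq_thread h2
      obtain ⟨m₂, rfl, -⟩ := Memory.mapTag_eq_fork h4
      obtain ⟨m', s₁, s₂, -, -, -, hD₁, hD₂⟩ := hD.of_par hs
      obtain rfl := hD₁.above.fork_eq
      obtain rfl := hD₂.above.fork_eq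
      exact ⟨_, (RCCS.Cong.distribution _ _ _).symm, rfl⟩
  | scope m P a ha =>
    constructor
    · intro R₀ m s h0 hs hD
      obtain ⟨m₀, P₀, rfl, rfl, h⟩ := RCCS.mapTag_eq_thread h0
      obtain ⟨Q₀, rfl, rfl⟩ := CCS.mapTag_eq_res h
      rw [Memory.freeNames_mapTag] at ha
      exact ⟨_, .scope _ _ _ ha, rfl⟩
    · intro R₀ m s h0 hs hD
      obtain ⟨Q₀, rfl, h⟩ := RCCS.mapTag_eq_res h0
      obtain ⟨m₀, P₀, rfl, rfl, rfl⟩ := RCCS.mapTag_eq_thread h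
      rw [Memory.freeNames_mapTag] at ha
      exact ⟨_, (RCCS.Cong.scope _ _ _ ha).symm, rfl⟩
  | alpha m h =>
    obtain ⟨hl, hl'⟩ := h.lift g
    constructor <;> intro R₀ m s h0 hs hD <;>
      obtain ⟨m₀, P₀, rfl, rfl, h⟩ := RCCS.mapTag_eq_thread h0
    · obtain ⟨Q₀, h1, rfl⟩ := hl P₀ h
      exact ⟨_, .alpha _ h1, rfl⟩
    · obtain ⟨Q₀, h1, rfl⟩ := hl' P₀ h
      exact ⟨_, .alpha _ h1, rfl⟩

theorem RCCS.Fwd.lift {R R' : RCCS N T'} {i α} (h : R.Fwd i α R') (g : T → T') :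
    ∀ (R₀ : RCCS N T) m s, R₀.mapTag g = R → s.lin → Der R₀ m s →
      ∃ R₀', R₀.Fwd i α R₀' ∧ R₀'.mapTag g = R' := by
  induction h with
  | act m i l t P hi =>
    intro R₀ _ _ h0 _ _
    obtain ⟨m₀, P₀, rfl, rfl, h⟩ := RCCS.mapTag_eq_thread h0
    obtain ⟨t₀, Q₀, rfl, rfl, rfl⟩ := CCS.mapTag_eq_pre h
    rw [Memory.ids_mapTag] at hi
    exact ⟨_, .act _ _ _ _ _ hi, rfl⟩
  | act_left m i l t P k u Q hi =>
    intro R₀ _ _ h0 _ _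
    obtain ⟨m₀, P₀, rfl, rfl, h⟩ := RCCS.mapTag_eq_thread h0
    obtain ⟨s₀, Q₀, t₀, S₀, rfl, rfl, rfl, rfl, rfl⟩ := CCS.mapTag_eq_sum h
    rw [Memory.ids_mapTag] at hi
    exact ⟨_, .act_left _ _ _ _ _ _ _ _ hi, rfl⟩
  | act_right m i l t P k u Q hi =>
    intro R₀ _ _ h0 _ _
    obtain ⟨m₀, P₀, rfl, rfl, h⟩ := RCCS.mapTag_eq_thread h0
    obtain ⟨s₀, Q₀, t₀, S₀, rfl, rfl, rfl, rfl, rfl⟩ := CCS.mapTag_eq_sum h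
    rw [Memory.ids_mapTag] at hi
    exact ⟨_, .act_right _ _ _ _ _ _ _ _ hi, rfl⟩
  | syn _ _ ih ih' =>
    intro R₀ m s h0 hs hD
    obtain ⟨Q₀, S₀, rfl, h, h'⟩ := RCCS.mapTag_eq_par h0
    obtain ⟨m', s₁, s₂, -, hs₁, hs₂, hD₁, hD₂⟩ := hD.of_par hs
    obtain ⟨Q₁, h1, rfl⟩ := ih Q₀ _ _ h hs₁ hD₁
    obtain ⟨S₁, h1', rfl⟩ := ih' S₀ _ _ h' hs₂ hD₂
    exact ⟨_, .syn h1 h1', rfl⟩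
  | par_left S hi _ ih =>
    intro R₀ m s h0 hs hD
    obtain ⟨Q₀, S₀, rfl, h, rfl⟩ := RCCS.mapTag_eq_par h0
    obtain ⟨m', s₁, s₂, -, hs₁, hs₂, hD₁, hD₂⟩ := hD.of_par hs
    obtain ⟨Q₁, h1, rfl⟩ := ih Q₀ _ _ h hs₁ hD₁
    rw [RCCS.ids_mapTag] at hi
    exact ⟨_, .par_left _ hi h1, rfl⟩
  | par_right R hi _ ih =>
    intro R₀ m s h0 hs hD
    obtain ⟨Q₀, S₀, rfl, rfl, h⟩ := RCCS.mapTag_eq_par h0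
    obtain ⟨m', s₁, s₂, -, hs₁, hs₂, hD₁, hD₂⟩ := hD.of_par hs
    obtain ⟨S₁, h1, rfl⟩ := ih S₀ _ _ h hs₂ hD₂
    rw [RCCS.ids_mapTag] at hi
    exact ⟨_, .par_right _ hi h1, rfl⟩
  | res a ha _ ih =>
    intro R₀ m s h0 hs hD
    obtain ⟨Q₀, rfl, h⟩ := RCCS.mapTag_eq_res h0
    obtain ⟨s', rfl, -, hD⟩ := hD.of_res hs
    obtain ⟨Q₁, h1, rfl⟩ := ih Q₀ _ s' h hs hD
    exact ⟨_, .res a ha h1, rfl⟩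
  | cong hc _ hc' ih =>
    intro R₀ m s h hs hD
    obtain ⟨R₁, h1, h2⟩ := (hc.lift g).1 R₀ m s h hs hD
    have hD₁ := (h1.der_iff m s hs).1 hD
    obtain ⟨R₂, h3, h4⟩ := ih R₁ m s h2 hs hD₁
    obtain ⟨R₃, h5, h6⟩ := (hc'.lift g).1 R₂ m s h4 hs (h3.der m s hs hD₁).1
    exact ⟨R₃, .cong h1 h3 h5, h6⟩

/-- The memory event stores the tag of the executed prefix and the tagged alternative, so the tagged
source can be rebuilt from the target. -/
theorem RCCS.Fwd.lift_bwd {R R' : RCCS N T'} {i α} (h : R.Fwd i α R') (g : T → T') :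
    ∀ (R₀' : RCCS N T) m s, R₀'.mapTag g = R' → s.lin → i ∉ m.ids → Der R₀' m s →
      ∃ R₀ : RCCS N T, R₀.Fwd i α R₀' ∧ R₀.mapTag g = R := by
  induction h with
  | act m i l t P hi =>
    intro R₀ _ _ h0 _ _ _
    obtain ⟨m₀, P₀, rfl, h, rfl⟩ := RCCS.mapTag_eq_thread h0
    obtain ⟨t₀, K₀, m₀, rfl, rfl, h', rfl⟩ := Memory.mapTag_eq_event h
    obtain rfl := CCS.mapTag_eq_nil h'
    rw [Memory.ids_mapTag] at hi
    exact ⟨_, .act _ _ _ _ _ hi, rfl⟩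
  | act_left m i l t P k u Q hi =>
    intro R₀ _ _ h0 _ _ _
    obtain ⟨m₀, P₀, rfl, h, rfl⟩ := RCCS.mapTag_eq_thread h0
    obtain ⟨t₀, K₀, m₀, rfl, rfl, h', rfl⟩ := Memory.mapTag_eq_event h
    obtain ⟨u₀, Q₀, rfl, rfl, rfl⟩ := CCS.mapTag_eq_pre h'
    rw [Memory.ids_mapTag] at hi
    exact ⟨_, .act_left _ _ _ _ _ _ _ _ hi, rfl⟩
  | act_right m i l t P k u Q hi =>
    intro R₀ _ _ h0 _ _ _
    obtain ⟨m₀, P₀, rfl, h, rfl⟩ := RCCS.mapTag_eq_thread h0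
    obtain ⟨t₀, K₀, m₀, rfl, rfl, h', rfl⟩ := Memory.mapTag_eq_event h
    obtain ⟨u₀, Q₀, rfl, rfl, rfl⟩ := CCS.mapTag_eq_pre h'
    rw [Memory.ids_mapTag] at hi
    exact ⟨_, .act_right _ _ _ _ _ _ _ _ hi, rfl⟩
  | syn hF hF' ih ih' =>
    intro R₀ m s h0 hs _ hD
    obtain ⟨Q₀, S₀, rfl, rfl, rfl⟩ := RCCS.mapTag_eq_par h0
    obtain ⟨m', s₁, s₂, -, hs₁, hs₂, hD₁, hD₂⟩ := hD.of_par hs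
    have him := fun hi => (Memory.mem_ids_iff_acts.1 hi).elim
      (hF.notMem_shared hF' (A := m'.acts) (by rw [RCCS.acts_mapTag]; exact hD₁.acts_subset)
        (by rw [RCCS.acts_mapTag]; exact hD₂.acts_subset))
    obtain ⟨Q₁, h1, rfl⟩ := ih Q₀ (.fork m') _ rfl hs₁ him hD₁
    obtain ⟨S₁, h1', rfl⟩ := ih' S₀ (.fork m') _ rfl hs₂ him hD₂
    exact ⟨_, .syn h1 h1', rfl⟩
  | par_left S hi _ ih =>
    intro R₀ m s h0 hs _ hD
    obtain ⟨Q₀, S₀, rfl, h, rfl⟩ := RCCS.mapTag_eq_par h0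
    obtain ⟨m', s₁, s₂, -, hs₁, hs₂, hD₁, hD₂⟩ := hD.of_par hs
    rw [RCCS.ids_mapTag] at hi
    obtain ⟨Q₁, h1, rfl⟩ := ih Q₀ _ _ h hs₁ (fun h => hi (hD₂.ids_subset h)) hD₁
    exact ⟨_, .par_left _ hi h1, rfl⟩
  | par_right R hi _ ih =>
    intro R₀ m s h0 hs _ hD
    obtain ⟨Q₀, S₀, rfl, rfl, h⟩ := RCCS.mapTag_eq_par h0
    obtain ⟨m', s₁, s₂, -, hs₁, hs₂, hD₁, hD₂⟩ := hD.of_par hs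
    rw [RCCS.ids_mapTag] at hi
    obtain ⟨S₁, h1, rfl⟩ := ih S₀ _ _ h hs₂ (fun h => hi (hD₁.ids_subset h)) hD₂
    exact ⟨_, .par_right _ hi h1, rfl⟩
  | res a ha _ ih =>
    intro R₀ m s h0 hs him hD
    obtain ⟨Q₀, rfl, h⟩ := RCCS.mapTag_eq_res h0
    obtain ⟨s', rfl, -, hD⟩ := hD.of_res hs
    obtain ⟨Q₁, h1, rfl⟩ := ih Q₀ _ s' h hs him hD
    exact ⟨_, .res a ha h1, rfl⟩
  | cong hc _ hc' ih =>
    intro R₀ m s h hs him hD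
    obtain ⟨R₁, h1, h2⟩ := (hc'.lift g).2 R₀ m s h hs hD
    have hD₁ := (h1.der_iff m s hs).1 hD
    obtain ⟨R₂, h3, h4⟩ := ih R₁ m s h2 hs him hD₁
    obtain ⟨R₃, h5, h6⟩ := (hc.lift g).2 R₂ m s h4 hs (h3.der_bwd m s hs him hD₁)
    exact ⟨R₃, .cong h5.symm h3 h1.symm, h6⟩

theorem RCCS.Steps.lift {R S : RCCS N T'} (h : R.Steps S) (g : T → T') {R₀ : RCCS N T}
    {s : Sem N T} (hs : s.lin) (hD : Der R₀ .empty s) (hR : R₀.mapTag g = R) :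
    ∃ S₀, R₀.Steps S₀ ∧ S₀.mapTag g = S := by
  induction h with
  | refl => exact ⟨R₀, .refl, hR⟩
  | tail _ h ih =>
    obtain ⟨S₀, h1, h2⟩ := ih
    have hD' := h1.der hs hD
    obtain ⟨i, α, h | h⟩ := h
    · obtain ⟨S₁, h3, h4⟩ := h.lift g S₀ _ _ h2 hs hD'
      exact ⟨S₁, h1.tail ⟨i, α, Or.inl h3⟩, h4⟩
    · obtain ⟨S₁, h3, h4⟩ := RCCS.Fwd.lift_bwd h g S₀ .empty _ h2 hs id hD'
      exact ⟨S₁, h1.tail ⟨i, α, Or.inr h3⟩, h4⟩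

theorem CCS.mapTag_locate (P : CCS N Unit) (g : List Bool → Unit) : P.locate.mapTag g = P := by
  induction P generalizing g with
  | nil => rfl
  | pre l t P ih => simp only [CCS.locate, CCS.mapTag, CCS.mapTag_mapTag, ih]
  | sum l s P k t Q ih ih' => simp only [CCS.locate, CCS.mapTag, CCS.mapTag_mapTag, ih, ih']
  | par P Q ih ih' => simp only [CCS.locate, CCS.mapTag, CCS.mapTag_mapTag, ih, ih']
  | res P a ih => simp only [CCS.locate, CCS.mapTag, ih]

/-! ### Structures below a configuration of the tag encoding -/

/-- The structure `S` is isomorphic along `ψ` to the part of the encoding `s` below `X`. -/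
structure ConfStruct.Below {U : Type v} (S : ConfStruct U (Label N)) (s : Sem N T)
    (X : Set (Set T)) (ψ : U → Set T) : Prop where
  bij : Set.BijOn ψ S.E X
  lab : ∀ e ∈ S.E, s.evs (ψ e) (S.lab e)
  subset : ∀ x ∈ S.C, x ⊆ S.E
  conf : ∀ x ⊆ S.E, x ∈ S.C ↔ s.cfg (ψ '' x)

/-- All axioms are pulled back along `ψ` from `Sem.Good`, with `X` as common upper bound for every
family of configurations. -/
theorem ConfStruct.Below.isConf {U : Type v} [Finite U] {S : ConfStruct U (Label N)} {s : Sem N T}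
    {X : Set (Set T)} {ψ : U → Set T} (h : S.Below s X ψ) (hs : s.Good) (hX : s.cfg X) :
    S.IsConf where
  subset_events := h.subset
  finiteness := fun x hx e he => ⟨x, hx, Set.toFinite x, he, subset_rfl⟩
  coincidence_free := by
    intro x hx e he e' he' hne
    have hxE := h.subset x hx
    obtain ⟨Z, hZ, hcZ, hsep⟩ := hs.separated _ ((h.conf x hxE).1 hx) _ ⟨e, he, rfl⟩ _
      ⟨e', he', rfl⟩ fun h' => hne (h.bij.injOn (hxE he) (hxE he') h')
    obtain ⟨z, hz, rfl⟩ := Set.subset_image_iff.1 hZ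
    have hzE := hz.trans hxE
    rw [h.bij.injOn.mem_image_iff hzE (hxE he), h.bij.injOn.mem_image_iff hzE (hxE he')] at hsep
    exact ⟨z, (h.conf z hzE).2 hcZ, hz, hsep⟩
  finite_complete := by
    intro 𝒳 h𝒳 _
    have hE : ⋃₀ 𝒳 ⊆ S.E := Set.sUnion_subset fun x hx => h.subset x (h𝒳 hx)
    rw [h.conf _ hE, Set.sUnion_eq_biUnion, Set.image_iUnion₂, ← Set.sUnion_image]
    refine hs.sUnion X _ hX ?_
    rintro _ ⟨x, hx, rfl⟩
    have hxE := h.subset x (h𝒳 hx)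
    exact ⟨(h.conf x hxE).1 (h𝒳 hx), (Set.image_mono hxE).trans h.bij.image_eq.le⟩
  stable := by
    intro x hx y hy hxy
    have hxE := h.subset x hx
    have hyE := h.subset y hy
    rw [h.conf _ (Set.inter_subset_left.trans hxE), h.bij.injOn.image_inter hxE hyE]
    exact hs.inter _ _ _ ((h.conf _ (h.subset _ hxy)).1 hxy) ((h.conf x hxE).1 hx)
      ((h.conf y hyE).1 hy) (Set.image_mono Set.subset_union_left)
      (Set.image_mono Set.subset_union_right)

/-- Both event sets are in bijection with `X`, and `s` alone determines the labels and the
configurations. -/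
theorem ConfStruct.Below.nonempty_iso {U : Type v} {V : Type w} {L : Type u}
    {S : ConfStruct U (Label L)} {S' : ConfStruct V (Label L)} {s : Sem L T} {X : Set (Set T)}
    {ψ : U → Set T} {ψ' : V → Set T} (h : S.Below s X ψ) (h' : S'.Below s X ψ') (hs : s.Good) :
    Nonempty (ConfStruct.Iso.{u, v, w} (L := Label L) S S') := by
  let f : S.E ≃ S'.E := (h.bij.equiv ψ).trans (h'.bij.equiv ψ').symm
  have hf : ∀ e, ψ' (f e) = ψ e := fun e =>
    congrArg Subtype.val ((h'.bij.equiv ψ').apply_symm_apply (h.bij.equiv ψ e))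
  refine ⟨⟨f, fun e => ?_, fun x => ?_⟩⟩
  · refine hs.label_unique (ψ e) _ _ ?_ (h.lab e e.2)
    rw [← hf]
    exact h'.lab _ (f e).2
  · have e1 : ψ' '' (Subtype.val '' (f '' x)) = ψ '' (Subtype.val '' x) := by
      simp only [Set.image_image, hf]
    rw [h.conf _ (Subtype.coe_image_subset _ _), h'.conf _ (Subtype.coe_image_subset _ _), e1]

/-- Over the empty memory, `ConfIds` is the predicate `s.cfg` on executed events, and distinct
identifiers execute disjoint tag sets. -/
theorem Rep.below {U : Type v} {D : IdConfStruct U (Label N) ℕ} {R : RCCS N T} {s : Sem N T}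
    (h : Rep D R .empty s) (hD : Der R .empty s) (hs : s.lin) :
    D.toConfStruct.Below s (R.trace .empty) fun e => R.ev (D.ident e) where
  bij := by
    refine ⟨fun e he => ⟨_, ⟨h.mem_ids he, id⟩, rfl⟩, fun e he e' he' hee => ?_, ?_⟩
    · obtain ⟨t, ht⟩ := RCCS.ev_nonempty.2 (h.mem_ids he)
      exact h.inj he he' (hD.id_unique hs _ _ t id id ht (hee.subset ht))
    · rintro _ ⟨i, ⟨hi, -⟩, rfl⟩
      rw [← h.image] at hi
      obtain ⟨e, he, rfl⟩ := hi
      exact ⟨e, he, rfl⟩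
  lab := fun e he => h.lab_ev e he id
  subset := h.subset
  conf := fun c hc => by
    rw [h.conf c hc, confIds_iff_of_subset (hD.good hs).cfg_empty (Set.empty_subset _),
      ← Set.image_image R.ev D.ident]
    simp only [Memory.ids, Set.sdiff_empty]

theorem Link.below {U : Type v} {S : ConfStruct U (Label N)} {s : Sem N T} {pos : U → Set T}
    (h : Link S s pos) {x : Set U} (hx : ∀ e ∈ x, e ∈ S.E) :
    (S.generated x).Below s (pos '' x) pos where
  bij := h.inj.injOn.bijOn_image
  lab := fun e he => (h.evs_pos e _).2 ⟨hx e he, rfl⟩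
  subset := fun _ hy => hy.2
  conf := fun y hy => (and_iff_left hy).trans (h.conf y)

end

end RevCCS

/-! ### The memory encoding and the address. -/

theorem mainTheorem2 {N : Type*} (P : RevCCS.CCS N Unit) (R : RevCCS.RCCS N Unit)
    (hR : R.HasOrigin P) :
    R.encMem.IsIdConf ∧
    (∃ x, RevCCS.IsAddress P R x) ∧
    ∀ x, RevCCS.IsAddress P R x →
      x ∈ P.enc.C ∧
      (P.enc.generated x).IsConf ∧
      Nonempty (RevCCS.ConfStruct.Iso R.encMem.toConfStruct (P.enc.generated x)) := by
  obtain ⟨hs, hL⟩ : P.locate.sem.lin ∧ RevCCS.Link P.enc P.locate.sem P.positions := by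
    have h := P.link_locate id Function.injective_id
    have hid : ∀ Q : RevCCS.CCS N (List Bool), Q.mapTag id = Q := fun Q => by
      induction Q <;> simp_all only [RevCCS.CCS.mapTag, id]
    simp only [hid, Set.image_id] at h
    exact h
  have hg := RevCCS.CCS.good_sem hs
  -- The tagged copy of the given computation provides an address.
  obtain ⟨R', hR', hRR'⟩ : ∃ R' : RevCCS.RCCS N (List Bool), R'.HasOrigin P.locate ∧
      R'.mapTag (fun _ => ()) = R := by
    refine RevCCS.RCCS.Steps.lift hR (fun _ => ()) hs (.base _ _) ?_
    rw [RevCCS.RCCS.mapTag, P.mapTag_locate]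
    rfl
  have key : ∀ R' : RevCCS.RCCS N (List Bool), R'.HasOrigin P.locate →
      R'.mapTag (fun _ => ()) = R → P.locate.sem.cfg (R'.trace .empty) ∧
      ∃ ψ, Set.InjOn R.encMem.ident R.encMem.E ∧
        R.encMem.toConfStruct.Below P.locate.sem (R'.trace .empty) ψ := by
    rintro R' hR' rfl
    have hD := RevCCS.RCCS.Steps.der hR' hs (.base _ _)
    have h := hD.rep (fun _ => ()) hs trivial
    exact ⟨hD.trace_cfg hs, _, h.inj, h.below hD hs⟩
  refine ⟨?_, ⟨_, R', hR', hRR', rfl⟩, ?_⟩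
  · obtain ⟨hc, ψ, hinj, hB⟩ := key R' hR' hRR'
    exact ⟨hB.isConf hg hc, fun x hx e he e' he' hne h =>
      hne (hinj (hB.subset x hx he) (hB.subset x hx he') h)⟩
  · rintro x ⟨R'', hR'', hRR'', rfl⟩
    obtain ⟨hc, ψ, -, hB⟩ := key R'' hR'' hRR''
    -- No executed tag set is missed by the address: the trace is a configuration, so each of its
    -- members is the position set of an event.
    have himg : P.positions '' {e | ∃ i ∈ R''.ids, P.positions e = {p | (i, p) ∈ R''.executed}} =
        R''.trace .empty := by
      ext A
      constructor
      · rintro ⟨e, ⟨i, hi, he⟩, rfl⟩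
        exact ⟨i, ⟨hi, id⟩, he.symm⟩
      · rintro ⟨i, hi, rfl⟩
        obtain ⟨α, hα⟩ := hg.exists_evs _ hc _ ⟨i, hi, rfl⟩
        obtain ⟨e, -, he, -⟩ := (hL.evs _ _).1 hα
        exact ⟨e, ⟨i, hi.1, he⟩, he⟩
    rw [← himg] at hc hB
    have hB' := hL.below (x := {e | ∃ i ∈ R''.ids, P.positions e = {p | (i, p) ∈ R''.executed}})
      fun e he => (hL.exists_evs_pos e).1 (hg.exists_evs _ hc _ ⟨e, he, rfl⟩)
    exact ⟨(hL.conf _).2 hc, hB'.isConf hg hc, hB.nonempty_iso hB' hg⟩
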